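/- **Theorem.** Let $\mathcal S$ be an o-minimal structure expanding the ordered field $(\mathbb R,<,0,1,+,\cdot)$, let $k\subset\mathbb R$ be a subfield, and let "definable" mean definable in $\mathcal S$ with parameters from $k$. Let $1\le p\le\infty$. A *definable $C^p$-manifold with corners* $M$ is a second countable Hausdorff space with a finite atlas of homeomorphisms $\phi_i\colon U_i\to V_i$, where $U_i\subset M$ is open, $V_i\subset\mathbb R^{n_i}\times\mathbb R_{\ge0}^{m_i}$ is relatively open and definable, and the transition maps $\phi_j\circ\phi_i^{-1}$ are definable and $C^p$ on their domains (i.e. they extend to $C^p$ maps on open neighbourhoods). A subset $G\subset M$ is *definable* if all $\phi_i(G\cap U_i)$ are definable; its dimension is the maximum of their o-minimal dimensions. For $d\ge0$ let $\mathrm{Reg}_d(G)$ be the set of points of $G$ that have an open neighbourhood $V$ in $M$ such that $G\cap V$ is an embedded $C^p$-submanifold (without boundary or corners) of $M$ of dimension $d$. A *pseudo-orientation* on a definable set $G$ of dimension $d$ is an equivalence class of pairs of a definable open subset $U\subset\mathrm{Reg}_d(G)$ with $\dim(G\setminus U)<d$ and an orientation on $U$, two pairs being equivalent if their orientations agree on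 the intersection. A *differential form of degree $d$ on $G$* is a continuous section $\omega\colon G\to\Lambda^dT^*M$; it is *definable* if its coefficients in the charts are definable functions. For $G$ with a pseudo-orientation represented by $U$, one puts $\int_G\omega:=\int_U\omega$ if the latter integral converges absolutely. Let $M$ be a definable $C^p$-manifold with corners, let $G\subset M$ be a compact definable subset of dimension $d$ with a pseudo-orientation, and let $\omega$ be a differential form of degree $d$ on $G$. Then $\int_G\omega$ converges absolutely (for every representative of the pseudo-orientation, with the same value). If, moreover, $\omega$ is definable, then this value is, up to sign, the volume (Lebesgue measure) of a definable bounded open subset of $\mathbb R^{d+1}$. -/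

import Mathlib

open FirstOrder MeasureTheory Set Topology

namespace OMin

/-! ### O-minimal structures on the real line -/

/-- The structure of `L` on `ℝ` has `<`, `0`, `1`, `+`, `·` (with their usual interpretations) among
its basic relations, constants and functions. -/
structure ExpandsOrderedField (L : Language) [L.Structure ℝ] : Prop where
  lt : ∃ R : L.Relations 2, ∀ x y : ℝ, Language.Structure.RelMap R ![x, y] ↔ x < y
  zero : ∃ c : L.Functions 0, Language.Structure.funMap c ![] = (0 : ℝ)
  one : ∃ c : L.Functions 0, Language.Structure.funMap c ![] = (1 : ℝ)
  add : ∃ f : L.Functions 2, ∀ x y : ℝ, Language.Structure.funMap f ![x, y] = x + y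
  mul : ∃ f : L.Functions 2, ∀ x y : ℝ, Language.Structure.funMap f ![x, y] = x * y

/-- `S` is a point or a (possibly unbounded) open interval. -/
def IsPointOrOpenInterval (S : Set ℝ) : Prop :=
  (∃ a, S = {a}) ∨ (∃ a b, S = Ioo a b) ∨ (∃ a, S = Ioi a) ∨ (∃ a, S = Iio a) ∨ S = univ

/-- The structure of `L` on `ℝ` is an o-minimal expansion of `(ℝ, <, 0, 1, +, ·)`. Definability is
with arbitrary real parameters here. -/
structure IsOMinimal (L : Language) [L.Structure ℝ] : Prop where
  expands : ExpandsOrderedField L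
  definable_iff : ∀ S : Set ℝ, (univ : Set ℝ).Definable₁ L S ↔
    ∃ F : Set (Set ℝ), F.Finite ∧ (∀ I ∈ F, IsPointOrOpenInterval I) ∧ S = ⋃₀ F

/-- The map `f`, considered on the domain `S ⊆ ℝ^α`, is definable with parameters from `k`: its graph
is a definable subset of `ℝ^α × ℝ^β = ℝ^(α ⊕ β)`. -/
def DefinableMapOn (L : Language) [L.Structure ℝ] (k : Subfield ℝ) {α β : Type*}
    (f : (α → ℝ) → (β → ℝ)) (S : Set (α → ℝ)) : Prop :=
  (k : Set ℝ).Definable L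
    {z : α ⊕ β → ℝ | (fun a => z (Sum.inl a)) ∈ S ∧
      (fun b => z (Sum.inr b)) = f (fun a => z (Sum.inl a))}

/-- The o-minimal dimension of a definable subset `A` of `ℝ^α`: the largest `e` such that the
projection of `A` to some choice of `e` distinct coordinates has non-empty interior (equivalently, the
largest dimension of a cell contained in `A`). It is `⊥` exactly for the empty set. -/
noncomputable def affineDim {α : Type*} (A : Set (α → ℝ)) : WithBot ℕ∞ :=
  ⨆ (e : ℕ) (_ : ∃ c : Fin e ↪ α, (interior ((fun (x : α → ℝ) (j : Fin e) => x (c j)) '' A)).Nonempty),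
    ((e : ℕ∞) : WithBot ℕ∞)

/-! ### Definable manifolds with corners -/

/-- `f` is of class `C^p` on the (arbitrary) set `A`: it extends to a `C^p` map on an open
neighbourhood of `A`. -/
def IsCpOn (p : ℕ∞) {α β : Type*} [Fintype α] [Fintype β] (f : (α → ℝ) → (β → ℝ))
    (A : Set (α → ℝ)) : Prop :=
  ∃ O : Set (α → ℝ), IsOpen O ∧ A ⊆ O ∧
    ∃ g : (α → ℝ) → (β → ℝ), ContDiffOn ℝ p g O ∧ EqOn f g A

/-- The space `ℝ^n × ℝ_{≥ 0}^m`, as a subset of `ℝ^(n + m)`. -/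
def quadrant (n m : ℕ) : Set (Fin n ⊕ Fin m → ℝ) :=
  {x | ∀ j : Fin m, 0 ≤ x (Sum.inr j)}

/-- A finite atlas that makes the topological space `M` into a definable `C^p`-manifold with corners
(definable in the given structure on `ℝ` with parameters from `k`). The Hausdorff property and second
countability of `M` are imposed separately, as type classes on `M`. -/
structure DefinableManifold (L : Language) [L.Structure ℝ] (k : Subfield ℝ) (p : ℕ∞)
    (M : Type*) [TopologicalSpace M] where
  /-- the number of charts -/
  r : ℕ
  n : Fin r → ℕ
  m : Fin r → ℕ
  /-- the charts `φ_i : U_i → V_i ⊆ ℝ^(n_i) × ℝ_{≥ 0}^(m_i)` -/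
  chart : (i : Fin r) → PartialEquiv M (Fin (n i) ⊕ Fin (m i) → ℝ)
  isOpen_source : ∀ i, IsOpen (chart i).source
  isOpen_target : ∀ i, ∃ O, IsOpen O ∧ (chart i).target = O ∩ quadrant (n i) (m i)
  continuousOn_chart : ∀ i, ContinuousOn (chart i) (chart i).source
  continuousOn_symm : ∀ i, ContinuousOn (chart i).symm (chart i).target
  cover : ∀ x, ∃ i, x ∈ (chart i).source
  definable_target : ∀ i, (k : Set ℝ).Definable L (chart i).target
  definable_transition : ∀ i j,
    DefinableMapOn L k ((chart i).symm.trans (chart j)) ((chart i).symm.trans (chart j)).source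
  contDiff_transition : ∀ i j,
    IsCpOn p ((chart i).symm.trans (chart j)) ((chart i).symm.trans (chart j)).source

namespace DefinableManifold

variable {L : Language} [L.Structure ℝ] {k : Subfield ℝ} {p : ℕ∞}
  {M : Type*} [TopologicalSpace M]

/-- The ambient space `ℝ^(n_i + m_i)` of the `i`-th chart. -/
abbrev Coord (X : DefinableManifold L k p M) (i : Fin X.r) : Type :=
  Fin (X.n i) ⊕ Fin (X.m i) → ℝ

/-- The transition map `φ_j ∘ φ_i⁻¹`, with its domain `φ_i(U_i ∩ U_j)`. -/
def transition (X : DefinableManifold L k p M) (i j : Fin X.r) :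
    PartialEquiv (X.Coord i) (X.Coord j) :=
  (X.chart i).symm.trans (X.chart j)

/-- The derivative of the transition map `φ_j ∘ φ_i⁻¹`. Its domain is relatively open in a
quadrant, so that the derivative within the domain is the derivative of any `C^1` extension. -/
noncomputable def transitionDeriv (X : DefinableManifold L k p M) (i j : Fin X.r)
    (y : X.Coord i) : X.Coord i →L[ℝ] X.Coord j :=
  fderivWithin ℝ (X.transition i j) (X.transition i j).source y

/-- The set `φ_i(G ∩ U_i)`. -/
def chartImage (X : DefinableManifold L k p M) (i : Fin X.r) (G : Set M) : Set (X.Coord i) :=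
  X.chart i '' (G ∩ (X.chart i).source)

/-- `G` is a definable subset of `M`. -/
def IsDefinable (X : DefinableManifold L k p M) (G : Set M) : Prop :=
  ∀ i, (k : Set ℝ).Definable L (X.chartImage i G)

/-- The dimension of a definable subset of `M`. -/
noncomputable def dim (X : DefinableManifold L k p M) (G : Set M) : WithBot ℕ∞ :=
  ⨆ i, affineDim (X.chartImage i G)

/-! ### Submanifolds and regular points -/

/-- A local `C^p`-parametrization of the subset `N` of `M`: a `C^p`-immersion `ψ` of an open
set `W ⊆ ℝ^d` into `M` that is a homeomorphism onto a (relatively) open subset of `N`. Its image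
lies in the domain of one chart of `M`, and `ψ` is written in this chart. -/
structure LocalParam (X : DefinableManifold L k p M) (d : ℕ) (N : Set M) where
  i : Fin X.r
  W : Set (Fin d → ℝ)
  ψ : (Fin d → ℝ) → X.Coord i
  isOpen_W : IsOpen W
  mapsTo : MapsTo ψ W (X.chart i).target
  contDiffOn : ContDiffOn ℝ p ψ W
  immersion : ∀ w ∈ W, Function.Injective (fderiv ℝ ψ w)
  isEmbedding : IsEmbedding (W.domRestrict ψ)
  isOpen_image : ∃ V : Set M, IsOpen V ∧ (X.chart i).symm '' (ψ '' W) = N ∩ V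

/-- The parametrization as a map to `M`. -/
def LocalParam.toM {X : DefinableManifold L k p M} {d : ℕ} {N : Set M}
    (P : X.LocalParam d N) (w : Fin d → ℝ) : M :=
  (X.chart P.i).symm (P.ψ w)

/-- `N` is an (embedded) `C^p`-submanifold of `M` of dimension `d` (without boundary or corners). -/
def IsSubmanifold (X : DefinableManifold L k p M) (d : ℕ) (N : Set M) : Prop :=
  ∀ x ∈ N, ∃ P : X.LocalParam d N, x ∈ P.toM '' P.W

/-- The set `Reg_d(G)` of the points of `G` near which `G` is a `C^p`-submanifold of dimension `d`. -/
def Reg (X : DefinableManifold L k p M) (d : ℕ) (G : Set M) : Set M :=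
  {x | x ∈ G ∧ ∃ V : Set M, IsOpen V ∧ x ∈ V ∧ X.IsSubmanifold d (G ∩ V)}

/-! ### Orientations and pseudo-orientations -/

/-- Let `P` and `Q` be local parametrizations with `P(w) = Q(v) = x` and the same tangent space `τ`
at `x`. Then `P` and `Q` induce bases of `τ`. An orientation of `τ` that gives the sign `s` to the
basis of `P` and the sign `t` to the basis of `Q` exists if and only if this relation holds: `s` and
`t` differ by the sign of the determinant of the base change `T`. -/
def SignsAgree {X : DefinableManifold L k p M} {d : ℕ} {N N' : Set M}
    (P : X.LocalParam d N) (w : Fin d → ℝ) (s : ℤˣ)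
    (Q : X.LocalParam d N') (v : Fin d → ℝ) (t : ℤˣ) : Prop :=
  ∀ T : (Fin d → ℝ) →L[ℝ] (Fin d → ℝ),
    (X.transitionDeriv P.i Q.i (P.ψ w)).comp (fderiv ℝ P.ψ w) = (fderiv ℝ Q.ψ v).comp T →
      (0 < T.det → s = t) ∧ (T.det < 0 → s = -t)

/-- An orientation on a `d`-dimensional submanifold `U` of `M`: an orientation of each tangent space,
locally constant on `U`. It is recorded by the signs `sgn P w` that the bases of the tangent spaces
induced by the local parametrizations `P` at the points `w` of their domains have. (For `d = 0` it is
the choice of a sign at each point.) -/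
structure OrientationOn (X : DefinableManifold L k p M) (d : ℕ) (U : Set M) where
  sgn : X.LocalParam d U → (Fin d → ℝ) → ℤˣ
  locallyConstant : ∀ (P : X.LocalParam d U), ∀ w ∈ P.W, ∀ᶠ w' in 𝓝 w, sgn P w' = sgn P w
  compatible : ∀ (P Q : X.LocalParam d U), ∀ w ∈ P.W, ∀ v ∈ Q.W, P.toM w = Q.toM v →
    SignsAgree P w (sgn P w) Q v (sgn Q v)

/-- A representative of a pseudo-orientation on `G`: a definable open subset `U` of `Reg_d(G)` with
`dim (G \ U) < d` and an orientation on `U`. -/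
structure PseudoOrientation (X : DefinableManifold L k p M) (d : ℕ) (G : Set M) where
  U : Set M
  isDefinable : X.IsDefinable U
  isOpen : ∃ V : Set M, IsOpen V ∧ U = X.Reg d G ∩ V
  dim_lt : X.dim (G \ U) < ((d : ℕ∞) : WithBot ℕ∞)
  orientation : X.OrientationOn d U

/-- Two representatives define the same pseudo-orientation: the orientations agree on the
intersection. -/
def PseudoOrientation.Equivalent {X : DefinableManifold L k p M} {d : ℕ} {G : Set M}
    (o o' : X.PseudoOrientation d G) : Prop :=
  ∀ (P : X.LocalParam d o.U) (Q : X.LocalParam d o'.U), ∀ w ∈ P.W, ∀ v ∈ Q.W,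
    P.toM w = Q.toM v →
      SignsAgree P w (o.orientation.sgn P w) Q v (o'.orientation.sgn Q v)

/-! ### Differential forms and their integrals -/

/-- A differential form of degree `d` on `G`: a continuous section over `G` of `Λ^d T^*M`. In the
chart `i` it is a continuous map from `G ∩ U_i` to the alternating `d`-forms on `ℝ^(n_i + m_i)`. -/
structure DiffForm (X : DefinableManifold L k p M) (d : ℕ) (G : Set M) where
  toFun : (i : Fin X.r) → M → (X.Coord i [⋀^Fin d]→L[ℝ] ℝ)
  continuousOn : ∀ i, ContinuousOn (toFun i) (G ∩ (X.chart i).source)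
  compatible : ∀ i j, ∀ x ∈ G, x ∈ (X.chart i).source → x ∈ (X.chart j).source →
    toFun i x =
      (toFun j x).compContinuousLinearMap (X.transitionDeriv i j (X.chart i x))

/-- The form is definable: in each chart, its coefficients (the values on tuples of standard basis
vectors) are definable functions on `φ_i(G ∩ U_i)`. -/
def DiffForm.IsDefinable {X : DefinableManifold L k p M} {d : ℕ} {G : Set M}
    (ω : X.DiffForm d G) : Prop :=
  ∀ (i : Fin X.r) (c : Fin d → Fin (X.n i) ⊕ Fin (X.m i)),
    DefinableMapOn L k
      (fun (y : X.Coord i) (_ : Unit) =>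
        ω.toFun i ((X.chart i).symm y) (fun l => Pi.single (c l) (1 : ℝ)))
      (X.chartImage i G)

/-- The coefficient function `a` of the pull-back `ψ^* ω = a dw_1 ∧ ⋯ ∧ dw_d` of `ω` along a local
parametrization `ψ : W → M`. -/
noncomputable def DiffForm.pullbackCoeff {X : DefinableManifold L k p M} {d : ℕ} {G N : Set M}
    (ω : X.DiffForm d G) (P : X.LocalParam d N) (w : Fin d → ℝ) : ℝ :=
  ω.toFun P.i (P.toM w) (fun l => fderiv ℝ P.ψ w (Pi.single l 1))

/-- A decomposition of `U` into countably many disjoint Borel pieces, each of them presented as the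
image of a Borel set under a local parametrization of `U`. -/
structure ParamPartition (X : DefinableManifold L k p M) (d : ℕ) (U : Set M) where
  param : ℕ → X.LocalParam d U
  B : ℕ → Set (Fin d → ℝ)
  measurableSet : ∀ j, MeasurableSet (B j)
  subset : ∀ j, B j ⊆ (param j).W
  disjoint : Pairwise fun j l => Disjoint ((param j).toM '' B j) ((param l).toM '' B l)
  cover : ⋃ j, (param j).toM '' B j = U

/-- The integral of the `d`-form `ω` over the oriented `d`-dimensional manifold `U` converges
absolutely, and its value is `I`: for every decomposition of `U` into countably many disjoint
parametrized pieces, the sum of the integrals of `|ω|` over the pieces is finite and the sum of the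
integrals of `ω` is `I`; and there is such a decomposition. -/
def OrientationOn.HasIntegral {X : DefinableManifold L k p M} {d : ℕ} {G U : Set M}
    (o : X.OrientationOn d U) (ω : X.DiffForm d G) (I : ℝ) : Prop :=
  Nonempty (X.ParamPartition d U) ∧
  ∀ D : X.ParamPartition d U,
    (∀ j, IntegrableOn (ω.pullbackCoeff (D.param j)) (D.B j) volume) ∧
    Summable (fun j => ∫ w in D.B j, |ω.pullbackCoeff (D.param j) w|) ∧
    HasSum (fun j => ∫ w in D.B j,
      (((o.sgn (D.param j) w : ℤˣ) : ℤ) : ℝ) * ω.pullbackCoeff (D.param j) w) I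

/-- The integral of `ω` over the pseudo-oriented set `G` converges absolutely, and its value is `I`:
this is the integral over `U`, for every representative of the pseudo-orientation. -/
def PseudoOrientation.HasIntegral {X : DefinableManifold L k p M} {d : ℕ} {G : Set M}
    (o : X.PseudoOrientation d G) (ω : X.DiffForm d G) (I : ℝ) : Prop :=
  ∀ o' : X.PseudoOrientation d G, o.Equivalent o' → o'.orientation.HasIntegral ω I

end DefinableManifold

end OMin

/-! Cut `G` into finitely many disjoint definable pieces, each inside a compact subset of one chart
domain. In a chart, the pull-back of `ω` is a combination of `d × d` coordinate minors, with
coefficients that are continuous and hence bounded on the compact set. Fix a choice `c` of `d`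
coordinates. Where `c` is nondegenerate on the oriented set `U`, the projection to `ℝ^d` has
discrete fibres. By o-minimality this part of `U` is, up to sets with null projection, a finite
union of graphs of continuous definable sections over open connected sets `D ⊆ ℝ^d`
(`Tame.exists_sections`), and `D` is bounded by compactness. Elsewhere the minor of `c` vanishes.
Along a graph, the change of variables turns the contribution of `c` into the integral of a bounded
function over `D` (`ParamPartition.integral_overSection`), and the sign of the orientation relative
to `c` is constant because `D` is connected. So the integral converges absolutely and is a finite
signed sum of integrals over such `D` (`OrientedSections.hasIntegral`). Another representative of
the pseudo-orientation differs by sets of dimension less than `d`, whose projections are null; hence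
the value is the same.

The set `U` is definable but its parametrizations need not be. Nondegeneracy of `c` is therefore
expressed by a first-order bi-Lipschitz condition on `U` itself (`lipSet`), which is equivalent to
the nonvanishing of the Jacobian.

If `ω` is definable, the signed sum is the integral of a single definable, bounded function `h` with
bounded support. Suppose that it is positive. Add a large integer constant to `h` over a box with
integer sides: the region below the graph has volume `∫ h` plus an integer. Removing from its
interior finitely many closed rational boxes of exactly this total volume leaves an open set of
volume `∫ h` (`exists_volume_eq_integral_of_pos`).

The o-minimal input is proved by induction on `n` for three generic properties of `ℝ^n`, collected
in `Tame`: a Baire property for countable families of definable sets, generic continuity of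
definable functions, and decomposition into finitely many open connected definable sets. Exceptional
sets only need to have empty interior, since this makes definable sets null
(`volume_eq_zero_of_interior_eq_empty`). Genericity arguments may use arbitrary real parameters; the
decompositions and sections introduce no new ones and thus stay definable over `k`. -/

set_option linter.unusedSectionVars false

namespace OMin

/-! ### Definable predicates and maps on finite products of the line -/

/-- A type identified with a finite power of `ℝ`. -/
class DSpace (X : Type*) where
  ι : Type
  fin : Finite ι
  coord : X ≃ (ι → ℝ)

attribute [instance] DSpace.fin

open DSpace

instance : DSpace ℝ where
  ι := Unit
  fin := inferInstance
  coord := (Equiv.funUnique Unit ℝ).symm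

instance {α : Type} [Finite α] : DSpace (α → ℝ) where
  ι := α
  fin := inferInstance
  coord := Equiv.refl _

instance {X Y : Type*} [DSpace X] [DSpace Y] : DSpace (X × Y) where
  ι := ι X ⊕ ι Y
  fin := inferInstance
  coord := (Equiv.prodCongr coord coord).trans (Equiv.sumArrowEquivProdArrow _ _ _).symm

variable (L : Language) [L.Structure ℝ] (A : Set ℝ)

/-- The predicate `P` is definable with parameters from `A`. -/
def DefP {X : Type*} [DSpace X] (P : X → Prop) : Prop :=
  A.Definable L {z : ι X → ℝ | P (coord.symm z)}

/-- The map `f` is definable with parameters from `A`. -/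
@[fun_prop]
def DefMap {X Y : Type*} [DSpace X] [DSpace Y] (f : X → Y) : Prop :=
  ∀ i : ι Y, A.DefinableFun L (fun z : ι X → ℝ => coord (f (coord.symm z)) i)

variable {L A}
variable {X Y Z : Type*} [DSpace X] [DSpace Y] [DSpace Z]

theorem DefP.mono {B : Set ℝ} {P : X → Prop} (h : DefP L A P) (hAB : A ⊆ B) : DefP L B P :=
  Set.Definable.mono h hAB

theorem DefMap.mono {B : Set ℝ} {f : X → Y} (h : DefMap L A f) (hAB : A ⊆ B) : DefMap L B f :=
  fun i => (h i).mono hAB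

theorem DefP.to_univ {P : X → Prop} (h : DefP L A P) : DefP L Set.univ P := h.mono (subset_univ _)

theorem DefMap.to_univ {f : X → Y} (h : DefMap L A f) : DefMap L Set.univ f := h.mono (subset_univ _)

theorem DefP.congr {P Q : X → Prop} (h : DefP L A P) (e : ∀ x, Q x ↔ P x) : DefP L A Q := by
  have : Q = P := funext fun x => propext (e x)
  rwa [this]

theorem DefP.and {P Q : X → Prop} (hP : DefP L A P) (hQ : DefP L A Q) :
    DefP L A (fun x => P x ∧ Q x) := Set.Definable.inter hP hQ

theorem DefP.or {P Q : X → Prop} (hP : DefP L A P) (hQ : DefP L A Q) :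
    DefP L A (fun x => P x ∨ Q x) := Set.Definable.union hP hQ

theorem DefP.not {P : X → Prop} (hP : DefP L A P) : DefP L A (fun x => ¬ P x) :=
  Set.Definable.compl hP

theorem DefP.imp {P Q : X → Prop} (hP : DefP L A P) (hQ : DefP L A Q) :
    DefP L A (fun x => P x → Q x) := (hP.not.or hQ).congr fun _ => imp_iff_not_or

theorem DefP.const (p : Prop) : DefP L A (fun _ : X => p) := by
  by_cases h : p
  · simp [DefP, h]
  · simp [DefP, h]

theorem DefP.finAll {κ : Type*} [Finite κ] {P : κ → X → Prop} (h : ∀ i, DefP L A (P i)) :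
    DefP L A (fun x => ∀ i, P i x) := by
  have := Set.definable_iInter_of_finite (A := A) (L := L) h
  simpa only [DefP, Set.ofPred_forall] using! this

theorem DefP.finEx {κ : Type*} [Finite κ] {P : κ → X → Prop} (h : ∀ i, DefP L A (P i)) :
    DefP L A (fun x => ∃ i, P i x) := by
  have := Set.definable_iUnion_of_finite (A := A) (L := L) h
  simpa only [DefP, Set.ofPred_exists] using! this

theorem DefP.ex {P : X → Y → Prop} (h : DefP L A (fun p : X × Y => P p.1 p.2)) :
    DefP L A (fun x => ∃ y, P x y) := by
  have := Set.Definable.exists_of_finite (β := ι Y) h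
  refine (congrArg (A.Definable L) ?_).mp this
  ext v
  constructor
  · rintro ⟨u, hu⟩
    exact ⟨coord.symm u, hu⟩
  · rintro ⟨y, hy⟩
    refine ⟨coord y, ?_⟩
    have : P (coord.symm v) (coord.symm (coord y)) := by rwa [Equiv.symm_apply_apply]
    exact this

theorem DefP.all {P : X → Y → Prop} (h : DefP L A (fun p : X × Y => P p.1 p.2)) :
    DefP L A (fun x => ∀ y, P x y) :=
  (DefP.ex (P := fun x y => ¬ P x y) h.not).not.congr fun x => by simp

theorem DefP.comp {P : Y → Prop} {f : X → Y} (hP : DefP L A P) (hf : DefMap L A f) :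
    DefP L A (fun x => P (f x)) := by
  have := Set.Definable.preimage_map hf hP
  simpa [DefP] using! this

@[fun_prop]
theorem DefMap.id : DefMap L A (fun x : X => x) := by
  intro i
  simpa using (Set.DefinableFun.proj (L := L) (A := A) (i := i))

@[fun_prop]
theorem DefMap.comp {g : Y → Z} {f : X → Y} (hg : DefMap L A g) (hf : DefMap L A f) :
    DefMap L A (fun x => g (f x)) := by
  intro i
  have := Set.DefinableFun.comp (A := A) (L := L) hf (hg i)
  simpa using this

@[fun_prop]
theorem DefMap.fst {f : X → Y × Z} (hf : DefMap L A f) : DefMap L A (fun x => (f x).1) :=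
  fun i => hf (Sum.inl i)

@[fun_prop]
theorem DefMap.snd {f : X → Y × Z} (hf : DefMap L A f) : DefMap L A (fun x => (f x).2) :=
  fun i => hf (Sum.inr i)

@[fun_prop]
theorem DefMap.prodMk {f : X → Y} {g : X → Z} (hf : DefMap L A f) (hg : DefMap L A g) :
    DefMap L A (fun x => (f x, g x)) := by
  rintro (i | i)
  · exact hf i
  · exact hg i

@[fun_prop]
theorem DefMap.apply {α : Type} [Finite α] (i : α) :
    DefMap L A (fun x : α → ℝ => x i) := fun _ => DefMap.id (X := α → ℝ) i

@[fun_prop]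
theorem DefMap.pi {α : Type} [Finite α] {f : X → α → ℝ} (hf : ∀ i, DefMap L A (fun x => f x i)) :
    DefMap L A f := fun i => hf i ()

theorem DefMap.of_graph {f : X → ℝ} (h : DefP L A (fun p : X × ℝ => p.2 = f p.1)) :
    DefMap L A f := by
  intro i
  have := Set.Definable.preimage_comp (fun o : ι X ⊕ ι ℝ => (Sum.elim some (fun _ => none) o)) h
  refine (congrArg (A.Definable L) ?_).mp this
  ext v
  simp only [Function.tupleGraph]
  constructor
  · intro h; exact h.symm
  · intro h; exact h.symm

@[fun_prop]
theorem DefMap.const {a : ℝ} (ha : a ∈ A) : DefMap L A (fun _ : X => a) :=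
  fun _ => L.definableFun_const _ ha

theorem DefP.eq {f g : X → ℝ} (hf : DefMap L A f) (hg : DefMap L A g) :
    DefP L A (fun x => f x = g x) := Set.DefinableFun.ofPred_eq (hf ()) (hg ())

theorem DefMap.ite {P : X → Prop} [DecidablePred P] {f g : X → ℝ} (hP : DefP L A P)
    (hf : DefMap L A f) (hg : DefMap L A g) : DefMap L A (fun x => if P x then f x else g x) :=
  .of_graph ((((hP.comp (by fun_prop : DefMap L A (fun p : X × ℝ => p.1))).and
    (.eq (f := fun p : X × ℝ => p.2) (g := fun p => f p.1) (by fun_prop) (by fun_prop))).or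
    ((hP.comp (by fun_prop : DefMap L A (fun p : X × ℝ => p.1))).not.and
    (.eq (f := fun p : X × ℝ => p.2) (g := fun p => g p.1) (by fun_prop) (by fun_prop)))).congr
    fun p => by by_cases h : P p.1 <;> simp [h])

/-! ### Definability with the order, the field operations and distances -/

section Field
variable [hE : Fact (ExpandsOrderedField L)]

@[fun_prop]
theorem DefMap.zero : DefMap L A (fun _ : X => (0 : ℝ)) := by
  obtain ⟨c, hc⟩ := hE.out.zero
  intro i
  have := (Set.DefinableFun.fun_symbol (M := ℝ) (L := L) c).mono (empty_subset A)
  have h2 := Set.DefinableFun.comp (A := A) (L := L)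
    (g := fun (_ : ι X → ℝ) => (![] : Fin 0 → ℝ)) (fun i => i.elim0) this
  simp only [hc] at h2
  exact h2

@[fun_prop]
theorem DefMap.add {f g : X → ℝ} (hf : DefMap L A f) (hg : DefMap L A g) :
    DefMap L A (fun x => f x + g x) := by
  obtain ⟨c, hc⟩ := hE.out.add
  intro i
  have := (Set.DefinableFun.fun_symbol (M := ℝ) (L := L) c).mono (empty_subset A)
  have h2 := Set.DefinableFun.comp (A := A) (L := L)
    (g := fun (z : ι X → ℝ) => ![f (coord.symm z), g (coord.symm z)]) (by
      intro j; fin_cases j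
      · exact hf ()
      · exact hg ()) this
  simp only [hc] at h2
  exact h2

@[fun_prop]
theorem DefMap.mul {f g : X → ℝ} (hf : DefMap L A f) (hg : DefMap L A g) :
    DefMap L A (fun x => f x * g x) := by
  obtain ⟨c, hc⟩ := hE.out.mul
  intro i
  have := (Set.DefinableFun.fun_symbol (M := ℝ) (L := L) c).mono (empty_subset A)
  have h2 := Set.DefinableFun.comp (A := A) (L := L)
    (g := fun (z : ι X → ℝ) => ![f (coord.symm z), g (coord.symm z)]) (by
      intro j; fin_cases j
      · exact hf ()
      · exact hg ()) this
  simp only [hc] at h2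
  exact h2

theorem DefP.lt {f g : X → ℝ} (hf : DefMap L A f) (hg : DefMap L A g) :
    DefP L A (fun x => f x < g x) := by
  obtain ⟨c, hc⟩ := hE.out.lt
  have h0 : (∅ : Set ℝ).Definable L {v : Fin 2 → ℝ | v 0 < v 1} := by
    rw [Set.empty_definable_iff]
    refine ⟨c.formula₂ (Language.Term.var 0) (Language.Term.var 1), ?_⟩
    ext v
    simp [Language.Formula.realize_rel₂, hc]
  have h2 := Set.Definable.preimage_map (A := A) (L := L)
    (F := fun (z : ι X → ℝ) => ![f (coord.symm z), g (coord.symm z)]) (by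
      intro j; fin_cases j
      · exact hf ()
      · exact hg ()) (h0.mono (empty_subset A))
  simpa [DefP] using! h2

theorem DefP.le {f g : X → ℝ} (hf : DefMap L A f) (hg : DefMap L A g) :
    DefP L A (fun x => f x ≤ g x) := (DefP.lt hg hf).not.congr fun _ => not_lt.symm

@[fun_prop]
theorem DefMap.neg {f : X → ℝ} (hf : DefMap L A f) : DefMap L A (fun x => - f x) :=
  .of_graph ((DefP.eq (f := fun p : X × ℝ => p.2 + f p.1) (g := fun _ => 0)
    (by fun_prop) (by fun_prop)).congr fun _ => eq_neg_iff_add_eq_zero)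

@[fun_prop]
theorem DefMap.sub {f g : X → ℝ} (hf : DefMap L A f) (hg : DefMap L A g) :
    DefMap L A (fun x => f x - g x) := by
  simp only [sub_eq_add_neg]; fun_prop

@[fun_prop]
theorem DefMap.finsum {κ : Type*} {s : Finset κ} {f : κ → X → ℝ} (hf : ∀ i, DefMap L A (f i)) :
    DefMap L A (fun x => ∑ i ∈ s, f i x) := by
  classical
  induction s using Finset.induction_on with
  | empty => simp only [Finset.sum_empty]; fun_prop
  | insert a s ha ih => simp only [Finset.sum_insert ha]; fun_prop

@[fun_prop]
theorem DefMap.abs {f : X → ℝ} (hf : DefMap L A f) : DefMap L A (fun x => |f x|) := by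
  have : DefMap L A (fun x => if 0 ≤ f x then f x else - f x) :=
    .ite (.le (by fun_prop) hf) hf (by fun_prop)
  convert this using 2 with x
  split_ifs with h
  · exact abs_of_nonneg h
  · exact abs_of_nonpos (not_le.1 h).le

/-- A metric space whose distance function is definable. -/
class DMetric (L : Language) [L.Structure ℝ] (X : Type*) [DSpace X] [PseudoMetricSpace X] : Prop where
  def_dist : ∀ A : Set ℝ, DefMap L A (fun p : X × X => dist p.1 p.2)

@[fun_prop]
theorem DefMap.dist [PseudoMetricSpace Y] [DMetric L Y] {f g : X → Y} (hf : DefMap L A f)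
    (hg : DefMap L A g) : DefMap L A (fun x => dist (f x) (g x)) :=
  (DMetric.def_dist A).comp (hf.prodMk hg)

instance : DMetric L ℝ where
  def_dist A := by simp only [Real.dist_eq]; fun_prop

/-- The sup distance is the least nonnegative bound of the coordinate distances, which is a
first-order description of its graph. -/
instance {α : Type} [Fintype α] : DMetric L (α → ℝ) where
  def_dist A := by
    refine .of_graph ((DefP.and (.le (f := fun _ => (0 : ℝ)) (g := fun p => p.2)
      (by fun_prop) (by fun_prop)) (.and
      (.finAll (P := fun i p => |p.1.1 i - p.1.2 i| ≤ p.2)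
        fun i => by refine .le ?_ ?_ <;> fun_prop)
      (.all (P := fun p s => 0 ≤ s → (∀ i, |p.1.1 i - p.1.2 i| ≤ s) → p.2 ≤ s)
        (.imp (.le (by fun_prop) (by fun_prop)) (.imp (.finAll fun i => .le (by fun_prop)
        (by fun_prop)) (.le (by fun_prop) (by fun_prop))))))).congr fun p => ?_)
    constructor
    · intro h
      rw [h]
      simp only [← Real.dist_eq]
      refine ⟨dist_nonneg, fun i => dist_le_pi_dist _ _ i, fun s hs h => ?_⟩
      exact (dist_pi_le_iff hs).2 h
    · simp only [← Real.dist_eq]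
      rintro ⟨h0, h1, h2⟩
      exact le_antisymm (h2 _ dist_nonneg fun i => dist_le_pi_dist _ _ i)
        ((dist_pi_le_iff h0).2 h1)

instance {X Y : Type*} [DSpace X] [DSpace Y] [PseudoMetricSpace X] [PseudoMetricSpace Y]
    [DMetric L X] [DMetric L Y] : DMetric L (X × Y) where
  def_dist A := by
    simp only [Prod.dist_eq, max_def]
    exact .ite (.le (by fun_prop) (by fun_prop)) (by fun_prop) (by fun_prop)

theorem DefP.interior [PseudoMetricSpace X] [DMetric L X] {S : Set X} (hS : DefP L A (· ∈ S)) :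
    DefP L A (· ∈ interior S) := by
  refine (DefP.ex (P := fun x (ε : ℝ) => 0 < ε ∧ ∀ y, Dist.dist y x < ε → y ∈ S)
    (.and (.lt (by fun_prop) (by fun_prop)) (.all (.imp (.lt (by fun_prop) (by fun_prop))
      (hS.comp (by fun_prop)))))).congr fun x => ?_
  rw [mem_interior_iff_mem_nhds, Metric.mem_nhds_iff]
  rfl

theorem DefP.closure [PseudoMetricSpace X] [DMetric L X] {S : Set X} (hS : DefP L A (· ∈ S)) :
    DefP L A (· ∈ closure S) := by
  have h : DefP L A (fun x => x ∉ _root_.interior Sᶜ) := (DefP.interior (S := Sᶜ) hS.not).not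
  refine h.congr fun x => ?_
  rw [closure_eq_compl_interior_compl]; rfl

/-- The ε-δ condition is first-order. Hence continuity loci are definable, and the dichotomy
"contains or misses an open set" applies to them. -/
theorem DefP.continuousAt [PseudoMetricSpace Y] [DMetric L Y] [PseudoMetricSpace Z] [DMetric L Z]
    {f : X → Y → Z} {g : X → Y} (hf : DefMap L A (fun p : X × Y => f p.1 p.2))
    (hg : DefMap L A g) : DefP L A (fun x => ContinuousAt (f x) (g x)) := by
  refine (DefP.all (P := fun x (ε : ℝ) => 0 < ε → ∃ δ : ℝ, 0 < δ ∧ ∀ y : Y, Dist.dist y (g x) < δ →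
    Dist.dist (f x y) (f x (g x)) < ε) (.imp (.lt (by fun_prop) (by fun_prop))
    (.ex (.and (.lt (by fun_prop) (by fun_prop)) (.all (.imp (.lt (by fun_prop) (by fun_prop))
      (.lt (.dist (hf.comp (f := fun p : ((X × ℝ) × ℝ) × Y => (p.1.1.1, p.2)) (by fun_prop))
       (hf.comp (f := fun p : ((X × ℝ) × ℝ) × Y => (p.1.1.1, g p.1.1.1)) (by fun_prop)))
        (by fun_prop)))))))).congr fun x => ?_
  exact Metric.continuousAt_iff

end Field

end OMin

namespace OMin

/-! ### Definable sets and functions in one variable, and a Baire property of definable sets -/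

theorem _root_.IsPreconnected.subset_or_subset_compl_of_frontier {X : Type*} [TopologicalSpace X]
    {T S : Set X} (hT : IsPreconnected T) (h : ∀ x ∈ T, x ∉ frontier S) : T ⊆ S ∨ T ⊆ Sᶜ := by
  have h1 : T ⊆ interior S ∪ interior Sᶜ := by
    intro x hx
    have := h x hx
    rw [frontier, interior_compl] at *
    simp only [mem_sdiff, not_and, not_not, mem_union, mem_compl_iff] at *
    tauto
  rcases hT.subset_or_subset isOpen_interior isOpen_interior
    (disjoint_compl_right.mono interior_subset interior_subset) h1 with h2 | h2
  · exact .inl (h2.trans interior_subset)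
  · exact .inr (h2.trans interior_subset)

theorem _root_.IsOpen.exists_rat_Ioo_subset {O : Set ℝ} (hO : IsOpen O) (hne : O.Nonempty) :
    ∃ p q : ℚ, p < q ∧ Ioo (p : ℝ) q ⊆ O := by
  obtain ⟨x, hx⟩ := hne
  obtain ⟨ε, hε, h⟩ := Metric.isOpen_iff.1 hO x hx
  obtain ⟨p, hp1, hp2⟩ := exists_rat_btwn (show x < x + ε / 2 by linarith)
  obtain ⟨q, hq1, hq2⟩ := exists_rat_btwn (show x + ε / 2 < x + ε by linarith)
  refine ⟨p, q, by exact_mod_cast hp2.trans hq1, fun y hy => h ?_⟩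
  rw [Metric.mem_ball, Real.dist_eq, abs_lt]
  constructor <;> linarith [hy.1, hy.2]

theorem _root_.IsOpen.exists_prod_Ioo_subset {X : Type*} [TopologicalSpace X] {O : Set (X × ℝ)}
    (hO : IsOpen O) (hne : O.Nonempty) :
    ∃ Q : Set X, IsOpen Q ∧ Q.Nonempty ∧ ∃ a b : ℝ, a < b ∧ Q ×ˢ Ioo a b ⊆ O := by
  obtain ⟨⟨x, t⟩, hx⟩ := hne
  obtain ⟨u, v, hu, hv, hxu, htv, h⟩ := isOpen_prod_iff.1 hO x t hx
  obtain ⟨p, q, hpq, h2⟩ := hv.exists_rat_Ioo_subset ⟨t, htv⟩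
  exact ⟨u, hu, ⟨x, hxu⟩, p, q, by exact_mod_cast hpq, (prod_mono le_rfl h2).trans h⟩

theorem not_countable_Ioo {a b : ℝ} (h : a < b) : ¬ (Ioo a b).Countable := by
  intro hc
  have := hc.measure_zero volume
  rw [Real.volume_Ioo, ENNReal.ofReal_eq_zero] at this
  linarith

variable {L : Language} [L.Structure ℝ] [hL : Fact (IsOMinimal L)]

instance : Fact (ExpandsOrderedField L) := ⟨hL.out.expands⟩

theorem exists_union_intervals {S : Set ℝ} (hS : DefP L univ (· ∈ S)) :
    ∃ F : Set (Set ℝ), F.Finite ∧ (∀ I ∈ F, IsPointOrOpenInterval I) ∧ S = ⋃₀ F := by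
  rw [← hL.out.definable_iff]
  exact Set.Definable.preimage_comp (fun _ : DSpace.ι ℝ => (0 : Fin 1)) hS

theorem IsPointOrOpenInterval.isOpen_or {I : Set ℝ} (h : IsPointOrOpenInterval I) :
    IsOpen I ∨ I.Finite := by
  rcases h with ⟨a, rfl⟩ | ⟨a, b, rfl⟩ | ⟨a, rfl⟩ | ⟨a, rfl⟩ | rfl
  · exact .inr (finite_singleton a)
  · exact .inl isOpen_Ioo
  · exact .inl isOpen_Ioi
  · exact .inl isOpen_Iio
  · exact .inl isOpen_univ

theorem IsPointOrOpenInterval.finite_frontier {I : Set ℝ} (h : IsPointOrOpenInterval I) :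
    (frontier I).Finite := by
  rcases h with ⟨a, rfl⟩ | ⟨a, b, rfl⟩ | ⟨a, rfl⟩ | ⟨a, rfl⟩ | rfl
  · exact (finite_singleton a).subset (isClosed_singleton.frontier_subset)
  · rcases lt_or_ge a b with h | h
    · rw [frontier_Ioo h]; exact (finite_singleton b).insert a
    · simp [Ioo_eq_empty (not_lt.2 h)]
  · rw [frontier_Ioi]; exact finite_singleton a
  · rw [frontier_Iio]; exact finite_singleton a
  · simp

theorem finite_of_interior_eq_empty {S : Set ℝ} (hS : DefP L univ (· ∈ S))
    (h : interior S = ∅) : S.Finite := by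
  obtain ⟨F, hF, hI, rfl⟩ := exists_union_intervals hS
  refine hF.sUnion fun I hIF => ?_
  rcases (hI I hIF).isOpen_or with h1 | h1
  · have : I ⊆ ∅ := h ▸ interior_maximal (subset_sUnion_of_mem hIF) h1
    exact finite_empty.subset this
  · exact h1

theorem finite_of_countable {S : Set ℝ} (hS : DefP L univ (· ∈ S)) (h : S.Countable) :
    S.Finite := by
  refine finite_of_interior_eq_empty hS ?_
  by_contra hne
  obtain ⟨p, q, hpq, hsub⟩ := isOpen_interior.exists_rat_Ioo_subset (nonempty_iff_ne_empty.2 hne)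
  exact not_countable_Ioo (show (p : ℝ) < q by exact_mod_cast hpq)
    (h.mono (hsub.trans interior_subset))

theorem finite_frontier {S : Set ℝ} (hS : DefP L univ (· ∈ S)) : (frontier S).Finite := by
  obtain ⟨F, hF, hI, rfl⟩ := exists_union_intervals hS
  clear hS
  induction F, hF using Set.Finite.induction_on with
  | empty => simp
  | insert _ hs ih =>
    rw [sUnion_insert]
    refine Finite.subset ?_ (frontier_union_subset _ _)
    exact ((hI _ (mem_insert _ _)).finite_frontier.inter_of_left _).union
      ((ih fun I h => hI I (mem_insert_of_mem _ h)).inter_of_right _)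

theorem exists_Ioo_subset_or_compl {S : Set ℝ} (hS : DefP L univ (· ∈ S)) (a : ℝ) :
    ∃ ε > 0, Ioo a (a + ε) ⊆ S ∨ Ioo a (a + ε) ⊆ Sᶜ := by
  have h1 : (frontier S \ {a})ᶜ ∈ 𝓝 a :=
    ((finite_frontier hS).subset sdiff_subset).isClosed.isOpen_compl.mem_nhds (by simp)
  obtain ⟨ε, hε, h⟩ := Metric.mem_nhds_iff.1 h1
  refine ⟨ε, hε, isPreconnected_Ioo.subset_or_subset_compl_of_frontier fun x hx hf => ?_⟩
  have : x ∈ Metric.ball a ε := by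
    rw [Metric.mem_ball, Real.dist_eq, abs_lt]; constructor <;> linarith [hx.1, hx.2]
  exact h this ⟨hf, hx.1.ne'⟩

/-- A nonempty open set covered by countably many definable sets has a nonempty open subset that
lies in one of them. -/
def DefBaire (L : Language) [L.Structure ℝ] (X : Type*) [DSpace X] [TopologicalSpace X] : Prop :=
  ∀ (κ : Type) [Countable κ] (S : κ → Set X), (∀ i, DefP L univ (· ∈ S i)) →
    ∀ O, IsOpen O → O.Nonempty → O ⊆ ⋃ i, S i →
      ∃ i, ∃ O' ⊆ O, IsOpen O' ∧ O'.Nonempty ∧ O' ⊆ S i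

/-- The frontiers are finite, so countably many of them cannot fill an interval. A point outside all
frontiers is interior to any of the sets that contains it. -/
theorem defBaire_real : DefBaire L ℝ := by
  intro κ _ S hS O hO hne hcov
  by_contra! hcon
  obtain ⟨p, q, hpq, hsub⟩ := hO.exists_rat_Ioo_subset hne
  have hpq' : (p : ℝ) < q := by exact_mod_cast hpq
  refine not_countable_Ioo hpq' (Countable.mono (s₂ := ⋃ i, (frontier (S i)))
    (fun x hx => ?_) (countable_iUnion fun i => (finite_frontier (hS i)).countable))
  obtain ⟨i, hi⟩ := mem_iUnion.1 (hcov (hsub hx))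
  refine mem_iUnion.2 ⟨i, subset_closure hi, fun hint => ?_⟩
  exact hcon i (O ∩ interior (S i)) inter_subset_left (hO.inter isOpen_interior)
    ⟨x, hsub hx, hint⟩ (inter_subset_right.trans interior_subset)

theorem DefBaire.of_finite {X : Type*} [DSpace X] [TopologicalSpace X] [Subsingleton X] :
    DefBaire L X := by
  intro κ _ S hS O hO ⟨x, hx⟩ hcov
  obtain ⟨i, hi⟩ := mem_iUnion.1 (hcov hx)
  refine ⟨i, O, le_rfl, hO, ⟨x, hx⟩, fun y _ => ?_⟩
  rwa [Subsingleton.elim y x]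

theorem DefMap.univ_const {X : Type*} [DSpace X] (a : ℝ) : DefMap L univ (fun _ : X => a) :=
  DefMap.const (mem_univ a)

theorem DefMap.real_prodMk_left {X : Type*} [DSpace X] (x : X) :
    DefMap L univ (fun t : ℝ => (x, t)) := by
  rintro (i | i)
  · exact DefMap.univ_const (X := ℝ) (DSpace.coord x i) ()
  · exact DefMap.id (X := ℝ) i

theorem DefMap.prodMk_right {X Y : Type*} [DSpace X] [DSpace Y] (y : Y) :
    DefMap L univ (fun x : X => (x, y)) := by
  rintro (i | i)
  · exact DefMap.id (X := X) i
  · exact DefMap.univ_const (X := X) (DSpace.coord y i) ()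

/-- By the one-variable case, every vertical fibre of a box contains a rational interval lying in
one `S i`. The pairs of an index and a rational interval are countable, so the Baire property of the
base makes one pair work over an open set. -/
theorem DefBaire.prod {X : Type*} [DSpace X] [TopologicalSpace X] (hX : DefBaire L X) :
    DefBaire L (X × ℝ) := by
  intro κ _ S hS O hO hne hcov
  obtain ⟨Q, hQ, hQne, a, b, hab, hsub⟩ := hO.exists_prod_Ioo_subset hne
  let T : κ × {r : ℚ × ℚ // r.1 < r.2 ∧ Ioo (r.1 : ℝ) r.2 ⊆ Ioo a b} → Set X := fun i =>
    {x | ∀ t : ℝ, (i.2.1.1 : ℝ) < t → t < i.2.1.2 → (x, t) ∈ S i.1}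
  have hT : ∀ i, DefP L univ (· ∈ T i) := fun i => .all (.imp
    (.lt (DefMap.univ_const _) (by fun_prop)) (.imp (.lt (by fun_prop) (DefMap.univ_const _))
      ((hS i.1).comp (f := fun p : X × ℝ => (p.1, p.2)) (by fun_prop))))
  obtain ⟨i, Q', hQ', hQ'o, hQ'ne, h⟩ := hX _ T hT Q hQ hQne (by
    intro x hx
    obtain ⟨j, J, hJ, hJo, hJne, hJS⟩ := defBaire_real κ (fun j => {t : ℝ | (x, t) ∈ S j})
      (fun j => (hS j).comp (DefMap.real_prodMk_left x)) (Ioo a b) isOpen_Ioo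
      (nonempty_Ioo.2 hab) (fun t ht => by
        obtain ⟨j, hj⟩ := mem_iUnion.1 (hcov (hsub (mk_mem_prod hx ht)))
        exact mem_iUnion.2 ⟨j, hj⟩)
    obtain ⟨p, q, hpq, hJ2⟩ := hJo.exists_rat_Ioo_subset hJne
    exact mem_iUnion.2 ⟨(j, ⟨(p, q), hpq, hJ2.trans hJ⟩), fun t h1 h2 => hJS (hJ2 ⟨h1, h2⟩)⟩)
  have hi := i.2.2
  refine ⟨i.1, Q' ×ˢ Ioo (i.2.1.1 : ℝ) i.2.1.2, (prod_mono hQ' hi.2).trans hsub,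
    hQ'o.prod isOpen_Ioo, hQ'ne.prod (nonempty_Ioo.2 (by exact_mod_cast hi.1)), ?_⟩
  rintro ⟨x, t⟩ ⟨hx, ht⟩
  exact h hx t ht.1 ht.2

/-- Two definable sets. -/
theorem DefBaire.mem_or {X : Type*} [DSpace X] [TopologicalSpace X] (hX : DefBaire L X)
    {S : Set X} (hS : DefP L univ (· ∈ S)) {O : Set X} (hO : IsOpen O) (hne : O.Nonempty) :
    ∃ O' ⊆ O, IsOpen O' ∧ O'.Nonempty ∧ (O' ⊆ S ∨ O' ⊆ Sᶜ) := by
  obtain ⟨i, O', h1, h2, h3, h4⟩ := hX Bool (fun b => cond b S Sᶜ)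
    (by rintro (_ | _); exacts [hS.not, hS]) O hO hne (fun x _ => by
      by_cases h : x ∈ S
      · exact mem_iUnion.2 ⟨true, h⟩
      · exact mem_iUnion.2 ⟨false, h⟩)
  cases i
  · exact ⟨O', h1, h2, h3, .inr h4⟩
  · exact ⟨O', h1, h2, h3, .inl h4⟩

/-- An open subset of the union can be shrunk to lie in `S` or off `S`, and in the latter case in
`T`. Only `S` has to be definable. -/
theorem DefBaire.interior_union {X : Type*} [DSpace X] [TopologicalSpace X] (hX : DefBaire L X)
    {S T : Set X} (hS : DefP L univ (· ∈ S)) (hSe : interior S = ∅)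
    (hTe : interior T = ∅) : interior (S ∪ T) = ∅ := by
  by_contra hne
  obtain ⟨O', h1, h2, h3, h4⟩ := hX.mem_or hS isOpen_interior (nonempty_iff_ne_empty.2 hne)
  rcases h4 with h4 | h4
  · exact h3.not_subset_empty (hSe ▸ interior_maximal h4 h2)
  · refine h3.not_subset_empty (hTe ▸ interior_maximal (fun x hx => ?_) h2)
    exact (interior_subset (h1 hx)).resolve_left (h4 hx)

theorem DefBaire.interior_iUnion {X : Type*} [DSpace X] [TopologicalSpace X] (hX : DefBaire L X)
    {κ : Type*} [Finite κ] {S : κ → Set X} (hS : ∀ i, DefP L univ (· ∈ S i))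
    (hSe : ∀ i, interior (S i) = ∅) : interior (⋃ i, S i) = ∅ := by
  by_contra hne
  obtain ⟨n, ⟨e⟩⟩ := Finite.exists_equiv_fin κ
  obtain ⟨i, O', h1, h2, h3, h4⟩ := hX (Fin n) (fun i => S (e.symm i)) (fun i => hS _) _
    isOpen_interior (nonempty_iff_ne_empty.2 hne) (interior_subset.trans (by
      rw [e.symm.surjective.iUnion_comp S]))
  exact h3.not_subset_empty (hSe _ ▸ interior_maximal h4 h2)

theorem DefBaire.interior_closure {X : Type*} [DSpace X] [TopologicalSpace X] (hX : DefBaire L X)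
    {S : Set X} (hS : DefP L univ (· ∈ S)) (hSe : interior S = ∅) : interior (closure S) = ∅ := by
  by_contra hne
  obtain ⟨O', h1, h2, h3, h4⟩ := hX.mem_or hS isOpen_interior (nonempty_iff_ne_empty.2 hne)
  rcases h4 with h4 | h4
  · exact h3.not_subset_empty (hSe ▸ interior_maximal h4 h2)
  · obtain ⟨x, hx⟩ := h3
    obtain ⟨y, hy1, hy2⟩ := mem_closure_iff.1 (interior_subset (h1 hx)) O' h2 hx
    exact h4 hy1 hy2

/-- `f` maps the points between `t₁` and `t₂` to points between `f t₁` and `f t₂`. -/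
def MapsBetween (f : ℝ → ℝ) (S : Set ℝ) : Prop :=
  ∀ t₁ ∈ S, ∀ t ∈ S, ∀ t₂ ∈ S, t₁ ≤ t → t ≤ t₂ →
    (f t₁ ≤ f t ∧ f t ≤ f t₂) ∨ (f t₂ ≤ f t ∧ f t ≤ f t₁)

/-- On some subinterval, a definable function is monotone or antitone, and continuous. -/
theorem exists_continuousOn_mapsBetween {f : ℝ → ℝ} (hf : DefMap L univ f) {a b : ℝ} (hab : a < b) :
    ∃ p q : ℚ, p < q ∧ Ioo (p : ℝ) q ⊆ Ioo a b ∧ ContinuousOn f (Ioo (p : ℝ) q) ∧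
      MapsBetween f (Ioo (p : ℝ) q) := by
  let R : Bool → ℝ → ℝ → Prop := fun β => cond β (· ≤ ·) (· ≥ ·)
  let S : Bool × ℕ → Set ℝ := fun i =>
    {x | ∀ t : ℝ, x < t → t < x + 1 / ((i.2 : ℝ) + 1) → R i.1 (f x) (f t)}
  have hS : ∀ i, DefP L univ (· ∈ S i) := by
    rintro ⟨β, m⟩
    refine .all (.imp (.lt (by fun_prop) (by fun_prop)) (.imp (.lt (by fun_prop)
      (.add (by fun_prop) (DefMap.univ_const _))) ?_))
    cases β
    · exact .le (by fun_prop) (by fun_prop)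
    · exact .le (by fun_prop) (by fun_prop)
  -- To the right of each `x`, the difference `f t - f x` eventually has a weak sign by
  -- o-minimality. The Baire property makes both this sign and the length `1 / (m + 1)` uniform on
  -- an open set.
  obtain ⟨⟨β, m⟩, O, hO, hOo, hOne, hOS⟩ := defBaire_real _ S hS (Ioo a b) isOpen_Ioo
    (nonempty_Ioo.2 hab) (by
      intro x hx
      have key : ∃ β : Bool, ∃ ε > 0, ∀ t ∈ Ioo x (x + ε), R β (f x) (f t) := by
        obtain ⟨ε, hε, h | h⟩ := exists_Ioo_subset_or_compl (L := L) (S := {t | f x ≤ f t})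
          (.le (DefMap.univ_const _) hf) x
        · exact ⟨true, ε, hε, fun t ht => h ht⟩
        · exact ⟨false, ε, hε, fun t ht => (not_le.1 (show ¬ f x ≤ f t from h ht)).le⟩
      obtain ⟨β, ε, hε, h⟩ := key
      obtain ⟨m, hm⟩ := exists_nat_one_div_lt hε
      exact mem_iUnion.2 ⟨(β, m), fun t h1 h2 => h t ⟨h1, by linarith⟩⟩)
  obtain ⟨p, q, hpq, hpqO⟩ := hOo.exists_rat_Ioo_subset hOne
  have hpq' : (p : ℝ) < q := by exact_mod_cast hpq
  have hm : (0 : ℝ) < 1 / ((m : ℝ) + 1) := by positivity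
  -- On an interval no longer than `1 / (m + 1)` the uniform comparison applies to any two points,
  -- so that `f` is monotone or antitone there.
  obtain ⟨q', hq'1, hq'2⟩ := exists_rat_btwn (show (p : ℝ) < min (q : ℝ) (p + 1 / ((m : ℝ) + 1)) by
    simp [hpq', Nat.cast_add_one_pos])
  have hmono : ∀ x ∈ Ioo (p : ℝ) q', ∀ t ∈ Ioo (p : ℝ) q', x ≤ t → R β (f x) (f t) := by
    intro x hx t ht hxt
    rcases hxt.eq_or_lt with rfl | hxt
    · cases β <;> simp [R]
    · refine hOS (hpqO ⟨hx.1, hx.2.trans (hq'2.trans_le (min_le_left _ _))⟩) t hxt ?_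
      have := hq'2.trans_le (min_le_right _ _)
      show t < x + 1 / ((m : ℝ) + 1)
      linarith [hx.1, ht.2]
  have hcount : {x ∈ Ioo (p : ℝ) q' | ¬ ContinuousWithinAt f (Ioo (p : ℝ) q') x}.Countable := by
    cases β
    · exact AntitoneOn.countable_not_continuousWithinAt (fun x hx t ht h => hmono x hx t ht h)
    · exact MonotoneOn.countable_not_continuousWithinAt (fun x hx t ht h => hmono x hx t ht h)
  have hbet : MapsBetween f (Ioo (p : ℝ) q') := by
    intro t₁ h1 t h t₂ h2 h1t ht2
    have ha := hmono _ h1 _ h h1t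
    have hb := hmono _ h _ h2 ht2
    cases β
    · exact .inr ⟨hb, ha⟩
    · exact .inl ⟨ha, hb⟩
  -- The continuity locus is definable, so it contains or misses an interval. Missing one is
  -- impossible: a monotone function has only countably many discontinuities.
  obtain ⟨O', hO', hO'o, hO'ne, hor⟩ := (defBaire_real (L := L)).mem_or
    (S := {x | ContinuousAt f x}) (.continuousAt (f := fun _ => f) (by fun_prop) (by fun_prop))
    (isOpen_Ioo (a := (p : ℝ)) (b := q')) (nonempty_Ioo.2 hq'1)
  obtain ⟨p1, q1, hpq1, hsub⟩ := hO'o.exists_rat_Ioo_subset hO'ne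
  have hpq1' : (p1 : ℝ) < q1 := by exact_mod_cast hpq1
  rcases hor with hor | hor
  · refine ⟨p1, q1, hpq1, fun x hx => ?_, fun x hx => (hor (hsub hx)).continuousWithinAt, ?_⟩
    · have := hO' (hsub hx)
      exact hO (hpqO ⟨this.1, this.2.trans (hq'2.trans_le (min_le_left _ _))⟩)
    · have := hsub.trans hO'
      exact fun t₁ h1 t h t₂ h2 => hbet t₁ (this h1) t (this h) t₂ (this h2)
  · refine absurd (hcount.mono fun x hx => ?_) (not_countable_Ioo hpq1')
    refine ⟨hO' (hsub hx), fun hc => hor (hsub hx) ?_⟩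
    exact hc.continuousAt (isOpen_Ioo.mem_nhds (hO' (hsub hx)))

/-- A definable function is continuous on a nonempty open subset of each nonempty open set. -/
def GenericallyContinuous (L : Language) [L.Structure ℝ] (X : Type*) [DSpace X]
    [TopologicalSpace X] : Prop :=
  ∀ f : X → ℝ, DefMap L univ f → ∀ O, IsOpen O → O.Nonempty →
    ∃ O' ⊆ O, IsOpen O' ∧ O'.Nonempty ∧ ContinuousOn f O'

theorem GenericallyContinuous.of_subsingleton {X : Type*} [DSpace X] [TopologicalSpace X]
    [Subsingleton X] : GenericallyContinuous L X :=
  fun _ _ O hO hne => ⟨O, le_rfl, hO, hne, fun x _ =>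
    (continuous_of_const fun x y => by rw [Subsingleton.elim x y]).continuousWithinAt⟩

/-- Separate continuity suffices when `f` is monotone in the last variable: `f (x, t)` is squeezed
between the values at two fixed heights just below and just above `t₀`, and these depend
continuously on `x`. -/
theorem continuousOn_prod_of_mapsBetween {X : Type*} [TopologicalSpace X] {f : X × ℝ → ℝ}
    {Q : Set X} (hQ : IsOpen Q) {a b : ℝ} (hc : ∀ x ∈ Q, ContinuousOn (fun t => f (x, t)) (Ioo a b))
    (hm : ∀ x ∈ Q, MapsBetween (fun t => f (x, t)) (Ioo a b))
    (hx : ∀ t ∈ Ioo a b, ContinuousOn (fun x => f (x, t)) Q) : ContinuousOn f (Q ×ˢ Ioo a b) := by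
  rintro ⟨x₀, t₀⟩ ⟨hx₀, ht₀⟩
  refine ContinuousAt.continuousWithinAt (Metric.tendsto_nhds.2 fun ε hε => ?_)
  have h1 : ∀ᶠ t in 𝓝 t₀, t ∈ Ioo a b ∧ Dist.dist (f (x₀, t)) (f (x₀, t₀)) < ε / 2 :=
    Filter.Eventually.and (isOpen_Ioo.mem_nhds ht₀)
      (Metric.tendsto_nhds.1 ((hc x₀ hx₀).continuousAt (isOpen_Ioo.mem_nhds ht₀)) _ (half_pos hε))
  obtain ⟨δ, hδ, h⟩ := Metric.eventually_nhds_iff.1 h1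
  have hd1 : Dist.dist (t₀ - δ / 2) t₀ < δ := by
    rw [Real.dist_eq, abs_lt]; constructor <;> linarith
  have hd2 : Dist.dist (t₀ + δ / 2) t₀ < δ := by
    rw [Real.dist_eq, abs_lt]; constructor <;> linarith
  obtain ⟨m1, e1⟩ := h hd1
  obtain ⟨m2, e2⟩ := h hd2
  have k : ∀ t ∈ Ioo a b, ∀ᶠ x in 𝓝 x₀, Dist.dist (f (x, t)) (f (x₀, t)) < ε / 2 := fun t ht =>
    Metric.tendsto_nhds.1 ((hx t ht).continuousAt (hQ.mem_nhds hx₀)) _ (half_pos hε)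
  have k3 : ∀ᶠ t in 𝓝 t₀, t ∈ Ioo (t₀ - δ / 2) (t₀ + δ / 2) :=
    isOpen_Ioo.mem_nhds ⟨by linarith, by linarith⟩
  rw [nhds_prod_eq]
  filter_upwards [(Filter.Eventually.and (hQ.mem_nhds hx₀) ((k _ m1).and (k _ m2))).prod_mk k3]
  rintro ⟨x, t⟩ ⟨⟨hxQ, k1, k2⟩, ht⟩
  simp only [Real.dist_eq, abs_lt] at *
  have := hm x hxQ _ m1 t ⟨by linarith [m1.1, ht.1], by linarith [m2.2, ht.2]⟩ _ m2 ht.1.le ht.2.le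
  rcases this with h | h <;> constructor <;> linarith [h.1, h.2]

/-- The one-variable result holds on an interval depending on `x`; the Baire property makes the
interval uniform. Continuity in `x` for fixed `t` is then arranged on a smaller box, and
monotonicity in `t` upgrades the two to joint continuity. -/
theorem GenericallyContinuous.prod {X : Type*} [DSpace X] [PseudoMetricSpace X] [DMetric L X]
    (hB : DefBaire L X) (hX : GenericallyContinuous L X) : GenericallyContinuous L (X × ℝ) := by
  intro f hf O hO hne
  obtain ⟨Q, hQ, hQne, a, b, hab, hsub⟩ := hO.exists_prod_Ioo_subset hne
  let T : {r : ℚ × ℚ // r.1 < r.2 ∧ Ioo (r.1 : ℝ) r.2 ⊆ Ioo a b} → Set X := fun r =>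
    {x | (∀ t : ℝ, t ∈ Ioo (r.1.1 : ℝ) r.1.2 → ContinuousAt (fun t => f (x, t)) t) ∧
      MapsBetween (fun t => f (x, t)) (Ioo (r.1.1 : ℝ) r.1.2)}
  have hI : ∀ r : ℚ × ℚ, DefP L univ (fun t : ℝ => t ∈ Ioo (r.1 : ℝ) r.2) := fun r =>
    .and (.lt (DefMap.univ_const _) (by fun_prop)) (.lt (by fun_prop) (DefMap.univ_const _))
  have hT : ∀ r, DefP L univ (· ∈ T r) := by
    intro r
    refine .and (.all (.imp ((hI r.1).comp (by fun_prop)) (.continuousAt (f := fun (p : X × ℝ) t =>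
      f (p.1, t)) (by fun_prop) (by fun_prop)))) ?_
    refine .all (.imp ((hI r.1).comp (by fun_prop)) (.all (.imp ((hI r.1).comp (by fun_prop))
      (.all (.imp ((hI r.1).comp (by fun_prop)) (.imp (.le (by fun_prop) (by fun_prop))
      (.imp (.le (by fun_prop) (by fun_prop)) ?_)))))))
    exact .or (.and (.le (by fun_prop) (by fun_prop)) (.le (by fun_prop) (by fun_prop)))
      (.and (.le (by fun_prop) (by fun_prop)) (.le (by fun_prop) (by fun_prop)))
  obtain ⟨r, Q', hQ', hQ'o, hQ'ne, h⟩ := hB _ T hT Q hQ hQne (by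
    intro x hx
    obtain ⟨p, q, hpq, h1, h2, h3⟩ := exists_continuousOn_mapsBetween (L := L)
      (f := fun t => f (x, t)) (hf.comp (DefMap.real_prodMk_left x)) hab
    exact mem_iUnion.2 ⟨⟨(p, q), hpq, h1⟩, fun t ht => h2.continuousAt (isOpen_Ioo.mem_nhds ht), h3⟩)
  have hr : (r.1.1 : ℝ) < r.1.2 := by exact_mod_cast r.2.1
  obtain ⟨O', hO', hO'o, hO'ne, hor⟩ := hB.prod.mem_or
    (S := {z : X × ℝ | ContinuousAt (fun x => f (x, z.2)) z.1})
    (.continuousAt (f := fun (p : X × ℝ) x => f (x, p.2)) (by fun_prop) (by fun_prop))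
    (hQ'o.prod (isOpen_Ioo (a := (r.1.1 : ℝ)) (b := r.1.2))) (hQ'ne.prod (nonempty_Ioo.2 hr))
  obtain ⟨Q₂, hQ₂, hQ₂ne, c, e, hce, hsub₂⟩ := hO'o.exists_prod_Ioo_subset hO'ne
  rcases hor with hor | hor
  · have hbox : ∀ x ∈ Q₂, ∀ t ∈ Ioo c e, x ∈ Q' ∧ t ∈ Ioo (r.1.1 : ℝ) r.1.2 := fun x hx t ht =>
      hO' (hsub₂ (mk_mem_prod hx ht))
    refine ⟨Q₂ ×ˢ Ioo c e, fun z hz => hsub ?_, hQ₂.prod isOpen_Ioo,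
      hQ₂ne.prod (nonempty_Ioo.2 hce), continuousOn_prod_of_mapsBetween hQ₂ ?_ ?_ ?_⟩
    · obtain ⟨h1, h2⟩ := hbox _ hz.1 _ hz.2
      exact ⟨hQ' h1, r.2.2 h2⟩
    · intro x hx t ht
      obtain ⟨h1, h2⟩ := hbox _ hx _ ht
      exact ((h h1).1 t h2).continuousWithinAt
    · intro x hx t₁ h1 t ht t₂ h2
      exact (h (hbox _ hx _ ht).1).2 t₁ (hbox _ hx _ h1).2 t (hbox _ hx _ ht).2 t₂ (hbox _ hx _ h2).2
    · intro t ht x hx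
      exact ContinuousAt.continuousWithinAt (hor (hsub₂ (mk_mem_prod hx ht)))
  -- If the locus of continuity in `x` missed a box, any horizontal slice of the box would
  -- contradict generic continuity on `X`.
  · exfalso
    obtain ⟨t, ht⟩ := nonempty_Ioo.2 hce
    obtain ⟨Q₃, h1, h2, ⟨x, hx⟩, h4⟩ := hX (fun x => f (x, t)) (hf.comp (DefMap.prodMk_right t)) Q₂ hQ₂ hQ₂ne
    exact hor (hsub₂ (mk_mem_prod (h1 hx) ht)) (h4.continuousAt (h2.mem_nhds hx))

end OMin

namespace OMin

variable {L : Language} [L.Structure ℝ] [hL : Fact (IsOMinimal L)] {A : Set ℝ}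

/-! ### Decompositions into open connected definable sets, up to sets with empty interior -/

/-! ### Definable enumeration of finite fibres -/

section Enumeration
variable {X : Type*} [DSpace X]

theorem lowest_spec {E : Set (X × ℝ)} {x : X} (hfin : {t | (x, t) ∈ E}.Finite)
    (hne : {t | (x, t) ∈ E}.Nonempty) :
    (x, sInf {t | (x, t) ∈ E}) ∈ E ∧ ∀ t, (x, t) ∈ E → sInf {t | (x, t) ∈ E} ≤ t :=
  ⟨hne.csInf_mem hfin, fun _ ht => csInf_le hfin.bddBelow ht⟩

theorem defMap_lowest {E : Set (X × ℝ)} (hE : DefP L A (· ∈ E))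
    (hfin : ∀ x, {t | (x, t) ∈ E}.Finite) : DefMap L A (fun x => sInf {t | (x, t) ∈ E}) := by
  -- The second alternative records the default value `sInf ∅ = 0` on empty fibres.
  refine .of_graph ((DefP.or (P := fun p : X × ℝ => (p.1, p.2) ∈ E ∧ ∀ t, (p.1, t) ∈ E → p.2 ≤ t)
    (Q := fun p => (∀ t, (p.1, t) ∉ E) ∧ p.2 = 0)
    (.and (hE.comp (by fun_prop)) (.all (.imp (hE.comp (by fun_prop))
      (.le (by fun_prop) (by fun_prop)))))
    (.and (.all (DefP.not (hE.comp (f := fun p : (X × ℝ) × ℝ => (p.1.1, p.2)) (by fun_prop))))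
      (.eq (by fun_prop) (by fun_prop)))).congr fun p => ?_)
  rcases eq_empty_or_nonempty {t | (p.1, t) ∈ E} with h | h
  · have h' : ∀ t, (p.1, t) ∉ E := fun t ht => by
      have : t ∈ {t | (p.1, t) ∈ E} := ht
      rwa [h] at this
    rw [h, Real.sInf_empty]
    constructor
    · exact fun hp => .inr ⟨h', hp⟩
    · rintro (⟨h1, _⟩ | ⟨_, h1⟩)
      · exact absurd h1 (h' _)
      · exact h1
  · obtain ⟨h1, h2⟩ := lowest_spec (hfin p.1) h
    constructor
    · intro hp
      rw [← hp] at h1 h2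
      exact .inl ⟨h1, h2⟩
    · rintro (⟨h3, h4⟩ | ⟨h3, _⟩)
      · exact le_antisymm (h4 _ h1) (h2 _ h3)
      · exact absurd h1 (h3 _)

/-- The lowest point of a finite fibre is definable without new parameters. Peeling it off lowers
the cardinality by one, so induction on `N` lists all fibres with at most `N` points. -/
theorem exists_enumeration (N : ℕ) {E : Set (X × ℝ)} (hE : DefP L A (· ∈ E))
    (hfin : ∀ x, {t | (x, t) ∈ E}.Finite) :
    DefP L A (fun x => {t | (x, t) ∈ E}.ncard ≤ N) ∧
    ∃ (f : Fin N → X → ℝ) (S : Fin N → Set X), (∀ l, DefMap L A (f l)) ∧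
      (∀ l, DefP L A (· ∈ S l)) ∧ (∀ l, ∀ x ∈ S l, (x, f l x) ∈ E) ∧
      (∀ l l' x, l ≠ l' → x ∈ S l → x ∈ S l' → f l x ≠ f l' x) ∧
      ∀ x, {t | (x, t) ∈ E}.ncard ≤ N → ∀ t, (x, t) ∈ E → ∃ l, x ∈ S l ∧ f l x = t := by
  induction N generalizing E with
  | zero =>
    refine ⟨?_, Fin.elim0, Fin.elim0, fun l => l.elim0, fun l => l.elim0, fun l => l.elim0,
      fun l => l.elim0, fun x hx t ht => ?_⟩
    · refine (DefP.all (P := fun x t => (x, t) ∉ E)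
        (DefP.not (hE.comp (f := fun p : X × ℝ => (p.1, p.2)) (by fun_prop)))).congr fun x => ?_
      rw [Nat.le_zero, ncard_eq_zero (hfin x), eq_empty_iff_forall_notMem]
      rfl
    · rw [Nat.le_zero, ncard_eq_zero (hfin x), eq_empty_iff_forall_notMem] at hx
      exact absurd ht (hx t)
  | succ N ih =>
    let lo : X → ℝ := fun x => sInf {t | (x, t) ∈ E}
    have hlo : DefMap L A lo := defMap_lowest hE hfin
    let E' : Set (X × ℝ) := {p | p ∈ E ∧ p.2 ≠ lo p.1}
    have hE' : DefP L A (· ∈ E') := .and hE (.not (.eq (by fun_prop) (by fun_prop)))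
    have hfib : ∀ x, {t | (x, t) ∈ E'} = {t | (x, t) ∈ E} \ {lo x} := fun x => rfl
    have hfin' : ∀ x, {t | (x, t) ∈ E'}.Finite := fun x => by
      rw [hfib]; exact (hfin x).subset sdiff_subset
    have hcard : ∀ x, {t | (x, t) ∈ E}.ncard ≤ N + 1 ↔ {t | (x, t) ∈ E'}.ncard ≤ N := by
      intro x
      rw [hfib]
      rcases eq_empty_or_nonempty {t | (x, t) ∈ E} with h | h
      · simp [h]
      · have hm : lo x ∈ {t | (x, t) ∈ E} := (lowest_spec (hfin x) h).1
        have := ncard_sdiff_singleton_add_one hm (hfin x)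
        omega
    obtain ⟨h1, f, S, hf, hS, hfE, hne, hcov⟩ := ih hE' hfin'
    refine ⟨h1.congr hcard, Fin.cons lo f, Fin.cons {x | ∃ t, (x, t) ∈ E} S, ?_, ?_, ?_, ?_, ?_⟩
    · exact Fin.cases hlo hf
    · exact Fin.cases (.ex (hE.comp (f := fun p : X × ℝ => (p.1, p.2)) (by fun_prop))) hS
    · exact Fin.cases (fun x hx => (lowest_spec (hfin x) hx).1) (fun l x hx => (hfE l x hx).1)
    · refine Fin.cases (Fin.cases (by simp) fun l' x _ _ h => ?_)
        (fun l => Fin.cases (fun x _ h _ => ?_) fun l' x hll => ?_)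
      · exact (hfE l' x h).2.symm
      · exact (hfE l x h).2
      · exact hne l l' x (fun h => hll (by rw [h]))
    · intro x hx t ht
      by_cases h : t = lo x
      · exact ⟨0, ⟨t, ht⟩, h.symm⟩
      · obtain ⟨l, hl⟩ := hcov x ((hcard x).1 hx) t ⟨ht, h⟩
        exact ⟨l.succ, hl⟩

end Enumeration

/-- A definable set is, up to a set with empty interior, a finite disjoint union of open connected
definable sets. -/
def OpenDecomposition (L : Language) [L.Structure ℝ] (X : Type*) [DSpace X]
    [TopologicalSpace X] : Prop :=
  ∀ (A : Set ℝ) (S : Set X), DefP L A (· ∈ S) → ∃ (κ : Type) (_ : Finite κ) (C : κ → Set X),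
    (∀ i, DefP L A (· ∈ C i)) ∧ (∀ i, IsOpen (C i)) ∧ (∀ i, IsPreconnected (C i)) ∧
    (∀ i, C i ⊆ S) ∧ (∀ i j x, x ∈ C i → x ∈ C j → i = j) ∧ interior (S \ ⋃ i, C i) = ∅

/-- `g` is a finite family of definable continuous sections of `E ⊆ X × Y → X`, with disjoint
graphs, defined on open connected sets, and exhausting `E` over a set whose complement has empty
interior. -/
structure IsSectionFamily (L : Language) [L.Structure ℝ] (A : Set ℝ) {X Y : Type*} [DSpace X]
    [TopologicalSpace X] [DSpace Y] [TopologicalSpace Y] (E : Set (X × Y)) {κ : Type}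
    (D : κ → Set X) (g : κ → X → Y) : Prop where
  finite : Finite κ
  def_dom : ∀ i, DefP L A (· ∈ D i)
  isOpen : ∀ i, IsOpen (D i)
  isPreconnected : ∀ i, IsPreconnected (D i)
  def_map : ∀ i, DefMap L A (g i)
  continuousOn : ∀ i, ContinuousOn (g i) (D i)
  mem : ∀ i, ∀ x ∈ D i, (x, g i x) ∈ E
  disjoint : ∀ i j x, i ≠ j → x ∈ D i → x ∈ D j → g i x ≠ g j x
  exhaust : interior {x | ∃ y, (x, y) ∈ E ∧ ∀ i, x ∈ D i → g i x ≠ y} = ∅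

/-- The properties of the spaces `ℝ^n` on which the decomposition theorem rests. -/
structure Tame (L : Language) [L.Structure ℝ] (X : Type*) [DSpace X] [TopologicalSpace X] :
    Prop where
  baire : DefBaire L X
  cont : GenericallyContinuous L X
  decomp : OpenDecomposition L X

theorem interior_eq_empty_mono {X : Type*} [TopologicalSpace X] {S T : Set X} (h : S ⊆ T)
    (hT : interior T = ∅) : interior S = ∅ :=
  subset_empty_iff.1 (hT ▸ interior_mono h)

theorem exists_open_forall {X : Type*} [TopologicalSpace X] {κ : Type*} [Finite κ]
    (P : κ → Set X → Prop) (anti : ∀ i O O', O' ⊆ O → P i O → P i O')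
    (dense : ∀ i O, IsOpen O → O.Nonempty → ∃ O' ⊆ O, IsOpen O' ∧ O'.Nonempty ∧ P i O')
    {O : Set X} (hO : IsOpen O) (hne : O.Nonempty) :
    ∃ O' ⊆ O, IsOpen O' ∧ O'.Nonempty ∧ ∀ i, P i O' := by
  classical
  cases nonempty_fintype κ
  suffices h : ∀ s : Finset κ, ∃ O' ⊆ O, IsOpen O' ∧ O'.Nonempty ∧ ∀ i ∈ s, P i O' by
    obtain ⟨O', h1, h2, h3, h4⟩ := h Finset.univ
    exact ⟨O', h1, h2, h3, fun i => h4 i (Finset.mem_univ i)⟩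
  intro s
  induction s using Finset.induction_on with
  | empty => exact ⟨O, le_rfl, hO, hne, by simp⟩
  | insert a s _ ih =>
    obtain ⟨O₁, h1, h2, h3, h4⟩ := ih
    obtain ⟨O₂, k1, k2, k3, k4⟩ := dense a O₁ h2 h3
    refine ⟨O₂, k1.trans h1, k2, k3, fun i hi => ?_⟩
    rcases Finset.mem_insert.1 hi with rfl | hi
    · exact k4
    · exact anti i _ _ k1 (h4 i hi)

/-! ### Generic uniform finiteness and the inductive step for decompositions -/

section Sections
variable {X : Type*} [DSpace X] [PseudoMetricSpace X] [DMetric L X]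

theorem GenericallyContinuous.interior_not_continuousAt (h : GenericallyContinuous L X) {f : X → ℝ}
    (hf : DefMap L univ f) : interior {x | ¬ ContinuousAt f x} = ∅ := by
  by_contra hne
  obtain ⟨O', h1, h2, ⟨x, hx⟩, h4⟩ := h f hf _ isOpen_interior (nonempty_iff_ne_empty.2 hne)
  exact interior_subset (h1 hx) (h4.continuousAt (h2.mem_nhds hx))

/-- Being within distance `ε` is a bijection between `s` and `t`. -/
def Matched (ε : ℝ) (s t : Set ℝ) : Prop :=
  (∀ a ∈ s, ∃ b, (b ∈ t ∧ |a - b| < ε) ∧ ∀ c, c ∈ t → |a - c| < ε → c = b) ∧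
  (∀ b ∈ t, ∃ a, (a ∈ s ∧ |a - b| < ε) ∧ ∀ c, c ∈ s → |c - b| < ε → c = a)

theorem Matched.ncard_eq {ε : ℝ} {s t : Set ℝ} (h : Matched ε s t) : s.ncard = t.ncard := by
  obtain ⟨h1, h2⟩ := h
  choose! f hf hf' using h1
  choose! g hg hg' using h2
  refine ncard_congr (fun a _ => f a) (fun a ha => (hf a ha).1) (fun a b ha hb hab => ?_)
    (fun b hb => ⟨g b, (hg b hb).1, ?_⟩)
  · rw [hg' (f a) (hf a ha).1 a ha (hf a ha).2]
    exact (hg' (f a) (hf a ha).1 b hb (hab ▸ (hf b hb).2)).symm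
  · exact (hf' (g b) (hg b hb).1 b hb (hg b hb).2).symm

/-- The cardinality of the fibre is locally constant on a definable set `G` whose complement has
empty interior. `G` is, up to empty interior, a finite union of connected sets, and on each of them
the cardinality is constant. -/
theorem exists_generic_ncard_le (hX : Tame L X) {E : Set (X × ℝ)} (hE : DefP L univ (· ∈ E))
    (hfin : ∀ x, {t | (x, t) ∈ E}.Finite) :
    ∃ N : ℕ, interior {x | ¬ {t | (x, t) ∈ E}.ncard ≤ N} = ∅ := by
  let F : X → Set ℝ := fun x => {t | (x, t) ∈ E}
  let G : Set X := {x | ∃ ε : ℝ, 0 < ε ∧ ∃ δ : ℝ, 0 < δ ∧ ∀ x', Dist.dist x' x < δ →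
    Matched ε (F x) (F x')}
  -- Local constancy of the cardinality is not visibly first-order. The existence of a matching by
  -- proximity is, and it implies equality of cardinalities.
  have hG : DefP L univ (· ∈ G) := by
    refine .ex (.and (.lt (by fun_prop) (by fun_prop)) (.ex (.and (.lt (by fun_prop) (by fun_prop))
      (.all (.imp (.lt (by fun_prop) (by fun_prop)) (.and ?_ ?_))))))
    · refine .all (.imp (hE.comp (by fun_prop)) (.ex (.and (.and (hE.comp (by fun_prop))
        (.lt (by fun_prop) (by fun_prop))) (.all (.imp (hE.comp (by fun_prop))
        (.imp (.lt (by fun_prop) (by fun_prop)) (.eq (by fun_prop) (by fun_prop))))))))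
    · refine .all (.imp (hE.comp (by fun_prop)) (.ex (.and (.and (hE.comp (by fun_prop))
        (.lt (by fun_prop) (by fun_prop))) (.all (.imp (hE.comp (by fun_prop))
        (.imp (.lt (by fun_prop) (by fun_prop)) (.eq (by fun_prop) (by fun_prop))))))))
  -- On an open subset of the complement the cardinality would be bounded by some `N`. Then the
  -- enumerating functions are continuous, with constant domains, on a smaller open set, and they
  -- match nearby fibres.
  have hGc : interior Gᶜ = ∅ := by
    by_contra hne
    obtain ⟨N, O₁, hO₁, hO₁o, hO₁ne, hN⟩ := hX.baire ℕ (fun N => {x | (F x).ncard ≤ N})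
      (fun N => (exists_enumeration N hE hfin).1) _ isOpen_interior (nonempty_iff_ne_empty.2 hne)
      (fun x _ => mem_iUnion.2 ⟨_, le_refl (F x).ncard⟩)
    obtain ⟨-, f, S, hf, hS, hfE, hinj, hcov⟩ := exists_enumeration N hE hfin
    obtain ⟨O₂, hO₂, hO₂o, ⟨x₀, hx₀⟩, hP⟩ := exists_open_forall
      (fun l O => ContinuousOn (f l) O ∧ (O ⊆ S l ∨ O ⊆ (S l)ᶜ))
      (fun l O O' h hP => ⟨hP.1.mono h, hP.2.imp h.trans h.trans⟩)
      (fun l O hO hne => by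
        obtain ⟨O', a1, a2, a3, a4⟩ := hX.cont (f l) (hf l) O hO hne
        obtain ⟨O'', b1, b2, b3, b4⟩ := hX.baire.mem_or (hS l) a2 a3
        exact ⟨O'', b1.trans a1, b2, b3, a4.mono b1, b4⟩) hO₁o hO₁ne
    refine interior_subset (hO₁ (hO₂ hx₀)) ?_
    -- Distinct values over `x₀` are more than `2 * ε` apart and each branch moves by less than `ε`,
    -- so that only values of the same branch can be within `ε` of each other.
    have hε : ∀ᶠ ε in 𝓝[>] (0 : ℝ), ∀ l l', f l x₀ ≠ f l' x₀ → 2 * ε < |f l x₀ - f l' x₀| := by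
      rw [Filter.eventually_all]; intro l
      rw [Filter.eventually_all]; intro l'
      by_cases h : f l x₀ = f l' x₀
      · simp [h]
      · have h' : 0 < |f l x₀ - f l' x₀| := abs_pos.2 (sub_ne_zero.2 h)
        filter_upwards [Ioo_mem_nhdsGT (half_pos h')] with ε hε _
        linarith [hε.2]
    obtain ⟨ε, hε1, hε2⟩ := (hε.and self_mem_nhdsWithin).exists
    have hε0 : 0 < ε := hε2
    have hev : ∀ᶠ x in 𝓝 x₀, x ∈ O₂ ∧ ∀ l, |f l x - f l x₀| < ε := by
      refine Filter.Eventually.and (hO₂o.mem_nhds hx₀) (Filter.eventually_all.2 fun l => ?_)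
      exact Metric.tendsto_nhds.1 ((hP l).1.continuousAt (hO₂o.mem_nhds hx₀)) ε hε0
    obtain ⟨δ, hδ, hball⟩ := Metric.eventually_nhds_iff.1 hev
    have hiff : ∀ l, ∀ x ∈ O₂, ∀ y ∈ O₂, x ∈ S l → y ∈ S l := fun l x hx y hy hxS => by
      rcases (hP l).2 with h | h
      · exact h hy
      · exact absurd hxS (h hx)
    have hmem : ∀ x ∈ O₂, ∀ t ∈ F x, ∃ l, x ∈ S l ∧ f l x = t := fun x hx t ht =>
      hcov x (hN (hO₂ hx)) t ht
    refine ⟨ε, hε0, δ, hδ, fun x hx => ?_⟩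
    obtain ⟨hxO, hxl⟩ := hball hx
    have habs : ∀ l l', x ∈ S l → x ∈ S l' → |f l x₀ - f l' x| < ε → l' = l := by
      intro l l' h1 h2 h3
      by_contra hll
      have h4 := hε1 l' l (hinj l' l x₀ hll (hiff _ _ hxO _ hx₀ h2) (hiff _ _ hxO _ hx₀ h1))
      have h5 := hxl l'
      rw [abs_lt] at h3 h5
      rcases lt_abs.1 h4 with h6 | h6 <;> linarith [h3.1, h3.2, h5.1, h5.2]
    constructor
    · intro a ha
      obtain ⟨l, hl, rfl⟩ := hmem x₀ hx₀ a ha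
      have hlx := hiff l _ hx₀ _ hxO hl
      refine ⟨f l x, ⟨hfE l x hlx, by rw [abs_sub_comm]; exact hxl l⟩, fun c hc hac => ?_⟩
      obtain ⟨l', hl', rfl⟩ := hmem x hxO c hc
      rw [habs l l' hlx hl' hac]
    · intro b hb
      obtain ⟨l, hl, rfl⟩ := hmem x hxO b hb
      have hlx := hiff l _ hxO _ hx₀ hl
      refine ⟨f l x₀, ⟨hfE l x₀ hlx, by rw [abs_sub_comm]; exact hxl l⟩, fun c hc hac => ?_⟩
      obtain ⟨l', hl', rfl⟩ := hmem x₀ hx₀ c hc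
      rw [habs l' l (hiff l' _ hx₀ _ hxO hl') hl hac]
  obtain ⟨κ, _, C, hCd, hCo, hCp, hCG, -, hCr⟩ := hX.decomp univ G hG
  have hconst : ∀ i, ∃ N, ∀ x ∈ C i, (F x).ncard = N := by
    intro i
    rcases (C i).eq_empty_or_nonempty with h | ⟨x₀, hx₀⟩
    · exact ⟨0, by simp [h]⟩
    · refine ⟨(F x₀).ncard, fun x hx => ?_⟩
      refine (hCp i).constant (f := fun x => (F x).ncard) (fun y hy => ?_) hx hx₀
      obtain ⟨ε, -, δ, hδ, hm⟩ := hCG i hy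
      refine ContinuousAt.continuousWithinAt ?_
      refine (continuousAt_const (y := (F y).ncard)).congr ?_
      exact Metric.eventually_nhds_iff.2 ⟨δ, hδ, fun x hx => (hm x hx).ncard_eq⟩
  choose N hN using hconst
  cases nonempty_fintype κ
  refine ⟨Finset.univ.sup N, interior_eq_empty_mono (T := Gᶜ ∪ (G \ ⋃ i, C i)) (fun x hx => ?_)
    (hX.baire.interior_union hG.not hGc hCr)⟩
  by_cases hxG : x ∈ G
  · refine .inr ⟨hxG, fun hxC => hx ?_⟩
    obtain ⟨i, hi⟩ := mem_iUnion.1 hxC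
    exact (hN i x hi).trans_le (Finset.le_sup (f := N) (Finset.mem_univ i))
  · exact .inl hxG

theorem def_iUnion {κ : Type*} [Finite κ] {C : κ → Set X} (hC : ∀ i, DefP L A (· ∈ C i)) :
    DefP L A (· ∈ ⋃ i, C i) := (DefP.finEx hC).congr fun _ => mem_iUnion

/-- The enumerating functions are restricted to their continuity points and their domains
decomposed. What is lost lies over points where the bound `N` fails, where a function is
discontinuous, or which the decompositions omit; the union of these sets has empty interior. -/
theorem Tame.exists_sections_line (hX : Tame L X) {E : Set (X × ℝ)} (hE : DefP L A (· ∈ E))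
    (hfin : ∀ x, {t | (x, t) ∈ E}.Finite) :
    ∃ (κ : Type) (D : κ → Set X) (g : κ → X → ℝ), IsSectionFamily L A E D g := by
  obtain ⟨N, hN⟩ := exists_generic_ncard_le hX hE.to_univ hfin
  obtain ⟨hNd, f, S, hf, hS, hfE, hinj, hcov⟩ := exists_enumeration N hE hfin
  have hS' : ∀ l, DefP L A (· ∈ {x | x ∈ S l ∧ ContinuousAt (f l) x}) := fun l =>
    .and (hS l) (.continuousAt (f := fun _ => f l) ((hf l).comp (by fun_prop)) (by fun_prop))
  choose κ hκ C hCd hCo hCp hCS hCdisj hCr using fun l => hX.decomp A _ (hS' l)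
  refine ⟨Σ l, κ l, fun i => C i.1 i.2, fun i => f i.1, inferInstance, fun i => hCd _ _,
    fun i => hCo _ _, fun i => hCp _ _, fun i => hf _,
    fun i x hx => (hCS _ _ hx).2.continuousWithinAt, fun i x hx => hfE _ _ (hCS _ _ hx).1, ?_, ?_⟩
  · rintro ⟨l, i⟩ ⟨l', j⟩ x hij hx hx'
    refine hinj l l' x ?_ (hCS _ _ hx).1 (hCS _ _ hx').1
    rintro rfl
    exact hij (by rw [hCdisj l i j x hx hx'])
  · have h1 : ∀ l, DefP L univ (· ∈ {x | ¬ ContinuousAt (f l) x}) := fun l =>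
      .not (.continuousAt (f := fun _ => f l) ((hf l).to_univ.comp (by fun_prop)) (by fun_prop))
    have h2 : ∀ l, DefP L univ (· ∈ {x | x ∈ S l ∧ ContinuousAt (f l) x} \ ⋃ i, C l i) := fun l =>
      ((hS' l).and (def_iUnion (hCd l)).not).to_univ
    refine interior_eq_empty_mono (fun x hx => ?_) (hX.baire.interior_union hNd.to_univ.not hN
      (hX.baire.interior_union (def_iUnion h1) (hX.baire.interior_iUnion h1 fun l =>
        hX.cont.interior_not_continuousAt (hf l).to_univ) (hX.baire.interior_iUnion h2 hCr)))
    obtain ⟨t, ht, hx⟩ := hx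
    by_cases hc : {t | (x, t) ∈ E}.ncard ≤ N
    · obtain ⟨l, hl, rfl⟩ := hcov x hc t ht
      by_cases hcl : ContinuousAt (f l) x
      · refine .inr (.inr (mem_iUnion.2 ⟨l, ⟨hl, hcl⟩, fun h => ?_⟩))
        obtain ⟨i, hi⟩ := mem_iUnion.1 h
        exact hx ⟨l, i⟩ hi rfl
      · exact .inr (.inl (mem_iUnion.2 ⟨l, hcl⟩))
    · exact .inl hc

/-- The projection is open, so a separation of `T` induces an open cover of `C`, and connectedness
of `C` gives a common point. The connected fibre over it meets both parts. -/
theorem isPreconnected_of_fibers {T : Set (X × ℝ)} {C : Set X} (hT : IsOpen T)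
    (hC : IsPreconnected C) (hTC : ∀ p ∈ T, p.1 ∈ C)
    (hfib : ∀ x ∈ C, {t | (x, t) ∈ T}.Nonempty ∧ IsPreconnected {t | (x, t) ∈ T}) :
    IsPreconnected T := by
  intro u v hu hv huv ⟨p, hpT, hpu⟩ ⟨q, hqT, hqv⟩
  obtain ⟨x, hxC, ⟨⟨x1, t1⟩, h1, rfl⟩, ⟨⟨x2, t2⟩, h2, hx2⟩⟩ := hC _ _
    (isOpenMap_fst _ (hT.inter hu)) (isOpenMap_fst _ (hT.inter hv)) (fun x hx => by
      obtain ⟨t, ht⟩ := (hfib x hx).1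
      rcases huv ht with h | h
      · exact .inl ⟨(x, t), ⟨ht, h⟩, rfl⟩
      · exact .inr ⟨(x, t), ⟨ht, h⟩, rfl⟩)
    ⟨p.1, hTC p hpT, p, ⟨hpT, hpu⟩, rfl⟩ ⟨q.1, hTC q hqT, q, ⟨hqT, hqv⟩, rfl⟩
  obtain rfl : x2 = x1 := hx2
  have hcont : Continuous (fun t : ℝ => (x2, t)) := by fun_prop
  obtain ⟨t, ht, ht'⟩ := (hfib _ hxC).2 _ _ (hu.preimage hcont) (hv.preimage hcont)
    (fun t ht => huv ht) ⟨t1, h1⟩ ⟨t2, h2⟩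
  exact ⟨(x2, t), ht, ht'⟩

/-- The frontiers of the vertical fibres are finite and generically given by finitely many sections.
Between consecutive sections a fibre lies inside `S` or outside it, so the bands inside `S`, over
suitable open connected bases, form the decomposition. -/
theorem OpenDecomposition.prod (hX : Tame L X) : OpenDecomposition L (X × ℝ) := by
  intro A S hS
  let E : Set (X × ℝ) := {p | p.2 ∈ frontier {t | (p.1, t) ∈ S}}
  have hE : DefP L A (· ∈ E) := by
    refine (DefP.and (P := fun p : X × ℝ => ∀ ε : ℝ, 0 < ε → ∃ t, (p.1, t) ∈ S ∧ Dist.dist p.2 t < ε)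
      (Q := fun p : X × ℝ => ∀ ε : ℝ, 0 < ε → ∃ t, (p.1, t) ∉ S ∧ Dist.dist p.2 t < ε)
      (.all (.imp (.lt (by fun_prop) (by fun_prop)) (.ex (.and (hS.comp (by fun_prop))
        (.lt (by fun_prop) (by fun_prop))))))
      (.all (.imp (.lt (by fun_prop) (by fun_prop)) (.ex (.and
        (hS.not.comp (f := fun p : ((X × ℝ) × ℝ) × ℝ => (p.1.1.1, p.2)) (by fun_prop))
        (.lt (by fun_prop) (by fun_prop))))))).congr fun p => ?_
    show p.2 ∈ frontier _ ↔ _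
    rw [frontier_eq_closure_inter_closure, mem_inter_iff, Metric.mem_closure_iff,
      Metric.mem_closure_iff]
    rfl
  have hfin : ∀ x, {t | (x, t) ∈ E}.Finite := fun x =>
    finite_frontier (hS.to_univ.comp (DefMap.real_prodMk_left x))
  obtain ⟨κ, D, f, hD⟩ := hX.exists_sections_line hE hfin
  have := hD.finite
  -- A sign condition `σ` says of each section whether it is absent (`none`), below `t` (`some
  -- true`) or above `t` (`some false`). The resulting set of heights is order-convex.
  let T : (κ → Option Bool) → X → Set ℝ := fun σ x => {t | ∀ i,
    (σ i = some true → f i x < t) ∧ (σ i = some false → t < f i x)}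
  have hTd : ∀ σ, DefP L A (fun p : X × ℝ => p.2 ∈ T σ p.1) := fun σ => .finAll fun i => by
    have := hD.def_map i
    exact .and (.imp (.const _) (.lt (by fun_prop) (by fun_prop)))
      (.imp (.const _) (.lt (by fun_prop) (by fun_prop)))
  have hTp : ∀ σ x, IsPreconnected (T σ x) := fun σ x => by
    refine OrdConnected.isPreconnected ⟨fun a ha b hb t ht i => ⟨fun h => ?_, fun h => ?_⟩⟩
    · exact ((ha i).1 h).trans_le ht.1
    · exact ht.2.trans_lt ((hb i).2 h)
  -- Over `B σ`, exactly the sections named by `σ` are present and the corresponding band is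
  -- nonempty and inside `S`.
  let B : (κ → Option Bool) → Set X := fun σ => {x | (∀ i, x ∈ D i ↔ σ i ≠ none) ∧
    (∃ t, t ∈ T σ x) ∧ ∀ t, t ∈ T σ x → (x, t) ∈ S}
  have hBd : ∀ σ, DefP L A (· ∈ B σ) := fun σ => by
    refine .and (.finAll fun i => ?_) (.and (.ex (hTd σ)) (.all (.imp (hTd σ)
      (hS.comp (by fun_prop)))))
    exact ((((hD.def_dom i)).and (.const (σ i ≠ none))).or
      ((((hD.def_dom i)).not.and (.const (¬ σ i ≠ none))))).congr fun x => by
      tauto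
  choose μ hμ C hCd hCo hCp hCB hCdisj hCr using fun σ => hX.decomp A _ (hBd σ)
  have hmemC : ∀ σ j x, x ∈ C σ j → ∀ i, σ i ≠ none → x ∈ D i := fun σ j x hx i hi =>
    ((hCB σ j hx).1 i).2 hi
  let P : (Σ σ, μ σ) → Set (X × ℝ) := fun a => {p | p.1 ∈ C a.1 a.2 ∧ p.2 ∈ T a.1 p.1}
  have hPo : ∀ a, IsOpen (P a) := by
    rintro ⟨σ, j⟩
    rw [isOpen_iff_mem_nhds]
    rintro ⟨x, t⟩ ⟨hx, ht⟩
    have hfc : ∀ i, σ i ≠ none → ContinuousAt (fun p : X × ℝ => f i p.1) (x, t) := fun i hi =>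
      ((hD.continuousOn i).continuousAt
        ((hD.isOpen i).mem_nhds (hmemC σ j x hx i hi))).comp (x := (x, t)) continuousAt_fst
    refine Filter.Eventually.and (continuousAt_fst.eventually ((hCo σ j).mem_nhds hx))
      (Filter.eventually_all.2 fun i => ?_)
    rcases hσ : σ i with _ | b
    · simp [hσ]
    · have hc := hfc i (by simp [hσ])
      rcases b
      · filter_upwards [continuousAt_snd.eventually_lt hc ((ht i).2 hσ)] with p hp
        simpa [hσ] using hp
      · filter_upwards [hc.eventually_lt continuousAt_snd ((ht i).1 hσ)] with p hp
        simpa [hσ] using hp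
  refine ⟨Σ σ, μ σ, inferInstance, P, fun a => .and ((hCd a.1 a.2).comp (by fun_prop)) (hTd a.1),
    hPo, fun a => isPreconnected_of_fibers (hPo a) (hCp a.1 a.2) (fun p hp => hp.1) fun x hx => ?_,
    ?_, ?_, ?_⟩
  · have hT : {t | (x, t) ∈ P a} = T a.1 x := by
      ext t; exact ⟨fun h => h.2, fun h => ⟨hx, h⟩⟩
    rw [hT]
    exact ⟨(hCB _ _ hx).2.1, hTp _ _⟩
  · rintro a ⟨x, t⟩ ⟨hx, ht⟩
    exact (hCB _ _ hx).2.2 t ht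
  · rintro ⟨σ, i⟩ ⟨τ, j⟩ ⟨x, t⟩ ⟨hx, ht⟩ ⟨hx', ht'⟩
    obtain rfl : σ = τ := by
      funext l
      have h1 := (hCB _ _ hx).1 l
      have h2 := (hCB _ _ hx').1 l
      have h3 := ht l
      have h4 := ht' l
      dsimp only at h1 h2 h3 h4
      rcases hσ : σ l with _ | _ | _ <;> rcases hτ : τ l with _ | _ | _ <;>
        simp only [hσ, hτ, ne_eq, not_true_eq_false, iff_false, reduceCtorEq, not_false_eq_true,
          iff_true, true_implies, false_implies, and_true, true_and, Option.some.injEq] at h1 h2 h3 h4 ⊢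
      · exact absurd h2 h1
      · exact absurd h2 h1
      · exact absurd h1 h2
      · exact absurd h3 h4.not_gt
      · exact absurd h1 h2
      · exact absurd h3 h4.not_gt
    rw [hCdisj σ i j x hx hx']
  · have hbad : DefP L univ (· ∈ {x | ∃ y, (x, y) ∈ E ∧ ∀ i, x ∈ D i → f i x ≠ y}) := by
      refine DefP.to_univ (.ex (.and hE (.finAll fun i => .imp ((hD.def_dom i).comp (by fun_prop))
        (.not (.eq ?_ (by fun_prop))))))
      have := hD.def_map i
      fun_prop
    have hcyl : ∀ Z : Set X, interior Z = ∅ → interior {p : X × ℝ | p.1 ∈ Z} = ∅ := fun Z hZ => by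
      by_contra hne
      obtain ⟨p, hp⟩ := nonempty_iff_ne_empty.2 hne
      have := interior_maximal (s := Z) (image_subset_iff.2 interior_subset)
        (isOpenMap_fst _ (isOpen_interior (s := {p : X × ℝ | p.1 ∈ Z})))
      rw [hZ] at this
      exact this ⟨p, hp, rfl⟩
    have hgr : ∀ i, interior {p : X × ℝ | p.2 = f i p.1} = ∅ := fun i => by
      by_contra hne
      obtain ⟨Q, -, ⟨x, hx⟩, a, b, hab, hsub⟩ := isOpen_interior.exists_prod_Ioo_subset
        (nonempty_iff_ne_empty.2 hne)
      obtain ⟨c, hc⟩ := exists_between hab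
      obtain ⟨d, hd⟩ := exists_between hc.2
      have h1 : (x, c) ∈ {p : X × ℝ | p.2 = f i p.1} :=
        interior_subset (hsub (mk_mem_prod hx ⟨hc.1, hc.2⟩))
      have h2 : (x, d) ∈ {p : X × ℝ | p.2 = f i p.1} :=
        interior_subset (hsub (mk_mem_prod hx ⟨hc.1.trans hd.1, hd.2⟩))
      exact hd.1.ne (Eq.trans (b := f i x) h1 (Eq.symm h2))
    have hgd : ∀ i, DefP L univ (· ∈ {p : X × ℝ | p.2 = f i p.1}) := fun i => by
      have := (hD.def_map i).to_univ
      exact .eq (by fun_prop) (by fun_prop)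
    have hrd : ∀ σ, DefP L univ (· ∈ {p : X × ℝ | p.1 ∈ B σ \ ⋃ i, C σ i}) := fun σ =>
      (((hBd σ).and (def_iUnion (hCd σ)).not).to_univ).comp
        (f := fun p : X × ℝ => p.1) (by fun_prop)
    refine interior_eq_empty_mono (fun p hp => ?_) (hX.baire.prod.interior_union
      (hbad.comp (f := fun p : X × ℝ => p.1) (by fun_prop)) (hcyl _ hD.exhaust)
      (hX.baire.prod.interior_union (def_iUnion hgd) (hX.baire.prod.interior_iUnion hgd hgr)
        (hX.baire.prod.interior_iUnion hrd fun σ => hcyl _ (hCr σ))))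
    obtain ⟨x, t⟩ := p
    obtain ⟨hpS, hpP⟩ := hp
    by_cases hb : ∃ y, (x, y) ∈ E ∧ ∀ i, x ∈ D i → f i x ≠ y
    · exact .inl hb
    refine .inr ?_
    by_cases hg : ∃ i, t = f i x
    · obtain ⟨i, hi⟩ := hg
      exact .inl (mem_iUnion.2 ⟨i, hi⟩)
    refine .inr ?_
    push Not at hb hg
    classical
    let σ : κ → Option Bool := fun i => if x ∈ D i then some (decide (f i x < t)) else none
    have htT : t ∈ T σ x := by
      intro i
      by_cases hi : x ∈ D i
      · simp only [σ, hi, if_true, Option.some.injEq, decide_eq_true_eq, decide_eq_false_iff_not]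
        exact ⟨id, fun h => lt_of_le_of_ne (not_lt.1 h) (hg i)⟩
      · simp [σ, hi]
    have hxB : x ∈ B σ := by
      refine ⟨fun i => by by_cases hi : x ∈ D i <;> simp [σ, hi], ⟨t, htT⟩, fun s hs => ?_⟩
      -- Every frontier point of this fibre is the value of a section present at `x`, whereas the
      -- band avoids all such values. The band therefore lies on one side of `S`, namely the side of
      -- `t`.
      have hfr : ∀ s ∈ T σ x, s ∉ frontier {t | (x, t) ∈ S} := by
        intro s hs hfs
        obtain ⟨i, hi, his⟩ := hb s hfs
        have h1 := hs i
        simp only [σ, hi, if_true, Option.some.injEq, decide_eq_true_eq, decide_eq_false_iff_not,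
          his, lt_irrefl, imp_false, not_not] at h1
        exact h1.1 h1.2
      rcases (hTp σ x).subset_or_subset_compl_of_frontier hfr with h | h
      · exact h hs
      · exact absurd hpS (h htT)
    refine mem_iUnion.2 ⟨σ, hxB, fun hC => hpP ?_⟩
    obtain ⟨j, hj⟩ := mem_iUnion.1 hC
    exact mem_iUnion.2 ⟨⟨σ, j⟩, hj, htT⟩

theorem Tame.prod (hX : Tame L X) : Tame L (X × ℝ) :=
  ⟨hX.baire.prod, hX.cont.prod hX.baire, OpenDecomposition.prod hX⟩

end Sections

/-! ### Tameness of all the spaces `ℝ^n` -/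

theorem Tame.of_subsingleton {X : Type*} [DSpace X] [TopologicalSpace X] [Subsingleton X] :
    Tame L X where
  baire := .of_finite
  cont := .of_subsingleton
  decomp A S hS := by
    refine ⟨Unit, inferInstance, fun _ => S, fun _ => hS, fun _ => ?_, fun _ => ?_, fun _ => le_rfl,
      fun _ _ _ _ _ => rfl, by simp [iUnion_const]⟩
    · rcases S.eq_empty_or_nonempty with h | h
      · rw [h]; exact isOpen_empty
      · rw [Subsingleton.eq_univ_of_nonempty h]; exact isOpen_univ
    · exact (subsingleton_of_subsingleton).isPreconnected

theorem Tame.of_homeomorph {X Y : Type*} [DSpace X] [TopologicalSpace X] [DSpace Y]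
    [TopologicalSpace Y] (e : X ≃ₜ Y) (he : ∀ A, DefMap L A e) (he' : ∀ A, DefMap L A e.symm)
    (hX : Tame L X) : Tame L Y where
  baire κ _ S hS O hO hne hcov := by
    obtain ⟨i, O', h1, h2, h3, h4⟩ := hX.baire κ (fun i => e ⁻¹' S i) (fun i => (hS i).comp (he _))
      (e ⁻¹' O) (hO.preimage e.continuous) (hne.preimage e.surjective) (by
        rw [← preimage_iUnion]; exact preimage_mono hcov)
    exact ⟨i, e '' O', image_subset_iff.2 h1, e.isOpenMap _ h2, h3.image e, image_subset_iff.2 h4⟩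
  cont f hf O hO hne := by
    obtain ⟨O', h1, h2, h3, h4⟩ := hX.cont (fun x => f (e x)) (hf.comp (he _)) (e ⁻¹' O)
      (hO.preimage e.continuous) (hne.preimage e.surjective)
    refine ⟨e '' O', image_subset_iff.2 h1, e.isOpenMap _ h2, h3.image e, ?_⟩
    have : ContinuousOn (fun y => (fun x => f (e x)) (e.symm y)) (e '' O') :=
      h4.comp e.symm.continuous.continuousOn (by rintro _ ⟨x, hx, rfl⟩; simpa using hx)
    simpa using this
  decomp A S hS := by
    obtain ⟨κ, hκ, C, h1, h2, h3, h4, h5, h6⟩ := hX.decomp A (e ⁻¹' S) (hS.comp (he _))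
    refine ⟨κ, hκ, fun i => e.symm ⁻¹' C i, fun i => (h1 i).comp (he' _),
      fun i => (h2 i).preimage e.symm.continuous, fun i => ?_, fun i y hy => ?_,
      fun i j y hi hj => h5 i j _ hi hj, ?_⟩
    · change IsPreconnected (e.symm ⁻¹' C i)
      rw [← e.image_eq_preimage_symm]
      exact (h3 i).image _ e.continuous.continuousOn
    · have := h4 i hy
      simpa using this
    · have : S \ ⋃ i, e.symm ⁻¹' C i = e.symm ⁻¹' (e ⁻¹' S \ ⋃ i, C i) := by
        ext y; simp
      rw [this, ← e.symm.preimage_interior, h6, preimage_empty]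

/-- `ℝ^n × ℝ` is `ℝ^(n+1)`. -/
def consHomeomorph (n : ℕ) : (Fin n → ℝ) × ℝ ≃ₜ (Fin (n + 1) → ℝ) where
  toFun p := Fin.cons p.2 p.1
  invFun z := (Fin.tail z, z 0)
  left_inv p := by simp
  right_inv z := by simp
  continuous_toFun := by
    refine continuous_pi (Fin.cases ?_ fun i => ?_)
    · exact continuous_snd
    · exact (continuous_apply i).comp continuous_fst
  continuous_invFun := by
    refine .prodMk (continuous_pi fun i => continuous_apply i.succ) (continuous_apply 0)

@[fun_prop]
theorem DefMap.cons {X : Type*} [DSpace X] {n : ℕ} {f : X → Fin n → ℝ} {g : X → ℝ}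
    (hf : DefMap L A f) (hg : DefMap L A g) :
    DefMap L A (fun x => (Fin.cons (g x) (f x) : Fin (n + 1) → ℝ)) := by
  refine .pi (Fin.cases ?_ fun i => ?_)
  · exact hg
  · simp only [Fin.cons_succ]; fun_prop

@[fun_prop]
theorem DefMap.tail {n : ℕ} :
    DefMap L A (fun z : Fin (n + 1) → ℝ => (Fin.tail z : Fin n → ℝ)) :=
  .pi fun i => DefMap.apply i.succ

theorem defMap_consHomeomorph (n : ℕ) : DefMap L A (consHomeomorph n) :=
  DefMap.cons (f := fun p : (Fin n → ℝ) × ℝ => p.1) (g := fun p => p.2) (by fun_prop) (by fun_prop)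

theorem defMap_consHomeomorph_symm (n : ℕ) : DefMap L A (consHomeomorph n).symm :=
  DefMap.prodMk (f := fun z : Fin (n + 1) → ℝ => (Fin.tail z : Fin n → ℝ)) (g := fun z => z 0)
    (by fun_prop) (by fun_prop)

theorem tame_fin (n : ℕ) : Tame L (Fin n → ℝ) := by
  induction n with
  | zero => exact .of_subsingleton
  | succ n ih =>
    exact Tame.of_homeomorph (consHomeomorph n) (fun _ => defMap_consHomeomorph n)
      (fun _ => defMap_consHomeomorph_symm n) ih.prod

end OMin

namespace OMin

variable {L : Language} [L.Structure ℝ] [hL : Fact (IsOMinimal L)] {A : Set ℝ}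

/-! ### Definable sets with empty interior are null, and sections of definable maps -/

theorem measurePreserving_consHomeomorph (n : ℕ) :
    MeasurePreserving (consHomeomorph n) (volume : Measure ((Fin n → ℝ) × ℝ)) volume := by
  have := ((volume_preserving_piFinSuccAbove (fun _ : Fin (n + 1) => ℝ) 0).symm).comp
    (Measure.measurePreserving_swap (μ := (volume : Measure (Fin n → ℝ))) (ν := (volume : Measure ℝ)))
  have h : (consHomeomorph n : (Fin n → ℝ) × ℝ → Fin (n + 1) → ℝ) =
      (MeasurableEquiv.piFinSuccAbove (fun _ : Fin (n + 1) => ℝ) 0).symm ∘ Prod.swap := by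
    funext p i
    refine Fin.cases ?_ (fun i => ?_) i <;> simp [consHomeomorph, MeasurableEquiv.piFinSuccAbove]
  rw [h]
  exact this

/-- Induction and Fubini: for almost all `x` the vertical fibre contains no interval and is
therefore finite. -/
theorem volume_eq_zero_of_interior_eq_empty {n : ℕ} {S : Set (Fin n → ℝ)}
    (hS : DefP L univ (· ∈ S)) (h : interior S = ∅) : volume S = 0 := by
  induction n with
  | zero =>
    have : S = ∅ := by
      by_contra hne
      have hu := Subsingleton.eq_univ_of_nonempty (nonempty_iff_ne_empty.2 hne)
      rw [hu, interior_univ] at h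
      exact univ_nonempty.ne_empty h
    rw [this, measure_empty]
  | succ n ih =>
    -- Passing to the closure gives Borel measurability without creating interior.
    have hT : DefP L univ (· ∈ closure S) := hS.closure
    have hTi : interior (closure S) = ∅ := (tame_fin (L := L) (n + 1)).baire.interior_closure hS h
    let T' : Set ((Fin n → ℝ) × ℝ) := consHomeomorph n ⁻¹' closure S
    have hT'c : IsClosed T' := isClosed_closure.preimage (consHomeomorph n).continuous
    have hT'd : DefP L univ (· ∈ T') := hT.comp (defMap_consHomeomorph n)
    have hT'i : interior T' = ∅ := by
      rw [← (consHomeomorph n).preimage_interior, hTi, preimage_empty]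
    refine measure_mono_null subset_closure ?_
    rw [← (measurePreserving_consHomeomorph n).measure_preimage
      isClosed_closure.measurableSet.nullMeasurableSet]
    change ((volume : Measure (Fin n → ℝ)).prod (volume : Measure ℝ)) T' = 0
    rw [Measure.measure_prod_null hT'c.measurableSet]
    -- If the set of base points whose fibre contains a fixed rational interval had interior, `T'`
    -- would contain a box. So this set is null by induction, and there are countably many rational
    -- intervals.
    let Z : ℚ × ℚ → Set (Fin n → ℝ) := fun r =>
      {x | r.1 < r.2 ∧ ∀ t : ℝ, (r.1 : ℝ) < t → t < r.2 → (x, t) ∈ T'}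
    have hZd : ∀ r, DefP L univ (· ∈ Z r) := fun r => .and (.const _) (.all (.imp
      (.lt (DefMap.univ_const _) (by fun_prop)) (.imp (.lt (by fun_prop) (DefMap.univ_const _))
        (hT'd.comp (f := fun p : (Fin n → ℝ) × ℝ => (p.1, p.2)) (by fun_prop)))))
    have hZi : ∀ r, interior (Z r) = ∅ := fun r => by
      by_contra hne
      obtain ⟨x, hx⟩ := nonempty_iff_ne_empty.2 hne
      have hr : (r.1 : ℝ) < r.2 := by exact_mod_cast (interior_subset hx).1
      obtain ⟨t, ht⟩ := nonempty_Ioo.2 hr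
      have hsub : interior (Z r) ×ˢ Ioo (r.1 : ℝ) r.2 ⊆ T' := fun p hp =>
        (interior_subset hp.1).2 p.2 hp.2.1 hp.2.2
      have := interior_maximal hsub (isOpen_interior.prod isOpen_Ioo)
      rw [hT'i] at this
      exact this (mk_mem_prod hx ht)
    have hae : ∀ᵐ x : Fin n → ℝ, ∀ r, x ∉ Z r :=
      ae_all_iff.2 fun r => measure_eq_zero_iff_ae_notMem.1 (ih (hZd r) (hZi r))
    filter_upwards [hae] with x hx
    refine (Finite.countable ?_).measure_zero volume
    refine finite_of_interior_eq_empty (L := L) (hT'd.comp (DefMap.real_prodMk_left x)) ?_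
    by_contra hne
    obtain ⟨p, q, hpq, hsub⟩ := isOpen_interior.exists_rat_Ioo_subset (nonempty_iff_ne_empty.2 hne)
    exact hx (p, q) ⟨hpq, fun t h1 h2 => interior_subset (s := Prod.mk x ⁻¹' T') (hsub ⟨h1, h2⟩)⟩

theorem volume_sdiff_interior {n : ℕ} {S : Set (Fin n → ℝ)} (hS : DefP L univ (· ∈ S)) :
    volume (S \ interior S) = 0 := by
  refine volume_eq_zero_of_interior_eq_empty (L := L) (hS.and hS.interior.not) ?_
  by_contra hne
  obtain ⟨x, hx⟩ := nonempty_iff_ne_empty.2 hne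
  exact (interior_subset hx).2 (interior_mono sdiff_subset hx)

theorem nullMeasurableSet_of_defP {n : ℕ} {S : Set (Fin n → ℝ)} (hS : DefP L univ (· ∈ S)) :
    NullMeasurableSet S volume := by
  have : S = interior S ∪ S \ interior S := (union_sdiff_cancel interior_subset).symm
  rw [this]
  exact isOpen_interior.measurableSet.nullMeasurableSet.union
    (.of_null (volume_sdiff_interior (L := L) hS))

/-! ### Sections of definable sets with countable fibres -/

section Sections
variable {X : Type*} [DSpace X] [PseudoMetricSpace X] [DMetric L X]

theorem IsSectionFamily.def_exhaust {Y : Type*} [DSpace Y] [TopologicalSpace Y] {E : Set (X × Y)}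
    (hE : DefP L A (· ∈ E)) {κ : Type} {D : κ → Set X} {g : κ → X → Y}
    (h : IsSectionFamily L A E D g) :
    DefP L A (· ∈ {x | ∃ y, (x, y) ∈ E ∧ ∀ i, x ∈ D i → g i x ≠ y}) := by
  have := h.finite
  refine .ex (.and (hE.comp (f := fun p : X × Y => (p.1, p.2)) (by fun_prop))
    (.finAll fun i => .imp ((h.def_dom i).comp (by fun_prop)) ?_))
  have := h.def_map i
  have h1 : DefP L A (fun p : X × Y => ∀ j, DSpace.coord (g i p.1) j = DSpace.coord p.2 j) :=
    .finAll fun j => .eq (f := fun p : X × Y => DSpace.coord (g i p.1) j)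
      (fun _ => (this.comp (f := fun p : X × Y => p.1) (by fun_prop)) j)
      (fun _ => (DefMap.snd (f := fun p : X × Y => p) (by fun_prop)) j)
  refine h1.not.congr fun p => ?_
  rw [← funext_iff, DSpace.coord.injective.eq_iff]

/-- Induction on `m`: sections of the image under `Fin.tail` are lifted, the added coordinate being
treated by the one-dimensional case over each of them. -/
theorem Tame.exists_sections_fin (hX : Tame L X) {m : ℕ} {E : Set (X × (Fin m → ℝ))}
    (hE : DefP L A (· ∈ E)) (hc : ∀ x, {y | (x, y) ∈ E}.Countable) :
    ∃ (κ : Type) (D : κ → Set X) (g : κ → X → Fin m → ℝ), IsSectionFamily L A E D g := by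
  induction m with
  | zero =>
    have h0 : DefMap L A (fun x : X => (x, (0 : Fin 0 → ℝ))) :=
      .prodMk (by fun_prop) (.pi fun i => i.elim0)
    obtain ⟨κ, hκ, C, h1, h2, h3, h4, h5, h6⟩ := hX.decomp A {x | (x, 0) ∈ E} (hE.comp h0)
    refine ⟨κ, C, fun _ _ => 0, hκ, h1, h2, h3, fun i => .pi fun i => i.elim0,
      fun i => continuousOn_const, fun i x hx => h4 i hx,
      fun i j x hij hi hj => absurd (h5 i j x hi hj) hij, ?_⟩
    refine interior_eq_empty_mono (fun x hx => ?_) h6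
    obtain ⟨y, hy, hx⟩ := hx
    obtain rfl : y = 0 := Subsingleton.elim _ _
    exact ⟨hy, fun h => by obtain ⟨i, hi⟩ := mem_iUnion.1 h; exact hx i hi rfl⟩
  | succ m ih =>
    let E' : Set (X × (Fin m → ℝ)) := {p | ∃ t : ℝ, (p.1, (Fin.cons t p.2 : Fin (m + 1) → ℝ)) ∈ E}
    have hE' : DefP L A (· ∈ E') := .ex (hE.comp (by fun_prop))
    obtain ⟨κ, D, g, hD⟩ := ih hE' (fun x => by
      refine ((hc x).image Fin.tail).mono ?_
      rintro y ⟨t, ht⟩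
      exact ⟨_, ht, Fin.tail_cons _ _⟩)
    have := hD.finite
    let F : κ → Set (X × ℝ) := fun i =>
      {p | p.1 ∈ D i ∧ (p.1, (Fin.cons p.2 (g i p.1) : Fin (m + 1) → ℝ)) ∈ E}
    have hF : ∀ i, DefP L A (· ∈ F i) := fun i => by
      have := hD.def_map i
      exact .and ((hD.def_dom i).comp (by fun_prop)) (hE.comp (by fun_prop))
    -- A countable definable subset of the line is finite.
    have hFfin : ∀ i x, {t | (x, t) ∈ F i}.Finite := fun i x => by
      refine finite_of_countable ((hF i).to_univ.comp (DefMap.real_prodMk_left x)) ?_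
      refine ((hc x).preimage_of_injOn (f := fun t => (Fin.cons t (g i x) : Fin (m + 1) → ℝ))
        (Function.Injective.injOn fun a b hab => ?_)).mono fun t ht => ht.2
      simpa using congrFun hab 0
    choose μ C f hC using fun i => hX.exists_sections_line (hF i) (hFfin i)
    have hμ : ∀ i, Finite (μ i) := fun i => (hC i).finite
    refine ⟨Σ i, μ i, fun a => C a.1 a.2, fun a x => Fin.cons (f a.1 a.2 x) (g a.1 x),
      inferInstance, fun a => (hC _).def_dom _, fun a => (hC _).isOpen _,
      fun a => (hC _).isPreconnected _, fun a => ?_, fun a => ?_, fun a x hx => ?_, ?_, ?_⟩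
    · have := hD.def_map a.1
      have := (hC a.1).def_map a.2
      fun_prop
    · have h1 := (hC a.1).continuousOn a.2
      have h2 := (hD.continuousOn a.1).mono fun x hx => ((hC a.1).mem a.2 x hx).1
      exact (consHomeomorph m).continuous.comp_continuousOn (h2.prodMk h1)
    · exact ((hC a.1).mem a.2 x hx).2
    · rintro ⟨i, j⟩ ⟨i', j'⟩ x hne hx hx' h
      have h0 := congrFun h 0
      have h1 := congrArg Fin.tail h
      simp only [Fin.cons_zero, Fin.tail_cons] at h0 h1
      by_cases hi : i = i'
      · subst hi
        exact (hC i).disjoint j j' x (fun hj => hne (by rw [hj])) hx hx' h0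
      · exact hD.disjoint i i' x hi ((hC i).mem j x hx).1 ((hC i').mem j' x hx').1 h1
    · refine interior_eq_empty_mono (fun x hx => ?_) (hX.baire.interior_union
        (hD.def_exhaust hE').to_univ hD.exhaust (hX.baire.interior_iUnion
        (fun i => ((hC i).def_exhaust (hF i)).to_univ) fun i => (hC i).exhaust))
      obtain ⟨y, hy, hx⟩ := hx
      have hyE : (x, (Fin.cons (y 0) (Fin.tail y) : Fin (m + 1) → ℝ)) ∈ E := by
        rwa [Fin.cons_self_tail]
      by_cases h : ∀ i, x ∈ D i → g i x ≠ Fin.tail y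
      · exact .inl ⟨Fin.tail y, ⟨y 0, hyE⟩, h⟩
      · push Not at h
        obtain ⟨i, hi, hgi⟩ := h
        refine .inr (mem_iUnion.2 ⟨i, y 0, ⟨hi, by rw [hgi]; exact hyE⟩, fun j hj hf => ?_⟩)
        refine hx ⟨i, j⟩ hj ?_
        simp only [hf, hgi, Fin.cons_self_tail]

theorem Tame.exists_sections (hX : Tame L X) {α : Type} [Finite α] {E : Set (X × (α → ℝ))}
    (hE : DefP L A (· ∈ E)) (hc : ∀ x, {y | (x, y) ∈ E}.Countable) :
    ∃ (κ : Type) (D : κ → Set X) (g : κ → X → α → ℝ), IsSectionFamily L A E D g := by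
  obtain ⟨m, ⟨e⟩⟩ := Finite.exists_equiv_fin α
  let e' := e.arrowCongr (Equiv.refl ℝ)
  have he : ∀ y, e' y = fun i => y (e.symm i) := fun y => rfl
  have he' : ∀ z, e'.symm z = fun i => z (e i) := fun y => rfl
  obtain ⟨κ, D, g, h⟩ := hX.exists_sections_fin (A := A)
    (E := {p : X × (Fin m → ℝ) | (p.1, fun i => p.2 (e i)) ∈ E})
    (hE.comp (f := fun p : X × (Fin m → ℝ) => (p.1, fun i => p.2 (e i))) (by fun_prop))
    (fun x => (hc x).preimage_of_injOn (f := fun (z : Fin m → ℝ) i => z (e i)) e'.symm.injective.injOn)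
  refine ⟨κ, D, fun i x j => g i x (e j), h.finite, h.def_dom, h.isOpen, h.isPreconnected,
    fun i => ?_, fun i => ?_, h.mem, fun i j x hij hi hj hg => ?_, ?_⟩
  · have := h.def_map i
    fun_prop
  · have := h.continuousOn i
    fun_prop
  · exact h.disjoint i j x hij hi hj (e'.symm.injective hg)
  · refine interior_eq_empty_mono ?_ h.exhaust
    rintro x ⟨y, hy, hx⟩
    refine ⟨e' y, ?_, fun i hi hg => hx i hi ?_⟩
    · have : (fun i => e' y (e i)) = y := e'.symm_apply_apply y
      show (x, fun i => e' y (e i)) ∈ E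
      rwa [this]
    · show (e'.symm (g i x)) = y
      rw [hg, e'.symm_apply_apply]

end Sections

end OMin

namespace OMin

variable {L : Language} [L.Structure ℝ] [hL : Fact (IsOMinimal L)]

/-! ### Integrals of bounded definable functions as volumes -/

theorem ratCast_mem_subfield (k : Subfield ℝ) (q : ℚ) : (q : ℝ) ∈ (k : Set ℝ) :=
  SubfieldClass.ratCast_mem k q

/-- An open set has closed subsets, made up of finitely many rational boxes, of any given smaller
rational volume. -/
theorem exists_isClosed_subset_volume_eq (k : Subfield ℝ) {n : ℕ} {E : Set (Fin (n + 1) → ℝ)}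
    (hE : IsOpen E) {q : ℚ} (hq : 0 < q) (h : ENNReal.ofReal q < volume E) :
    ∃ T ⊆ E, IsClosed T ∧ DefP L (k : Set ℝ) (· ∈ T) ∧ volume T = ENNReal.ofReal q := by
  classical
  let X := Fin (n + 1) → ℝ
  -- The covered point is arbitrary, but the cube assigned to it has rational centre and radius,
  -- which keeps the cube definable over `k`.
  let J := X × (Fin (n + 1) → ℚ) × ℚ
  let cen : J → X := fun a i => (a.2.1 i : ℝ)
  let rad : J → ℝ := fun a => a.2.2
  let t : Set J := {a | 0 < rad a ∧ Dist.dist a.1 (cen a) ≤ rad a ∧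
    Metric.closedBall (cen a) (rad a) ⊆ E}
  -- A cube of radius `r` near the point lies in the ball of radius `2 * r` around it. Vitali's
  -- theorem compares the cube with the ball enlarged three times, whence the constant `6 ^ (n +
  -- 1)`.
  obtain ⟨u, hut, huc, hud, hu0⟩ := Vitali.exists_disjoint_covering_ae (volume : Measure X) E t
    ((6 : NNReal) ^ (n + 1)) (fun a => 2 * rad a) (fun a => a.1)
    (fun a => Metric.closedBall (cen a) (rad a)) (by
      rintro a ⟨h1, h2, -⟩ y hy
      rw [Metric.mem_closedBall] at *
      linarith [dist_triangle y (cen a) a.1, dist_comm a.1 (cen a)]) (by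
      rintro a ⟨h1, -, -⟩
      rw [Real.volume_pi_closedBall _ (by positivity), Real.volume_pi_closedBall _ h1.le,
        Fintype.card_fin, ENNReal.coe_pow, ENNReal.coe_ofNat, ← ENNReal.ofReal_ofNat,
        ← ENNReal.ofReal_pow (by positivity), ← ENNReal.ofReal_mul (by positivity), ← mul_pow]
      refine ENNReal.ofReal_le_ofReal (le_of_eq ?_)
      ring) (by
      rintro a ⟨h1, -, -⟩
      exact ⟨cen a, Metric.ball_subset_interior_closedBall (Metric.mem_ball_self h1)⟩)
    (fun a _ => Metric.isClosed_closedBall) (by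
      intro x hx ε hε
      obtain ⟨δ, hδ, hδE⟩ := Metric.isOpen_iff.1 hE x hx
      obtain ⟨ρ, hρ0, hρ⟩ := exists_rat_btwn (show 0 < min (ε / 2) (δ / 2) by positivity)
      have hr : ∀ i, ∃ r : ℚ, |x i - r| < ρ := fun i => by
        obtain ⟨r, h1, h2⟩ := exists_rat_btwn (show x i - ρ < x i by linarith)
        exact ⟨r, by rw [abs_lt]; constructor <;> linarith⟩
      choose r hr using hr
      have hxr : Dist.dist x (fun i => (r i : ℝ)) ≤ ρ :=
        (dist_pi_le_iff hρ0.le).2 fun i => (hr i).le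
      refine ⟨(x, r, ρ), ⟨hρ0, hxr, fun y hy => hδE ?_⟩, ?_, rfl⟩
      · rw [Metric.mem_closedBall] at hy
        rw [Metric.mem_ball]
        have h1 : Dist.dist y (fun i => (r i : ℝ)) ≤ ρ := hy
        have := dist_triangle y (fun i => (r i : ℝ)) x
        rw [dist_comm (fun i => (r i : ℝ)) x] at this
        linarith [hρ.trans_le (min_le_right _ _)]
      · show 2 * (ρ : ℝ) ≤ ε
        linarith [hρ.trans_le (min_le_left _ _)])
  have hvol : ∀ a ∈ t, volume (Metric.closedBall (cen a) (rad a)) =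
      ENNReal.ofReal ((2 * rad a) ^ (n + 1)) := fun a ha => by
    rw [Real.volume_pi_closedBall _ ha.1.le, Fintype.card_fin]
  have hlt : ENNReal.ofReal q < ∑' a : u, volume (Metric.closedBall (cen a) (rad a)) := by
    refine h.trans_le ?_
    rw [← measure_biUnion huc hud (fun a _ => Metric.isClosed_closedBall.measurableSet)]
    refine (measure_mono (subset_union_left.trans (sdiff_union_self
      (s := E) (t := ⋃ a ∈ u, Metric.closedBall (cen a) (rad a))).ge)).trans
      ((measure_union_le _ _).trans ?_)
    rw [hu0, zero_add]
  rw [ENNReal.tsum_eq_iSup_sum] at hlt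
  obtain ⟨F', hF'⟩ := lt_iSup_iff.1 hlt
  let F : Finset J := F'.map (Function.Embedding.subtype _)
  have hFu : ∀ a ∈ F, a ∈ u := by
    intro a ha
    obtain ⟨b, -, rfl⟩ := Finset.mem_map.1 ha
    exact b.2
  let V : ℚ := ∑ a ∈ F, (2 * a.2.2) ^ (n + 1)
  have hV : (V : ℝ) = ∑ a ∈ F, (2 * rad a) ^ (n + 1) := by simp [V, rad]
  have hpos : ∀ a ∈ F, 0 < rad a := fun a ha => (hut (hFu a ha)).1
  have hqV : q < V := by
    have h1 : ENNReal.ofReal q < ENNReal.ofReal V := by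
      refine hF'.trans_eq ?_
      rw [hV, ENNReal.ofReal_sum_of_nonneg fun a ha => by have := hpos a ha; positivity,
        Finset.sum_map]
      exact Finset.sum_congr rfl fun a _ => hvol _ (hut a.2)
    exact_mod_cast (ENNReal.ofReal_lt_ofReal_iff_of_nonneg (by positivity)).1 h1
  have hV0 : 0 < V := hq.trans hqV
  -- Finitely many disjoint cubes have total volume `V > q`. Shrinking all of them by the factor `q
  -- / V` in coordinate `0` only makes the volume exactly `q` and keeps the boxes rational.
  let l : ℚ := q / V
  have hl0 : 0 < l := div_pos hq hV0
  have hl1 : l ≤ 1 := ((div_lt_one hV0).2 hqV).le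
  have hl0' : (0 : ℝ) < l := by exact_mod_cast hl0
  have hl1' : (l : ℝ) ≤ 1 := by exact_mod_cast hl1
  let lo : J → X := fun a => Fin.cons (a.2.1 0 - l * a.2.2) (fun i => a.2.1 i.succ - a.2.2)
  let hi : J → X := fun a => Fin.cons (a.2.1 0 + l * a.2.2) (fun i => a.2.1 i.succ + a.2.2)
  have hsub : ∀ a ∈ F, Icc (lo a) (hi a) ⊆ Metric.closedBall (cen a) (rad a) := by
    intro a ha y hy
    have h0 := hpos a ha
    have h0' : (l : ℝ) * rad a ≤ rad a := mul_le_of_le_one_left h0.le hl1'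
    rw [Metric.mem_closedBall, dist_pi_le_iff h0.le]
    intro i
    have h1 := hy.1 i
    have h2 := hy.2 i
    rw [Real.dist_eq, abs_le]
    refine Fin.cases (fun h1 h2 => ?_) (fun i h1 h2 => ?_) i h1 h2
    · simp only [lo, hi, Fin.cons_zero] at h1 h2
      simp only [cen, rad] at *
      constructor <;> linarith
    · simp only [lo, hi, Fin.cons_succ] at h1 h2
      simp only [cen, rad] at *
      constructor <;> linarith
  have hvolI : ∀ a ∈ F, volume (Icc (lo a) (hi a)) =
      ENNReal.ofReal (l * (2 * rad a) ^ (n + 1)) := by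
    intro a ha
    have h0 := hpos a ha
    rw [Real.volume_Icc_pi, Fin.prod_univ_succ]
    simp only [lo, hi, Fin.cons_zero, Fin.cons_succ]
    have e1 : ((a.2.1 0 : ℝ) + l * a.2.2 - (a.2.1 0 - l * a.2.2)) = l * (2 * rad a) := by
      simp only [rad]; ring
    have e2 : ∀ i : Fin n, ((a.2.1 i.succ : ℝ) + a.2.2 - (a.2.1 i.succ - a.2.2)) = 2 * rad a := by
      intro i; simp only [rad]; ring
    simp only [e1, e2, Finset.prod_const, Finset.card_univ, Fintype.card_fin]
    rw [← ENNReal.ofReal_pow (by positivity), ← ENNReal.ofReal_mul (by positivity)]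
    congr 1
    ring
  refine ⟨⋃ a ∈ F, Icc (lo a) (hi a), iUnion₂_subset fun a ha =>
    (hsub a ha).trans (hut (hFu a ha)).2.2, ?_, ?_, ?_⟩
  · exact isClosed_biUnion_finset fun a _ => isClosed_Icc
  · have hlo : ∀ (a : J) (i : Fin (n + 1)), lo a i ∈ (k : Set ℝ) ∧ hi a i ∈ (k : Set ℝ) := by
      intro a i
      refine Fin.cases ?_ (fun i => ?_) i
      · simp only [lo, hi, Fin.cons_zero]
        exact ⟨by exact_mod_cast ratCast_mem_subfield k (a.2.1 0 - l * a.2.2),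
          by exact_mod_cast ratCast_mem_subfield k (a.2.1 0 + l * a.2.2)⟩
      · simp only [lo, hi, Fin.cons_succ]
        exact ⟨by exact_mod_cast ratCast_mem_subfield k (a.2.1 i.succ - a.2.2),
          by exact_mod_cast ratCast_mem_subfield k (a.2.1 i.succ + a.2.2)⟩
    refine (DefP.finEx (P := fun (a : F) (y : X) => (∀ i, lo a i ≤ y i) ∧ (∀ i, y i ≤ hi a i))
      fun a => .and (.finAll fun i => .le (.const (hlo a i).1) (by fun_prop))
        (.finAll fun i => .le (by fun_prop) (.const (hlo a i).2))).congr fun y => ?_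
    simp only [mem_iUnion, Subtype.exists, exists_prop]
    rfl
  · rw [measure_biUnion_finset (fun a ha b hb hab => (hud (hFu a ha) (hFu b hb) hab).mono
      (hsub a ha) (hsub b hb)) fun a _ => measurableSet_Icc, Finset.sum_congr rfl hvolI,
      ← ENNReal.ofReal_sum_of_nonneg fun a ha => by have := hpos a ha; positivity,
      ← Finset.mul_sum, ← hV]
    congr 1
    have : (V : ℝ) ≠ 0 := by exact_mod_cast hV0.ne'
    simp only [l]
    push_cast
    field_simp

theorem aemeasurable_of_defMap {d : ℕ} {h : (Fin d → ℝ) → ℝ} (hh : DefMap L univ h) :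
    AEMeasurable h volume := by
  have h1 : NullMeasurable h (volume : Measure (Fin d → ℝ)) := by
    have : Measurable (fun x : NullMeasurableSpace (Fin d → ℝ) volume => h x) :=
      measurable_of_Ioi fun a => nullMeasurableSet_of_defP (L := L)
        (S := {x | a < h x}) (.lt (DefMap.univ_const a) hh)
    exact fun s hs => this hs
  exact h1.aemeasurable

/-- A shift by a constant makes the function positive over a cube, and a set of rational boxes of
the added volume is then removed. Positivity of the integral leaves room for these boxes inside the
open region. -/
theorem exists_volume_eq_integral_of_pos (k : Subfield ℝ) {d : ℕ} {h : (Fin d → ℝ) → ℝ}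
    (hh : DefMap L (k : Set ℝ) h) {C N : ℝ} (hC : ∀ x, |h x| ≤ C)
    (hN : ∀ x, h x ≠ 0 → ‖x‖ ≤ N) (hpos : 0 < ∫ x, h x) :
    ∃ S : Set (Fin (d + 1) → ℝ), DefP L (k : Set ℝ) (· ∈ S) ∧ IsOpen S ∧
      Bornology.IsBounded S ∧ ∫ x, h x = (volume S).toReal := by
  -- Natural numbers are chosen so that the cube, the shift and the added volume involve only
  -- parameters from `k`.
  obtain ⟨c, hc⟩ := exists_nat_gt C
  obtain ⟨m, hm⟩ := exists_nat_gt N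
  have hc0 : (0 : ℝ) < c := (abs_nonneg _).trans_lt ((hC 0).trans_lt hc)
  obtain ⟨x₀, hx₀⟩ : ∃ x, h x ≠ 0 := by
    by_contra! h0
    simp [h0] at hpos
  have hm0 : (0 : ℝ) < m := (norm_nonneg _).trans_lt ((hN x₀ hx₀).trans_lt hm)
  let Q : Set (Fin d → ℝ) := Metric.ball 0 m
  have hQd : DefP L (k : Set ℝ) (· ∈ Q) := by
    refine (DefP.finAll (P := fun (i : Fin d) (x : Fin d → ℝ) => |x i| < m)
      fun i => .lt (by fun_prop) (.const (by exact_mod_cast ratCast_mem_subfield k m))).congr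
      fun x => ?_
    rw [mem_ball_zero_iff, pi_norm_lt_iff hm0]
    rfl
  have hQvol : volume.real Q = (2 * m) ^ d := by
    rw [measureReal_def, Real.volume_pi_ball _ hm0, Fintype.card_fin,
      ENNReal.toReal_ofReal (by positivity)]
  let E : Set (Fin (d + 1) → ℝ) := {z | Fin.tail z ∈ Q ∧ 0 < z 0 ∧ z 0 < h (Fin.tail z) + c}
  have hcD : ∀ {Y : Type} [DSpace Y], DefMap L (k : Set ℝ) (fun _ : Y => (c : ℝ)) :=
    fun {Y} _ => .const (by exact_mod_cast ratCast_mem_subfield k c)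
  have hE : DefP L (k : Set ℝ) (· ∈ E) := .and (hQd.comp (by fun_prop))
    (.and (.lt (by fun_prop) (by fun_prop)) (.lt (by fun_prop) (.add (by fun_prop) hcD)))
  have hmeas := aemeasurable_of_defMap (L := L) hh.to_univ
  have hint : IntegrableOn h Q volume :=
    Measure.integrableOn_of_bounded (M := C) measure_ball_lt_top.ne hmeas.aestronglyMeasurable
      (Filter.Eventually.of_forall hC)
  have hsup : ∫ x in Q, h x = ∫ x, h x := by
    refine setIntegral_eq_integral_of_forall_compl_eq_zero fun x hx => ?_
    by_contra h0
    exact hx (mem_ball_zero_iff.2 ((hN x h0).trans_lt hm))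
  have hEvol : volume E = ENNReal.ofReal ((∫ x, h x) + c * (2 * m) ^ d) := by
    rw [← (measurePreserving_consHomeomorph d).measure_preimage
      (nullMeasurableSet_of_defP (L := L) hE.to_univ)]
    have h1 : consHomeomorph d ⁻¹' E = regionBetween (fun _ => 0) (fun x => h x + c) Q := by
      ext p
      simp [E, consHomeomorph, regionBetween]
    rw [h1]
    have h2 := volume_regionBetween_eq_integral (μ := (volume : Measure (Fin d → ℝ)))
      (f := fun _ => 0) (g := fun x => h x + c) (s := Q) integrableOn_zero
      (hint.add (integrableOn_const measure_ball_lt_top.ne)) measurableSet_ball (fun x _ => by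
        have := (abs_le.1 (hC x)).1
        show 0 ≤ h x + c
        linarith)
    refine h2.trans ?_
    congr 1
    simp only [Pi.sub_apply, sub_zero]
    rw [integral_add hint (integrableOn_const measure_ball_lt_top.ne), hsup, setIntegral_const,
      hQvol, smul_eq_mul, mul_comm]
  have hEo : volume (interior E) = volume E := by
    refine le_antisymm (measure_mono interior_subset) ?_
    refine (measure_mono (sdiff_union_of_subset interior_subset).ge).trans
      ((measure_union_le _ _).trans ?_)
    rw [volume_sdiff_interior (L := L) hE.to_univ, zero_add]
  let q : ℚ := c * (2 * m) ^ d
  have hq : (q : ℝ) = c * (2 * m) ^ d := by simp [q]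
  have hq0 : (0 : ℝ) < q := by rw [hq]; positivity
  -- The interior has the same volume as `E`, which exceeds `q` because the integral is positive.
  -- Removing a closed set keeps the result open.
  obtain ⟨T, hTE, hTc, hTd, hTv⟩ := exists_isClosed_subset_volume_eq (L := L) k
    (isOpen_interior (s := E)) (q := q) (by exact_mod_cast hq0) (by
      rw [hEo, hEvol, ← hq]
      exact (ENNReal.ofReal_lt_ofReal_iff (by positivity)).2 (by linarith))
  refine ⟨interior E \ T, hE.interior.and hTd.not, isOpen_interior.sdiff hTc, ?_, ?_⟩
  · refine (isBounded_iff_forall_norm_le.2 ⟨C + c + m, fun z hz => ?_⟩).subset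
      (sdiff_subset.trans interior_subset : _ ⊆ E)
    have h1 := abs_le.1 (hC (Fin.tail z))
    have hC0 : 0 ≤ C := (abs_nonneg _).trans (hC 0)
    rw [pi_norm_le_iff_of_nonneg (by positivity)]
    intro i
    rw [Real.norm_eq_abs, abs_le]
    refine Fin.cases ?_ (fun i => ?_) i
    · constructor <;> linarith [hz.2.1, hz.2.2]
    · have h2 : ‖Fin.tail z i‖ < m := (norm_le_pi_norm _ i).trans_lt (mem_ball_zero_iff.1 hz.1)
      rw [Real.norm_eq_abs, abs_lt] at h2
      have h3 : Fin.tail z i = z i.succ := rfl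
      rw [h3] at h2
      constructor <;> linarith [h2.1, h2.2]
  · rw [measure_sdiff hTE hTc.measurableSet.nullMeasurableSet (by rw [hTv]; exact ENNReal.ofReal_ne_top),
      hEo, hEvol, hTv, ← hq, ← ENNReal.ofReal_sub _ hq0.le, add_sub_cancel_right,
      ENNReal.toReal_ofReal hpos.le]

theorem exists_volume_eq_integral (k : Subfield ℝ) {d : ℕ} {h : (Fin d → ℝ) → ℝ}
    (hh : DefMap L (k : Set ℝ) h) {C N : ℝ} (hC : ∀ x, |h x| ≤ C)
    (hN : ∀ x, h x ≠ 0 → ‖x‖ ≤ N) :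
    ∃ S : Set (Fin (d + 1) → ℝ), DefP L (k : Set ℝ) (· ∈ S) ∧ IsOpen S ∧
      Bornology.IsBounded S ∧
      (∫ x, h x = (volume S).toReal ∨ ∫ x, h x = -(volume S).toReal) := by
  rcases lt_trichotomy (∫ x, h x) 0 with h0 | h0 | h0
  · obtain ⟨S, h1, h2, h3, h4⟩ := exists_volume_eq_integral_of_pos k (h := fun x => - h x)
      hh.neg (C := C) (N := N) (by simpa using hC) (by simpa using hN)
      (by rw [integral_neg]; linarith)
    exact ⟨S, h1, h2, h3, .inr (by rw [← h4, integral_neg, neg_neg])⟩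
  · exact ⟨∅, DefP.const False, isOpen_empty, Bornology.isBounded_empty, .inl (by simp [h0])⟩
  · obtain ⟨S, h1, h2, h3, h4⟩ := exists_volume_eq_integral_of_pos k hh hC hN h0
    exact ⟨S, h1, h2, h3, .inl h4⟩

end OMin

namespace OMin

namespace DefinableManifold

variable {L : Language} [L.Structure ℝ] {k : Subfield ℝ} {p : ℕ∞}
  {M : Type*} [TopologicalSpace M] (X : DefinableManifold L k p M)

/-! ### Transition maps -/

theorem mem_transition_source {i j : Fin X.r} {y : X.Coord i} :
    y ∈ (X.transition i j).source ↔
      y ∈ (X.chart i).target ∧ (X.chart i).symm y ∈ (X.chart j).source := by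
  simp [transition, PartialEquiv.trans_source]

theorem transition_apply (i j : Fin X.r) (y : X.Coord i) :
    X.transition i j y = X.chart j ((X.chart i).symm y) := rfl

theorem hasFDerivWithinAt_transition (hp : 1 ≤ p) {i j : Fin X.r} {y : X.Coord i}
    (hy : y ∈ (X.transition i j).source) :
    HasFDerivWithinAt (X.transition i j) (X.transitionDeriv i j y) (X.transition i j).source y := by
  obtain ⟨O, hO, hsub, g, hg, heq⟩ := X.contDiff_transition i j
  have hgd : DifferentiableAt ℝ g y := ((hg.contDiffAt (hO.mem_nhds (hsub hy))).differentiableAt (by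
    have : (1 : WithTop ℕ∞) ≤ (p : WithTop ℕ∞) := by exact_mod_cast hp
    exact (zero_lt_one.trans_le this).ne'))
  have : DifferentiableWithinAt ℝ (X.transition i j) (X.transition i j).source y :=
    hgd.differentiableWithinAt.congr (fun z hz => heq hz) (heq hy)
  exact this.hasFDerivWithinAt

theorem hasFDerivAt_transition_comp (hp : 1 ≤ p) {i j : Fin X.r} {E : Type*}
    [NormedAddCommGroup E] [NormedSpace ℝ E] {ψ : E → X.Coord i} {ψ' : E →L[ℝ] X.Coord i} {w : E}
    (hψ : HasFDerivAt ψ ψ' w) (hev : ∀ᶠ v in 𝓝 w, ψ v ∈ (X.transition i j).source) :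
    HasFDerivAt (fun v => X.transition i j (ψ v)) ((X.transitionDeriv i j (ψ w)).comp ψ') w :=
  (X.hasFDerivWithinAt_transition hp hev.self_of_nhds).comp_hasFDerivAt w hψ hev

theorem contDiffOn_transition_comp {i j : Fin X.r} {E : Type*}
    [NormedAddCommGroup E] [NormedSpace ℝ E] {ψ : E → X.Coord i} {W : Set E}
    (hψ : ContDiffOn ℝ p ψ W) (hW : ∀ v ∈ W, ψ v ∈ (X.transition i j).source) :
    ContDiffOn ℝ p (fun v => X.transition i j (ψ v)) W := by
  obtain ⟨O, hO, hsub, g, hg, heq⟩ := X.contDiff_transition i j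
  exact (hg.comp hψ fun v hv => hsub (hW v hv)).congr fun v hv => heq (hW v hv)

theorem chart_isOpen_preimage {i : Fin X.r} {O : Set (X.Coord i)} (hO : IsOpen O) :
    IsOpen ((X.chart i).source ∩ X.chart i ⁻¹' O) :=
  (X.continuousOn_chart i).isOpen_inter_preimage (X.isOpen_source i) hO

variable {X}

theorem mem_chartImage {i : Fin X.r} {N : Set M} {y : X.Coord i} :
    y ∈ X.chartImage i N ↔ y ∈ (X.chart i).target ∧ (X.chart i).symm y ∈ N := by
  constructor
  · rintro ⟨x, ⟨hx, hxs⟩, rfl⟩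
    exact ⟨(X.chart i).map_source hxs, by rwa [(X.chart i).left_inv hxs]⟩
  · rintro ⟨h1, h2⟩
    exact ⟨_, ⟨h2, (X.chart i).map_target h1⟩, (X.chart i).right_inv h1⟩

theorem chart_mem_chartImage {i : Fin X.r} {N : Set M} {x : M} (hx : x ∈ (X.chart i).source) :
    X.chart i x ∈ X.chartImage i N ↔ x ∈ N := by
  rw [mem_chartImage, (X.chart i).left_inv hx]
  exact and_iff_right ((X.chart i).map_source hx)

/-! ### Local parametrizations in a given chart -/

namespace LocalParam

variable {d : ℕ} {N : Set M} (P : X.LocalParam d N)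

theorem toM_mem_source {w : Fin d → ℝ} (hw : w ∈ P.W) : P.toM w ∈ (X.chart P.i).source :=
  (X.chart P.i).map_target (P.mapsTo hw)

theorem chart_toM {w : Fin d → ℝ} (hw : w ∈ P.W) : X.chart P.i (P.toM w) = P.ψ w :=
  (X.chart P.i).right_inv (P.mapsTo hw)

theorem toM_mem {w : Fin d → ℝ} (hw : w ∈ P.W) : P.toM w ∈ N := by
  obtain ⟨V, -, h⟩ := P.isOpen_image
  have : P.toM w ∈ (X.chart P.i).symm '' (P.ψ '' P.W) := ⟨_, ⟨w, hw, rfl⟩, rfl⟩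
  rw [h] at this
  exact this.1

theorem injOn_toM : InjOn P.toM P.W := by
  intro w hw v hv h
  have h1 : P.ψ w = P.ψ v := by rw [← P.chart_toM hw, ← P.chart_toM hv, h]
  have := P.isEmbedding.injective (a₁ := ⟨w, hw⟩) (a₂ := ⟨v, hv⟩) h1
  exact congrArg Subtype.val this

theorem continuousOn_toM : ContinuousOn P.toM P.W :=
  (X.continuousOn_symm P.i).comp P.contDiffOn.continuousOn P.mapsTo

theorem isOpen_image_toM : ∃ V : Set M, IsOpen V ∧ P.toM '' P.W = N ∩ V := by
  obtain ⟨V, hV, h⟩ := P.isOpen_image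
  exact ⟨V, hV, by rw [← h, image_image]; rfl⟩

/-- This is where the embedding hypothesis enters: points of `N` close to `P.toM w` come from
parameters close to `w`. -/
theorem exists_mem_of_near {w : Fin d → ℝ} (hw : w ∈ P.W) {O : Set (Fin d → ℝ)} (hO : O ∈ 𝓝 w) :
    ∀ᶠ x in 𝓝 (P.toM w), x ∈ N → ∃ v ∈ P.W, v ∈ O ∧ P.toM v = x := by
  have h1 : ∃ U ∈ 𝓝 (P.ψ w), ∀ v ∈ P.W, P.ψ v ∈ U → v ∈ O := by
    have h2 : Subtype.val ⁻¹' O ∈ 𝓝 (⟨w, hw⟩ : P.W) := continuous_subtype_val.continuousAt hO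
    rw [P.isEmbedding.isInducing.nhds_eq_comap, Filter.mem_comap] at h2
    obtain ⟨U, hU, h⟩ := h2
    exact ⟨U, hU, fun v hv hvU => h (show (⟨v, hv⟩ : P.W) ∈ _ from hvU)⟩
  obtain ⟨U, hU, hUO⟩ := h1
  obtain ⟨V, hV, hVi⟩ := P.isOpen_image_toM
  have hsrc := (X.isOpen_source P.i).mem_nhds (P.toM_mem_source hw)
  have hcont := (X.continuousOn_chart P.i).continuousAt hsrc
  have hwV : P.toM w ∈ N ∩ V := hVi ▸ mem_image_of_mem _ hw
  filter_upwards [hV.mem_nhds hwV.2, hcont (by rw [P.chart_toM hw]; exact hU)] with x hxV hxU hxN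
  have : x ∈ P.toM '' P.W := hVi ▸ ⟨hxN, hxV⟩
  obtain ⟨v, hv, rfl⟩ := this
  refine ⟨v, hv, hUO v hv ?_, rfl⟩
  rw [← P.chart_toM hv]
  exact hxU

/-- The part of the domain that is mapped to the domain of the chart `κ`. -/
def domIn (κ : Fin X.r) : Set (Fin d → ℝ) := {w | w ∈ P.W ∧ P.toM w ∈ (X.chart κ).source}

/-- The parametrization, in the chart `κ`. -/
def inChart (κ : Fin X.r) (w : Fin d → ℝ) : X.Coord κ := X.chart κ (P.toM w)

theorem isOpen_domIn (κ : Fin X.r) : IsOpen (P.domIn κ) :=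
  P.continuousOn_toM.isOpen_inter_preimage P.isOpen_W (X.isOpen_source κ)

theorem ψ_mem_source {κ : Fin X.r} {w : Fin d → ℝ} (hw : w ∈ P.domIn κ) :
    P.ψ w ∈ (X.transition P.i κ).source := X.mem_transition_source.2 ⟨P.mapsTo hw.1, hw.2⟩

theorem contDiffOn_inChart (κ : Fin X.r) : ContDiffOn ℝ p (P.inChart κ) (P.domIn κ) :=
  X.contDiffOn_transition_comp (P.contDiffOn.mono fun _ h => h.1) fun _ h => P.ψ_mem_source h

theorem contDiffAt_inChart {κ : Fin X.r} {w : Fin d → ℝ} (hw : w ∈ P.domIn κ) :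
    ContDiffAt ℝ p (P.inChart κ) w :=
  (P.contDiffOn_inChart κ).contDiffAt ((P.isOpen_domIn κ).mem_nhds hw)

theorem _root_.OMin.one_le_coe {p : ℕ∞} (hp : 1 ≤ p) : (1 : WithTop ℕ∞) ≤ (p : WithTop ℕ∞) := by
  exact_mod_cast hp

theorem _root_.OMin.coe_ne_zero {p : ℕ∞} (hp : 1 ≤ p) : (p : WithTop ℕ∞) ≠ 0 :=
  (zero_lt_one.trans_le (one_le_coe hp)).ne'

theorem hasFDerivAt_ψ (hp : 1 ≤ p) {w : Fin d → ℝ} (hw : w ∈ P.W) :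
    HasFDerivAt P.ψ (fderiv ℝ P.ψ w) w :=
  ((P.contDiffOn.contDiffAt (P.isOpen_W.mem_nhds hw)).differentiableAt
    (coe_ne_zero hp)).hasFDerivAt

theorem hasFDerivAt_inChart (hp : 1 ≤ p) {κ : Fin X.r} {w : Fin d → ℝ} (hw : w ∈ P.domIn κ) :
    HasFDerivAt (P.inChart κ) ((X.transitionDeriv P.i κ (P.ψ w)).comp (fderiv ℝ P.ψ w)) w :=
  X.hasFDerivAt_transition_comp hp (P.hasFDerivAt_ψ hp hw.1)
    (Filter.mem_of_superset ((P.isOpen_domIn κ).mem_nhds hw) fun _ h => P.ψ_mem_source h)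

theorem chart_symm_inChart {κ : Fin X.r} {w : Fin d → ℝ} (hw : w ∈ P.domIn κ) :
    (X.chart κ).symm (P.inChart κ w) = P.toM w := (X.chart κ).left_inv hw.2

theorem inChart_mem {κ : Fin X.r} {w : Fin d → ℝ} (hw : w ∈ P.domIn κ) :
    P.inChart κ w ∈ X.chartImage κ N := (chart_mem_chartImage hw.2).2 (P.toM_mem hw.1)

/-- The coordinates `c` of the parametrization, in the chart `κ`. -/
def coords (κ : Fin X.r) (c : Fin d → Fin (X.n κ) ⊕ Fin (X.m κ)) (w : Fin d → ℝ) : Fin d → ℝ :=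
  fun l => P.inChart κ w (c l)

/-- The Jacobian determinant of the coordinates `c`. -/
noncomputable def jac (κ : Fin X.r) (c : Fin d → Fin (X.n κ) ⊕ Fin (X.m κ)) (w : Fin d → ℝ) : ℝ :=
  (fderiv ℝ (P.coords κ c) w).det

/-- The coordinate projection given by `c`. -/
def _root_.OMin.coordProj {α : Type*} {d : ℕ} (c : Fin d → α) : (α → ℝ) →L[ℝ] (Fin d → ℝ) :=
  ContinuousLinearMap.pi fun l => ContinuousLinearMap.proj (c l)

theorem contDiffAt_coords {κ : Fin X.r} (c : Fin d → Fin (X.n κ) ⊕ Fin (X.m κ)) {w : Fin d → ℝ}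
    (hw : w ∈ P.domIn κ) : ContDiffAt ℝ p (P.coords κ c) w :=
  (coordProj c).contDiff.contDiffAt.comp w (P.contDiffAt_inChart hw)

theorem hasFDerivAt_coords (hp : 1 ≤ p) {κ : Fin X.r} (c : Fin d → Fin (X.n κ) ⊕ Fin (X.m κ))
    {w : Fin d → ℝ} (hw : w ∈ P.domIn κ) :
    HasFDerivAt (P.coords κ c) ((coordProj c).comp (fderiv ℝ (P.inChart κ) w)) w :=
  (coordProj c).hasFDerivAt.comp w (P.hasFDerivAt_inChart hp hw).differentiableAt.hasFDerivAt

theorem jac_eq_det (hp : 1 ≤ p) {κ : Fin X.r} (c : Fin d → Fin (X.n κ) ⊕ Fin (X.m κ))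
    {w : Fin d → ℝ} (hw : w ∈ P.domIn κ) :
    P.jac κ c w = Matrix.det (Matrix.of fun l j =>
      fderiv ℝ (P.inChart κ) w (Pi.single l 1) (c j)) := by
  rw [jac, (P.hasFDerivAt_coords hp c hw).fderiv, ContinuousLinearMap.det,
    ← LinearMap.det_toMatrix', ← Matrix.det_transpose]
  congr 1

end LocalParam

/-! ### The pull-back of a form in a given chart -/

/-- Multilinear expansion gives a sum over all index tuples, ordered or not. Averaging it over the
permutations of the arguments turns the products into determinants; the factor `1 / d!` compensates
for the unordered sum. -/
theorem _root_.AlternatingMap.apply_eq_sum_det {α : Type*} [Fintype α] [DecidableEq α] {d : ℕ}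
    (f : (α → ℝ) [⋀^Fin d]→ₗ[ℝ] ℝ) (v : Fin d → α → ℝ) :
    f v = ∑ c : Fin d → α, f (fun l => Pi.single (c l) 1) / (d.factorial : ℝ) *
      Matrix.det (Matrix.of fun l j => v l (c j)) := by
  have h1 : f v = ∑ c : Fin d → α, (∏ l, v l (c l)) * f (fun l => Pi.single (c l) 1) := by
    conv_lhs => rw [show v = fun l => ∑ a, v l a • (Pi.single a 1 : α → ℝ) by
      funext l; exact pi_eq_sum_univ' (v l) ]
    rw [← AlternatingMap.coe_multilinearMap, MultilinearMap.map_sum]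
    refine Finset.sum_congr rfl fun c _ => ?_
    rw [MultilinearMap.map_smul_univ, smul_eq_mul, AlternatingMap.coe_multilinearMap]
  have h2 : ∀ σ : Equiv.Perm (Fin d), f v = ∑ c : Fin d → α, (Equiv.Perm.sign σ : ℤ) *
      (∏ l, v l (c (σ l))) * f (fun l => Pi.single (c l) 1) := by
    intro σ
    rw [h1, ← Equiv.sum_comp (σ.arrowCongr (Equiv.refl α)).symm]
    refine Finset.sum_congr rfl fun c _ => ?_
    have h3 := f.map_perm (fun l => (Pi.single (c l) 1 : α → ℝ)) σ
    have h4 : (fun l => (Pi.single (((σ.arrowCongr (Equiv.refl α)).symm c) l) 1 : α → ℝ)) =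
      (fun l => (Pi.single (c l) 1 : α → ℝ)) ∘ σ := by funext l; rfl
    rw [h4, h3]
    simp only [Equiv.arrowCongr_symm, Equiv.arrowCongr_apply, Units.smul_def, zsmul_eq_mul]
    simp only [Equiv.refl_symm, Equiv.coe_refl, Function.comp_apply, Equiv.symm_symm, id_eq]
    ring
  have h5 : (d.factorial : ℝ) * f v = ∑ σ : Equiv.Perm (Fin d), f v := by
    simp [Finset.card_univ, Fintype.card_perm]
  have hd : (d.factorial : ℝ) ≠ 0 := by positivity
  rw [← mul_right_inj' hd, h5, Finset.sum_congr rfl fun σ _ => h2 σ, Finset.sum_comm,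
    Finset.mul_sum]
  refine Finset.sum_congr rfl fun c _ => ?_
  rw [← Finset.sum_mul, ← Matrix.det_transpose, Matrix.det_apply']
  simp only [Matrix.transpose_apply, Matrix.of_apply]
  field_simp

/-- The coefficients of a form in the chart `κ`, as functions on `M`. -/
noncomputable def DiffForm.coeff {d : ℕ} {G : Set M} (ω : X.DiffForm d G) (κ : Fin X.r)
    (c : Fin d → Fin (X.n κ) ⊕ Fin (X.m κ)) (x : M) : ℝ :=
  ω.toFun κ x (fun l => Pi.single (c l) 1) / (d.factorial : ℝ)

/-- The compatibility of `ω` moves the pull-back to the chart `κ`, which need not be the chart of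
`P`; there it is expanded in minors. -/
theorem DiffForm.pullbackCoeff_eq_sum {d : ℕ} {G N : Set M} (ω : X.DiffForm d G) (hp : 1 ≤ p)
    (P : X.LocalParam d N) (hN : N ⊆ G) {κ : Fin X.r} {w : Fin d → ℝ} (hw : w ∈ P.domIn κ) :
    ω.pullbackCoeff P w = ∑ c, ω.coeff κ c (P.toM w) * P.jac κ c w := by
  have h1 : ω.pullbackCoeff P w =
      ω.toFun κ (P.toM w) (fun l => fderiv ℝ (P.inChart κ) w (Pi.single l 1)) := by
    rw [pullbackCoeff, ω.compatible P.i κ _ (hN (P.toM_mem hw.1)) (P.toM_mem_source hw.1) hw.2,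
      P.chart_toM hw.1, (P.hasFDerivAt_inChart hp hw).fderiv]
    rfl
  rw [h1]
  refine ((ω.toFun κ (P.toM w)).toAlternatingMap.apply_eq_sum_det _).trans ?_
  refine Finset.sum_congr rfl fun c _ => ?_
  rw [P.jac_eq_det hp c hw]
  rfl

end DefinableManifold

end OMin

namespace OMin

namespace DefinableManifold

variable {L : Language} [L.Structure ℝ] {k : Subfield ℝ} {p : ℕ∞}
  {M : Type*} [TopologicalSpace M] {X : DefinableManifold L k p M}

/-! ### Nondegenerate coordinate projections and signs -/

namespace LocalParam

variable {d : ℕ} {N N' : Set M}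

theorem hasStrictFDerivAt_coords (P : X.LocalParam d N) (hp : 1 ≤ p) {κ : Fin X.r}
    {c : Fin d → Fin (X.n κ) ⊕ Fin (X.m κ)} {w : Fin d → ℝ} (hw : w ∈ P.domIn κ)
    (hj : P.jac κ c w ≠ 0) :
    HasStrictFDerivAt (P.coords κ c)
      ((fderiv ℝ (P.coords κ c) w).toContinuousLinearEquivOfDetNeZero hj :
        (Fin d → ℝ) →L[ℝ] (Fin d → ℝ)) w :=
  (P.contDiffAt_coords c hw).hasStrictFDerivAt (coe_ne_zero hp)

/-- If a coordinate projection is nondegenerate on `N'` at a point, then the change of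
parametrization between `N` and `N'` is differentiable there. -/
theorem exists_baseChange (hp : 1 ≤ p) (P : X.LocalParam d N) (Q : X.LocalParam d N')
    {κ : Fin X.r} {w v : Fin d → ℝ} (hw : w ∈ P.domIn κ) (hv : v ∈ Q.W)
    (hPQ : P.toM w = Q.toM v) (hN : ∀ᶠ z in 𝓝 (P.toM w), z ∈ N → z ∈ N')
    (c : Fin d → Fin (X.n κ) ⊕ Fin (X.m κ)) (hj : Q.jac κ c v ≠ 0) :
    ∃ T : (Fin d → ℝ) →L[ℝ] (Fin d → ℝ),
      (X.transitionDeriv P.i Q.i (P.ψ w)).comp (fderiv ℝ P.ψ w) = (fderiv ℝ Q.ψ v).comp T ∧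
      P.jac κ c w = Q.jac κ c v * T.det := by
  have hv' : v ∈ Q.domIn κ := ⟨hv, hPQ ▸ hw.2⟩
  have hF := Q.hasStrictFDerivAt_coords hp hv' hj
  set e := (fderiv ℝ (Q.coords κ c) v).toContinuousLinearEquivOfDetNeZero hj with he
  set I := hF.localInverse _ _ _ with hI
  have hleft : ∀ᶠ u in 𝓝 v, I (Q.coords κ c u) = u := hF.eventually_left_inverse
  have hId : HasStrictFDerivAt I (e.symm : (Fin d → ℝ) →L[ℝ] _) (Q.coords κ c v) :=
    hF.to_localInverse
  have hcoords : P.coords κ c w = Q.coords κ c v := by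
    funext l; simp only [coords, inChart, hPQ]
  have hPc := (P.hasFDerivAt_coords hp c hw).differentiableAt.hasFDerivAt
  -- The change of parametrization: read off the coordinates `c` from `P`, then recover the
  -- parameter of `Q` by the inverse function theorem.
  let Φ : (Fin d → ℝ) → (Fin d → ℝ) := fun u => I (P.coords κ c u)
  let T : (Fin d → ℝ) →L[ℝ] (Fin d → ℝ) :=
    (e.symm : (Fin d → ℝ) →L[ℝ] _).comp (fderiv ℝ (P.coords κ c) w)
  have hΦ : HasFDerivAt Φ T w := by
    rw [← hcoords] at hId
    exact hId.hasFDerivAt.comp w hPc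
  have hΦw : Φ w = v := by
    have := hleft.self_of_nhds
    rwa [← hcoords] at this
  -- Near `w`, points of `N` belong to `N'` and are thus in the image of `Q`. Their `Q`-parameter is
  -- close to `v`, where it is determined by the coordinates `c`.
  have hev : ∀ᶠ u in 𝓝 w, Φ u ∈ Q.domIn κ ∧ Q.toM (Φ u) = P.toM u := by
    have hc : ContinuousAt P.toM w := P.continuousOn_toM.continuousAt (P.isOpen_W.mem_nhds hw.1)
    have h1 := Q.exists_mem_of_near hv (Filter.inter_mem hleft ((Q.isOpen_domIn κ).mem_nhds hv'))
    rw [← hPQ] at h1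
    filter_upwards [hc.eventually (hN.and h1), P.isOpen_W.mem_nhds hw.1] with u hu huW
    obtain ⟨v', -, hv'2, hv'3⟩ := hu.2 (hu.1 (P.toM_mem huW))
    have : Φ u = v' := by
      have h2 : P.coords κ c u = Q.coords κ c v' := by
        funext l; simp only [coords, inChart, hv'3]
      show I (P.coords κ c u) = v'
      rw [h2]
      exact hv'2.1
    rw [this]
    exact ⟨hv'2.2, hv'3⟩
  have hwQ : w ∈ P.domIn Q.i := ⟨hw.1, hPQ ▸ Q.toM_mem_source hv⟩
  refine ⟨T, ?_, ?_⟩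
  · have h1 := P.hasFDerivAt_inChart hp hwQ
    have h2 : HasFDerivAt (fun u => Q.ψ (Φ u)) ((fderiv ℝ Q.ψ v).comp T) w :=
      HasFDerivAt.comp w (by rw [hΦw]; exact Q.hasFDerivAt_ψ hp hv) hΦ
    refine h1.unique (h2.congr_of_eventuallyEq ?_)
    filter_upwards [hev] with u hu
    rw [inChart, ← hu.2, Q.chart_toM hu.1.1]
  · have h1 : fderiv ℝ (P.coords κ c) w = (fderiv ℝ (Q.coords κ c) v).comp T := by
      ext1 u
      have : (e : (Fin d → ℝ) →L[ℝ] _) = fderiv ℝ (Q.coords κ c) v := by rw [he]; rfl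
      rw [← this]
      simp [T]
    rw [jac, h1]
    exact LinearMap.det_comp _ _

/-- The sign of the orientation relative to the coordinates `c`. -/
noncomputable def orientedSign (s : ℤˣ) (j : ℝ) : ℤ := (s : ℤ) * (SignType.sign j : ℤ)

/-- A base change multiplies the sign of the Jacobian and the sign of the induced basis by the same
sign of `T.det`, so that their product does not depend on the parametrization. -/
theorem orientedSign_eq (hp : 1 ≤ p) (P : X.LocalParam d N) (Q : X.LocalParam d N')
    {κ : Fin X.r} {w v : Fin d → ℝ} (hw : w ∈ P.domIn κ) (hv : v ∈ Q.W)
    (hPQ : P.toM w = Q.toM v) (hN : ∀ᶠ z in 𝓝 (P.toM w), z ∈ N → z ∈ N')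
    {c : Fin d → Fin (X.n κ) ⊕ Fin (X.m κ)} (hj : Q.jac κ c v ≠ 0) (hjP : P.jac κ c w ≠ 0)
    {s t : ℤˣ} (h : SignsAgree P w s Q v t) :
    orientedSign s (P.jac κ c w) = orientedSign t (Q.jac κ c v) := by
  obtain ⟨T, h1, h2⟩ := P.exists_baseChange hp Q hw hv hPQ hN c hj
  obtain ⟨h3, h4⟩ := h T h1
  rw [orientedSign, orientedSign, h2, sign_mul]
  rcases lt_trichotomy T.det 0 with h0 | h0 | h0
  · rw [h4 h0, sign_neg h0]; simp
  · rw [h2, h0, mul_zero] at hjP; exact absurd rfl hjP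
  · rw [h3 h0, sign_pos h0]; simp

/-- The points of `N`, in the chart `κ`, near which the coordinates `c` are bi-Lipschitz
on `N`. -/
def _root_.OMin.DefinableManifold.lipSet (X : DefinableManifold L k p M) {d : ℕ} (κ : Fin X.r)
    (c : Fin d → Fin (X.n κ) ⊕ Fin (X.m κ)) (N : Set M) : Set (X.Coord κ) :=
  {y | y ∈ X.chartImage κ N ∧ ∃ C : ℝ, ∃ ε : ℝ, 0 < ε ∧ ∀ z, z ∈ X.chartImage κ N →
    ∀ z', z' ∈ X.chartImage κ N → dist z y < ε → dist z' y < ε →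
      dist z z' ≤ C * dist (fun l => z (c l)) (fun l => z' (c l))}

theorem exists_inChart_of_near (P : X.LocalParam d N) {κ : Fin X.r} {w : Fin d → ℝ}
    (hw : w ∈ P.domIn κ) {O : Set (Fin d → ℝ)} (hO : O ∈ 𝓝 w) :
    ∀ᶠ z in 𝓝 (P.inChart κ w), z ∈ X.chartImage κ N →
      ∃ v ∈ P.domIn κ, v ∈ O ∧ P.inChart κ v = z := by
  have h1 := P.exists_mem_of_near hw.1 hO
  rw [← P.chart_symm_inChart hw] at h1
  have h2 := (X.continuousOn_symm κ) _ (mem_chartImage.1 (P.inChart_mem hw)).1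
  have h3 := h2.eventually h1
  rw [eventually_nhdsWithin_iff] at h3
  filter_upwards [h3] with z hz hzN
  obtain ⟨hzt, hzN⟩ := mem_chartImage.1 hzN
  obtain ⟨v, hv, hvO, hvz⟩ := hz hzt hzN
  refine ⟨v, ⟨hv, ?_⟩, hvO, ?_⟩
  · rw [hvz]; exact (X.chart κ).map_target hzt
  · rw [inChart, hvz, (X.chart κ).right_inv hzt]

/-- Both the parametrization and the local inverse of its coordinates are Lipschitz; the product of
the two constants serves as `C`. -/
theorem inChart_mem_lipSet (P : X.LocalParam d N) (hp : 1 ≤ p) {κ : Fin X.r}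
    {c : Fin d → Fin (X.n κ) ⊕ Fin (X.m κ)} {w : Fin d → ℝ} (hw : w ∈ P.domIn κ)
    (hj : P.jac κ c w ≠ 0) : P.inChart κ w ∈ X.lipSet κ c N := by
  have hF := P.hasStrictFDerivAt_coords hp hw hj
  have hleft : ∀ᶠ u in 𝓝 w, hF.localInverse _ _ _ (P.coords κ c u) = u := hF.eventually_left_inverse
  obtain ⟨K, s, hs, hK⟩ := hF.to_localInverse.exists_lipschitzOnWith
  obtain ⟨K', s', hs', hK'⟩ :=
    ((P.contDiffAt_inChart hw).hasStrictFDerivAt (coe_ne_zero hp)).exists_lipschitzOnWith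
  have hO : {u | hF.localInverse _ _ _ (P.coords κ c u) = u ∧ P.coords κ c u ∈ s ∧ u ∈ s'} ∈ 𝓝 w :=
    hleft.and (((P.contDiffAt_coords c hw).continuousAt.eventually hs).and hs')
  obtain ⟨ε, hε, h⟩ := Metric.eventually_nhds_iff.1 (P.exists_inChart_of_near hw hO)
  refine ⟨P.inChart_mem hw, K' * K, ε, hε, fun z hz z' hz' hd hd' => ?_⟩
  obtain ⟨v, hv, ⟨h1, h2, h3⟩, rfl⟩ := h hd hz
  obtain ⟨v', hv', ⟨h1', h2', h3'⟩, rfl⟩ := h hd' hz'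
  calc dist (P.inChart κ v) (P.inChart κ v') ≤ K' * dist v v' := hK'.dist_le_mul _ h3 _ h3'
    _ ≤ K' * (K * dist (P.coords κ c v) (P.coords κ c v')) := by
      refine mul_le_mul_of_nonneg_left ?_ K'.2
      have := hK.dist_le_mul _ h2 _ h2'
      rwa [h1, h1'] at this
    _ = _ := by rw [mul_assoc]; rfl

theorem injective_fderiv_inChart (P : X.LocalParam d N) (hp : 1 ≤ p) {κ : Fin X.r}
    {w : Fin d → ℝ} (hw : w ∈ P.domIn κ) : Function.Injective (fderiv ℝ (P.inChart κ) w) := by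
  have h1 := (P.hasFDerivAt_inChart hp hw).differentiableAt.hasFDerivAt
  have hev : ∀ᶠ v in 𝓝 w, P.inChart κ v ∈ (X.transition κ P.i).source := by
    filter_upwards [(P.isOpen_domIn κ).mem_nhds hw] with v hv
    rw [X.mem_transition_source, P.chart_symm_inChart hv]
    exact ⟨(X.chart κ).map_source hv.2, P.toM_mem_source hv.1⟩
  have h2 := X.hasFDerivAt_transition_comp hp h1 hev
  have h3 : fderiv ℝ P.ψ w = _ := ((P.hasFDerivAt_ψ hp hw.1).congr_of_eventuallyEq (by
    filter_upwards [(P.isOpen_domIn κ).mem_nhds hw] with v hv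
    rw [X.transition_apply, P.chart_symm_inChart hv, P.chart_toM hv.1])).unique h2
  have h4 := P.immersion w hw.1
  rw [h3] at h4
  exact Function.Injective.of_comp h4

/-- Along a kernel vector of the coordinate derivative, the parametrization moves with nonzero
speed, being an immersion, while its coordinates `c` have speed zero. This violates the Lipschitz
estimate. -/
theorem jac_ne_zero_of_mem_lipSet (P : X.LocalParam d N) (hp : 1 ≤ p) {κ : Fin X.r}
    {c : Fin d → Fin (X.n κ) ⊕ Fin (X.m κ)} {w : Fin d → ℝ} (hw : w ∈ P.domIn κ)
    (h : P.inChart κ w ∈ X.lipSet κ c N) : P.jac κ c w ≠ 0 := by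
  intro hj
  obtain ⟨-, C, ε, hε, hC⟩ := h
  obtain ⟨u, hu0, hu⟩ : ∃ u, u ≠ 0 ∧ fderiv ℝ (P.coords κ c) w u = 0 := by
    have := LinearMap.bot_lt_ker_of_det_eq_zero
      (f := (fderiv ℝ (P.coords κ c) w : (Fin d → ℝ) →ₗ[ℝ] (Fin d → ℝ))) hj
    obtain ⟨u, hu, hu0⟩ := SetLike.exists_of_lt this
    exact ⟨u, fun h => hu0 (by simpa using h), hu⟩
  have hline : HasDerivAt (fun t : ℝ => w + t • u) u 0 := by
    simpa using ((hasDerivAt_id (0 : ℝ)).smul_const u).const_add w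
  have hw0 : w + (0 : ℝ) • u = w := by simp
  have h1 : HasDerivAt (fun t : ℝ => P.inChart κ (w + t • u)) (fderiv ℝ (P.inChart κ) w u) 0 := by
    have h0 := (P.hasFDerivAt_inChart hp hw).differentiableAt.hasFDerivAt
    rw [← hw0] at h0
    have := HasFDerivAt.comp_hasDerivAt (0 : ℝ) (f := fun t : ℝ => w + t • u) h0 hline
    rw [hw0] at this
    exact this
  have h2 : HasDerivAt (fun t : ℝ => P.coords κ c (w + t • u)) 0 0 := by
    have h0 := (P.hasFDerivAt_coords hp c hw).differentiableAt.hasFDerivAt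
    rw [← hw0] at h0
    have := HasFDerivAt.comp_hasDerivAt (0 : ℝ) (f := fun t : ℝ => w + t • u) h0 hline
    rw [hw0, hu] at this
    exact this
  have hs1 := h1.tendsto_slope_zero.norm
  have hs2 := (h2.tendsto_slope_zero.norm.const_mul C)
  have hdom : ∀ᶠ t in 𝓝 (0 : ℝ), w + t • u ∈ P.domIn κ :=
    hline.continuousAt ((P.isOpen_domIn κ).mem_nhds (by simpa only [hw0] using hw))
  have hnear : ∀ᶠ t in 𝓝 (0 : ℝ), dist (P.inChart κ (w + t • u)) (P.inChart κ w) < ε := by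
    have := Metric.tendsto_nhds.1 h1.continuousAt ε hε
    simpa only [hw0] using this
  have hle := le_of_tendsto_of_tendsto hs1 hs2 (by
    filter_upwards [nhdsWithin_le_nhds hdom, nhdsWithin_le_nhds hnear] with t ht1 ht2
    have := hC _ (P.inChart_mem ht1) _ (P.inChart_mem hw) ht2 (by rwa [dist_self])
    simp only [zero_add, hw0, norm_smul, ← dist_eq_norm]
    calc ‖t⁻¹‖ * dist (P.inChart κ (w + t • u)) (P.inChart κ w)
        ≤ ‖t⁻¹‖ * (C * dist (P.coords κ c (w + t • u)) (P.coords κ c w)) :=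
          mul_le_mul_of_nonneg_left this (norm_nonneg _)
      _ = _ := by ring)
  rw [norm_zero, mul_zero] at hle
  have h0 : fderiv ℝ (P.inChart κ) w u = 0 := norm_le_zero_iff.1 hle
  exact hu0 (P.injective_fderiv_inChart hp hw (h0.trans (map_zero _).symm))

end LocalParam

/-- The estimate forces nearby points with equal coordinates `c` to coincide. The fibre is discrete,
and a discrete subspace of `ℝ^N` is countable. -/
theorem countable_lipSet_fiber {d : ℕ} {N : Set M} (κ : Fin X.r)
    (c : Fin d → Fin (X.n κ) ⊕ Fin (X.m κ)) (x : Fin d → ℝ) :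
    {y | y ∈ X.lipSet κ c N ∧ (fun l => y (c l)) = x}.Countable := by
  set S := {y | y ∈ X.lipSet κ c N ∧ (fun l => y (c l)) = x}
  have : DiscreteTopology S := by
    rw [discreteTopology_iff_isOpen_singleton]
    rintro ⟨y, hy⟩
    obtain ⟨⟨hyN, C, ε, hε, hC⟩, hyx⟩ := hy
    rw [Metric.isOpen_singleton_iff]
    refine ⟨ε, hε, fun z hz => ?_⟩
    have h1 := hC z.1 z.2.1.1 y hyN hz (by rwa [dist_self])
    rw [z.2.2, hyx, dist_self, mul_zero] at h1
    exact Subtype.ext (dist_le_zero.1 h1)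
  exact countable_coe_iff.1 (countable_of_Lindelof_of_discrete (X := S))

/-- The condition quantifies only over points of the definable set and real numbers, never over
parametrizations. -/
theorem defP_lipSet [Fact (ExpandsOrderedField L)] {A : Set ℝ} {d : ℕ} {N : Set M} {κ : Fin X.r}
    (c : Fin d → Fin (X.n κ) ⊕ Fin (X.m κ)) (hN : DefP L A (· ∈ X.chartImage κ N)) :
    DefP L A (· ∈ X.lipSet κ c N) := by
  refine .and hN (.ex (.ex (.and (.lt (by fun_prop) (by fun_prop)) (.all (.imp
    (hN.comp (by fun_prop)) (.all (.imp (hN.comp (by fun_prop)) (.imp (.lt (by fun_prop)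
    (by fun_prop)) (.imp (.lt (by fun_prop) (by fun_prop)) (.le (by fun_prop) ?_))))))))))
  fun_prop

end DefinableManifold

end OMin

namespace OMin

namespace DefinableManifold

variable {L : Language} [L.Structure ℝ] {k : Subfield ℝ} {p : ℕ∞}
  {M : Type*} [TopologicalSpace M] {X : DefinableManifold L k p M}

/-! ### Localization of parametrizations -/

/-- The restriction of a local parametrization to an open set on which `N` and `N'` agree. -/
def LocalParam.restrict {d : ℕ} {N N' : Set M} (P : X.LocalParam d N) (V : Set M) (hV : IsOpen V)
    (h : N ∩ V = N' ∩ V) : X.LocalParam d N' where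
  i := P.i
  W := P.W ∩ P.toM ⁻¹' V
  ψ := P.ψ
  isOpen_W := P.continuousOn_toM.isOpen_inter_preimage P.isOpen_W hV
  mapsTo := P.mapsTo.mono_left inter_subset_left
  contDiffOn := P.contDiffOn.mono inter_subset_left
  immersion := fun w hw => P.immersion w hw.1
  isEmbedding := P.isEmbedding.comp (IsEmbedding.inclusion inter_subset_left)
  isOpen_image := by
    obtain ⟨V', hV', h'⟩ := P.isOpen_image_toM
    refine ⟨V' ∩ V, hV'.inter hV, ?_⟩
    rw [image_image]
    change P.toM '' (P.W ∩ P.toM ⁻¹' V) = _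
    rw [image_inter_preimage, h', inter_comm V' V, ← inter_assoc, ← h, inter_right_comm]

/-- A local parametrization with empty domain. -/
def LocalParam.empty {d : ℕ} (N : Set M) (i : Fin X.r) : X.LocalParam d N where
  i := i
  W := ∅
  ψ := fun _ => 0
  isOpen_W := isOpen_empty
  mapsTo := mapsTo_empty _ _
  contDiffOn := contDiffOn_empty
  immersion := fun _ h => h.elim
  isEmbedding := .of_subsingleton _
  isOpen_image := ⟨∅, isOpen_empty, by simp⟩

namespace PseudoOrientation

variable {d : ℕ} {G : Set M}

theorem subset (o : X.PseudoOrientation d G) : o.U ⊆ G := by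
  obtain ⟨V, -, h⟩ := o.isOpen
  exact fun x hx => (h ▸ hx : x ∈ X.Reg d G ∩ V).1.1

/-- All points of `G` near a regular point are regular too, so `U` and `G` coincide near each point
of `U`, and parametrizations of `G` can be restricted to `U`. -/
theorem isSubmanifold (o : X.PseudoOrientation d G) : X.IsSubmanifold d o.U := by
  obtain ⟨V, hV, h⟩ := o.isOpen
  intro x hx
  have hx' : x ∈ X.Reg d G ∩ V := h ▸ hx
  obtain ⟨⟨hxG, V₁, hV₁, hxV₁, hsub⟩, hxV⟩ := hx'
  obtain ⟨P, w, hw, rfl⟩ := hsub x ⟨hxG, hxV₁⟩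
  refine ⟨P.restrict (V₁ ∩ V) (hV₁.inter hV) ?_, w, ⟨hw, hxV₁, hxV⟩, rfl⟩
  rw [h]
  ext z
  constructor
  · rintro ⟨⟨h1, h2⟩, -, h3⟩
    exact ⟨⟨⟨h1, V₁, hV₁, h2, hsub⟩, h3⟩, h2, h3⟩
  · rintro ⟨⟨⟨h1, -⟩, -⟩, h2, h3⟩
    exact ⟨⟨h1, h2⟩, h2, h3⟩

theorem exists_isOpen_inter_eq (o o' : X.PseudoOrientation d G) :
    ∃ V, IsOpen V ∧ o.U ∩ V = o'.U ∩ V ∧ o.U ∩ o'.U ⊆ V := by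
  obtain ⟨V, hV, h⟩ := o.isOpen
  obtain ⟨V', hV', h'⟩ := o'.isOpen
  refine ⟨V ∩ V', hV.inter hV', ?_, ?_⟩
  · rw [h, h']; ext z; simp only [mem_inter_iff]; tauto
  · rw [h, h']; rintro z ⟨h1, h2⟩; exact ⟨h1.2, h2.2⟩

end PseudoOrientation

/-! ### The sign of an orientation in given coordinates -/

namespace LocalParam

theorem continuousOn_jac {d : ℕ} {N : Set M} (P : X.LocalParam d N) (hp : 1 ≤ p) (κ : Fin X.r)
    (c : Fin d → Fin (X.n κ) ⊕ Fin (X.m κ)) : ContinuousOn (P.jac κ c) (P.domIn κ) :=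
  ContinuousLinearMap.continuous_det.comp_continuousOn
    (ContDiffOn.continuousOn_fderiv_of_isOpen (n := p)
      (fun _ hw => (P.contDiffAt_coords c hw).contDiffWithinAt) (P.isOpen_domIn κ)
      (one_le_coe hp))

end LocalParam

namespace OrientationOn

variable {d : ℕ} {U : Set M}

/-- The sign, at a point of the chart `κ`, of the orientation relative to the coordinates `c`
(zero if `c` are not local coordinates on `U`). -/
noncomputable def signAt (o : X.OrientationOn d U) (κ : Fin X.r)
    (c : Fin d → Fin (X.n κ) ⊕ Fin (X.m κ)) (y : X.Coord κ) : ℤ :=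
  open Classical in
  if h : ∃ Q : X.LocalParam d U × (Fin d → ℝ), Q.2 ∈ Q.1.domIn κ ∧ Q.1.inChart κ Q.2 = y ∧
      Q.1.jac κ c Q.2 ≠ 0 then
    LocalParam.orientedSign (o.sgn h.choose.1 h.choose.2) (h.choose.1.jac κ c h.choose.2)
  else 0

theorem _root_.OMin.DefinableManifold.LocalParam.toM_eq_of_inChart_eq {N N' : Set M}
    {P : X.LocalParam d N} {Q : X.LocalParam d N'} {κ : Fin X.r} {w v : Fin d → ℝ}
    (hw : w ∈ P.domIn κ) (hv : v ∈ Q.domIn κ) (h : P.inChart κ w = Q.inChart κ v) :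
    P.toM w = Q.toM v := by
  rw [← P.chart_symm_inChart hw, h, Q.chart_symm_inChart hv]

/-- The choice in `signAt` is harmless because `orientedSign` does not depend on the
parametrization. -/
theorem signAt_inChart (o : X.OrientationOn d U) (hp : 1 ≤ p) {κ : Fin X.r}
    {c : Fin d → Fin (X.n κ) ⊕ Fin (X.m κ)} (P : X.LocalParam d U) {w : Fin d → ℝ}
    (hw : w ∈ P.domIn κ) (hj : P.jac κ c w ≠ 0) :
    o.signAt κ c (P.inChart κ w) = LocalParam.orientedSign (o.sgn P w) (P.jac κ c w) := by
  have h : ∃ Q : X.LocalParam d U × (Fin d → ℝ), Q.2 ∈ Q.1.domIn κ ∧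
      Q.1.inChart κ Q.2 = P.inChart κ w ∧ Q.1.jac κ c Q.2 ≠ 0 := ⟨⟨P, w⟩, hw, rfl, hj⟩
  rw [signAt, dif_pos h]
  obtain ⟨h1, h2, h3⟩ := h.choose_spec
  have h4 := LocalParam.toM_eq_of_inChart_eq h1 hw h2
  exact LocalParam.orientedSign_eq hp _ P h1 hw.1 h4 (.of_forall fun _ h => h) hj h3
    (o.compatible _ _ _ h1.1 _ hw.1 h4)

theorem eventually_signAt_eq (o : X.OrientationOn d U) (hp : 1 ≤ p) {κ : Fin X.r}
    {c : Fin d → Fin (X.n κ) ⊕ Fin (X.m κ)} (P : X.LocalParam d U) {w : Fin d → ℝ}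
    (hw : w ∈ P.domIn κ) (hj : P.jac κ c w ≠ 0) :
    ∀ᶠ z in 𝓝 (P.inChart κ w), z ∈ X.chartImage κ U →
      o.signAt κ c z = o.signAt κ c (P.inChart κ w) := by
  have hO : {v | o.sgn P v = o.sgn P w ∧ SignType.sign (P.jac κ c v) =
      SignType.sign (P.jac κ c w) ∧ P.jac κ c v ≠ 0} ∈ 𝓝 w := by
    have hc := (P.continuousOn_jac hp κ c).continuousAt ((P.isOpen_domIn κ).mem_nhds hw)
    refine (o.locallyConstant P w hw.1).and (Filter.Eventually.and ?_ (hc.eventually_ne hj))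
    have := (continuousAt_sign_of_ne_zero hj).comp hc
    exact this.eventually (isOpen_discrete {SignType.sign (P.jac κ c w)} |>.mem_nhds rfl)
  filter_upwards [P.exists_inChart_of_near hw hO] with z hz hzU
  obtain ⟨v, hv, ⟨h1, h2, h3⟩, rfl⟩ := hz hzU
  rw [o.signAt_inChart hp P hv h3, o.signAt_inChart hp P hw hj, LocalParam.orientedSign, h1, h2]
  rfl

/-- The sign is locally constant along `U`, hence constant along a continuous section over a
connected set. -/
theorem exists_signAt_eq (o : X.OrientationOn d U) (hp : 1 ≤ p) (hU : X.IsSubmanifold d U)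
    {κ : Fin X.r} {c : Fin d → Fin (X.n κ) ⊕ Fin (X.m κ)} {D : Set (Fin d → ℝ)}
    (hD : IsPreconnected D) {g : (Fin d → ℝ) → X.Coord κ} (hg : ContinuousOn g D)
    (hmem : ∀ x ∈ D, g x ∈ X.lipSet κ c U) :
    ∃ s : ℤ, ∀ x ∈ D, o.signAt κ c (g x) = s := by
  have hc : ContinuousOn (fun x => o.signAt κ c (g x)) D := by
    intro x hx
    obtain ⟨h1, h2⟩ := mem_chartImage.1 (hmem x hx).1
    obtain ⟨P, w, hw, hwx⟩ := hU _ h2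
    have hwκ : w ∈ P.domIn κ := ⟨hw, by rw [hwx]; exact (X.chart κ).map_target h1⟩
    have hwg : P.inChart κ w = g x := by rw [LocalParam.inChart, hwx, (X.chart κ).right_inv h1]
    have hj : P.jac κ c w ≠ 0 := P.jac_ne_zero_of_mem_lipSet hp hwκ (by rw [hwg]; exact hmem x hx)
    have h3 := o.eventually_signAt_eq hp P hwκ hj
    rw [hwg] at h3
    have h4 := (hg x hx).eventually h3
    refine tendsto_nhds_of_eventually_eq ?_
    filter_upwards [h4, self_mem_nhdsWithin] with z hz hzD
    exact hz (hmem z hzD).1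
  rcases D.eq_empty_or_nonempty with rfl | ⟨x₀, hx₀⟩
  · exact ⟨0, fun x hx => hx.elim⟩
  · exact ⟨_, fun x hx => hD.constant hc hx hx₀⟩

end OrientationOn

/-- Two representatives coincide as sets near a common point, so a parametrization of one restricts
to the other, where their orientations agree. -/
theorem PseudoOrientation.Equivalent.orientedSign_eq {d : ℕ} {G : Set M}
    {o o' : X.PseudoOrientation d G} (h : o.Equivalent o') (hp : 1 ≤ p) {κ : Fin X.r}
    {c : Fin d → Fin (X.n κ) ⊕ Fin (X.m κ)} (Q : X.LocalParam d o'.U) {w : Fin d → ℝ}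
    (hw : w ∈ Q.domIn κ) (hj : Q.jac κ c w ≠ 0) (hU : Q.toM w ∈ o.U) :
    LocalParam.orientedSign (o'.orientation.sgn Q w) (Q.jac κ c w) =
      o.orientation.signAt κ c (Q.inChart κ w) := by
  obtain ⟨V, hV, heq, hsub⟩ := o'.exists_isOpen_inter_eq o
  have hwV : Q.toM w ∈ V := hsub ⟨Q.toM_mem hw.1, hU⟩
  let P := Q.restrict V hV heq
  have hwP : w ∈ P.domIn κ := ⟨⟨hw.1, hwV⟩, hw.2⟩
  refine Eq.trans ?_ (o.orientation.signAt_inChart hp P hwP hj).symm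
  refine (LocalParam.orientedSign_eq hp P Q hwP hw.1 rfl ?_ hj hj
    (h P Q w hwP.1 w hw.1 rfl)).symm
  filter_upwards [hV.mem_nhds hwV] with z hz hzU
  exact (heq.symm ▸ ⟨hzU, hz⟩ : z ∈ o'.U ∩ V).1

theorem LocalParam.inChart_mem_lipSet_of_mem {d : ℕ} {G : Set M}
    {o o' : X.PseudoOrientation d G} (hp : 1 ≤ p) {κ : Fin X.r}
    {c : Fin d → Fin (X.n κ) ⊕ Fin (X.m κ)} (Q : X.LocalParam d o'.U) {w : Fin d → ℝ}
    (hw : w ∈ Q.domIn κ) (hj : Q.jac κ c w ≠ 0) (hU : Q.toM w ∈ o.U) :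
    Q.inChart κ w ∈ X.lipSet κ c o.U := by
  obtain ⟨V, hV, heq, hsub⟩ := o'.exists_isOpen_inter_eq o
  have hwV : Q.toM w ∈ V := hsub ⟨Q.toM_mem hw.1, hU⟩
  exact (Q.restrict V hV heq).inChart_mem_lipSet hp (κ := κ) (w := w) ⟨⟨hw.1, hwV⟩, hw.2⟩ hj

/-! ### Null sets -/

/-- Locally, the set is contained in the image of part of `Z` under a Lipschitz inverse of the
coordinates, and such images of null sets are null. -/
theorem LocalParam.volume_coords_mem_eq_zero {d : ℕ} {N : Set M} (P : X.LocalParam d N)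
    (hp : 1 ≤ p) {κ : Fin X.r} (c : Fin d → Fin (X.n κ) ⊕ Fin (X.m κ)) {Z : Set (Fin d → ℝ)}
    (hZ : volume Z = 0) :
    volume {w | w ∈ P.domIn κ ∧ P.jac κ c w ≠ 0 ∧ P.coords κ c w ∈ Z} = 0 := by
  refine measure_null_of_locally_null _ fun w ⟨hw, hj, _⟩ => ?_
  have hF := P.hasStrictFDerivAt_coords hp hw hj
  have hleft : ∀ᶠ u in 𝓝 w, hF.localInverse _ _ _ (P.coords κ c u) = u := hF.eventually_left_inverse
  obtain ⟨K, s, hs, hK⟩ := hF.to_localInverse.exists_lipschitzOnWith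
  have h1 := (P.contDiffAt_coords c hw).continuousAt.eventually hs
  refine ⟨_, inter_mem_nhdsWithin _ (hleft.and h1), ?_⟩
  refine measure_mono_null (t := (hF.localInverse _ _ _) '' (s ∩ Z)) ?_ ?_
  · rintro u ⟨⟨-, -, hu⟩, hu1, hu2⟩
    exact ⟨_, ⟨hu2, hu⟩, hu1⟩
  · have h2 := (hK.mono inter_subset_left).hausdorffMeasure_image_le
      (s := s ∩ Z) (d := Fintype.card (Fin d)) (by positivity)
    rw [hausdorffMeasure_pi_real] at h2
    rw [measure_mono_null inter_subset_right hZ, mul_zero] at h2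
    exact nonpos_iff_eq_zero.1 h2

theorem interior_coords_image_eq_empty {d : ℕ} {N : Set M}
    (hN : X.dim N < ((d : ℕ∞) : WithBot ℕ∞)) {κ : Fin X.r}
    (c : Fin d → Fin (X.n κ) ⊕ Fin (X.m κ)) :
    interior ((fun (y : X.Coord κ) l => y (c l)) '' X.chartImage κ N) = ∅ := by
  by_cases hc : Function.Injective c
  · by_contra h
    refine hN.not_ge (le_trans ?_ (le_iSup (fun i => affineDim (X.chartImage i N)) κ))
    exact le_iSup₂_of_le (f := fun (e : ℕ) (_ : ∃ c : Fin e ↪ _, (interior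
      ((fun (x : X.Coord κ) (j : Fin e) => x (c j)) '' X.chartImage κ N)).Nonempty) =>
      ((e : ℕ∞) : WithBot ℕ∞)) d ⟨⟨c, hc⟩, nonempty_iff_ne_empty.2 h⟩ le_rfl
  -- With a repeated coordinate, the image lies in a hyperplane `z a = z b`.
  · obtain ⟨a, b, hab, hne⟩ : ∃ a b, c a = c b ∧ a ≠ b := by
      simpa [Function.Injective] using hc
    rw [eq_empty_iff_forall_notMem]
    intro x hx
    obtain ⟨ε, hε, hball⟩ := Metric.isOpen_iff.1 isOpen_interior x hx
    have hmem : ∀ z ∈ Metric.ball x ε, z a = z b := by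
      intro z hz
      obtain ⟨y, -, rfl⟩ := interior_subset (hball hz)
      show y (c a) = y (c b)
      rw [hab]
    have h1 := hmem x (Metric.mem_ball_self hε)
    have h2 := hmem (x + Pi.single a (ε / 2)) (by
      rw [Metric.mem_ball, dist_self_add_left, Pi.norm_single, Real.norm_eq_abs, abs_of_pos (by positivity)]
      linarith)
    simp [hne.symm, h1] at h2
    linarith

theorem volume_coords_image_eq_zero [Fact (IsOMinimal L)] {d : ℕ} {N : Set M}
    (hdef : X.IsDefinable N) (hN : X.dim N < ((d : ℕ∞) : WithBot ℕ∞)) {κ : Fin X.r}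
    (c : Fin d → Fin (X.n κ) ⊕ Fin (X.m κ)) :
    volume ((fun (y : X.Coord κ) l => y (c l)) '' X.chartImage κ N) = 0 := by
  refine volume_eq_zero_of_interior_eq_empty (L := L) ?_ (interior_coords_image_eq_empty hN c)
  have h : DefP L univ (· ∈ X.chartImage κ N) := DefP.to_univ (A := (k : Set ℝ)) (hdef κ)
  refine (DefP.ex (P := fun (x : Fin d → ℝ) (y : X.Coord κ) => y ∈ X.chartImage κ N ∧
    ∀ l, y (c l) = x l) (.and (h.comp (by fun_prop)) (.finAll fun l => .eq (by fun_prop)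
    (by fun_prop)))).congr fun x => ?_
  simp only [mem_image, funext_iff]

end DefinableManifold

end OMin

namespace OMin

namespace DefinableManifold

variable {L : Language} [L.Structure ℝ] {k : Subfield ℝ} {p : ℕ∞}
  {M : Type*} [TopologicalSpace M] {X : DefinableManifold L k p M}

/-! ### Definable sets in manifolds -/

theorem IsDefinable.defP {N : Set M} (h : X.IsDefinable N) (i : Fin X.r) :
    DefP L (k : Set ℝ) (· ∈ X.chartImage i N) := h i

theorem IsDefinable.of_defP {N : Set M}
    (h : ∀ i, DefP L (k : Set ℝ) (· ∈ X.chartImage i N)) : X.IsDefinable N := h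

theorem IsDefinable.inter {N N' : Set M} (h : X.IsDefinable N) (h' : X.IsDefinable N') :
    X.IsDefinable (N ∩ N') := .of_defP fun i => ((h.defP i).and (h'.defP i)).congr fun y => by
  simp only [mem_chartImage, mem_inter_iff]; tauto

theorem IsDefinable.diff {N N' : Set M} (h : X.IsDefinable N) (h' : X.IsDefinable N') :
    X.IsDefinable (N \ N') := .of_defP fun i => ((h.defP i).and (h'.defP i).not).congr fun y => by
  simp only [mem_chartImage, mem_sdiff]; tauto

theorem IsDefinable.iUnion {ι : Type*} [Finite ι] {N : ι → Set M} (h : ∀ j, X.IsDefinable (N j)) :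
    X.IsDefinable (⋃ j, N j) := .of_defP fun i => (DefP.finEx fun j => (h j).defP i).congr fun y => by
  simp only [mem_chartImage, mem_iUnion, exists_and_left]

theorem defP_transition [Fact (ExpandsOrderedField L)] (i j : Fin X.r) :
    DefP L (k : Set ℝ) (fun q : X.Coord i × X.Coord j =>
      q.1 ∈ (X.transition i j).source ∧ q.2 = X.transition i j q.1) := by
  have h : DefP L (k : Set ℝ) (fun z : ((Fin (X.n i) ⊕ Fin (X.m i)) ⊕ (Fin (X.n j) ⊕ Fin (X.m j)) → ℝ) =>
    (fun a => z (Sum.inl a)) ∈ (X.transition i j).source ∧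
      (fun b => z (Sum.inr b)) = X.transition i j (fun a => z (Sum.inl a))) :=
    X.definable_transition i j
  refine h.comp (f := fun q : X.Coord i × X.Coord j => Sum.elim q.1 q.2) (.pi ?_)
  rintro (a | a)
  · exact (by fun_prop : DefMap L (k : Set ℝ) (fun q : X.Coord i × X.Coord j => q.1 a))
  · exact (by fun_prop : DefMap L (k : Set ℝ) (fun q : X.Coord i × X.Coord j => q.2 a))

theorem isDefinable_symm_image [Fact (ExpandsOrderedField L)] {κ : Fin X.r} {S : Set (X.Coord κ)}
    (hS : DefP L (k : Set ℝ) (· ∈ S)) :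
    X.IsDefinable ((X.chart κ).symm '' (S ∩ (X.chart κ).target)) := .of_defP fun i => by
  refine (DefP.ex (P := fun (y : X.Coord i) (z : X.Coord κ) =>
    (y ∈ (X.transition i κ).source ∧ z = X.transition i κ y) ∧ z ∈ S)
    ((defP_transition i κ).and (hS.comp (by fun_prop)))).congr fun y => ?_
  rw [mem_chartImage]
  constructor
  · rintro ⟨h1, z, ⟨hz, hzt⟩, h2⟩
    refine ⟨z, ⟨X.mem_transition_source.2 ⟨h1, ?_⟩, ?_⟩, hz⟩
    · rw [← h2]; exact (X.chart κ).map_target hzt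
    · rw [X.transition_apply, ← h2, (X.chart κ).right_inv hzt]
  · rintro ⟨z, ⟨h1, h2⟩, h3⟩
    rw [X.mem_transition_source] at h1
    rw [X.transition_apply] at h2
    refine ⟨h1.1, z, ⟨h3, ?_⟩, ?_⟩
    · rw [h2]; exact (X.chart κ).map_source h1.2
    · rw [h2, (X.chart κ).left_inv h1.2]

theorem exists_isCompact_isDefinable_nhds [Fact (ExpandsOrderedField L)] {κ : Fin X.r} {x : M}
    (hx : x ∈ (X.chart κ).source) :
    ∃ C ∈ 𝓝 x, IsCompact C ∧ C ⊆ (X.chart κ).source ∧ X.IsDefinable C := by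
  obtain ⟨O, hO, hOt⟩ := X.isOpen_target κ
  have hxt := (X.chart κ).map_source hx
  rw [hOt] at hxt
  obtain ⟨ε, hε, hball⟩ := Metric.isOpen_iff.1 hO _ hxt.1
  -- Centre and radius are rational so that the neighbourhood is definable over `k`. It is compact
  -- since the quadrant is closed.
  obtain ⟨ρ, hρ0, hρ⟩ := exists_rat_btwn (half_pos hε)
  have hq : ∀ a, ∃ q : ℚ, |X.chart κ x a - q| < ρ := fun a => by
    obtain ⟨q, hq⟩ := exists_rat_near (X.chart κ x a) hρ0
    exact ⟨q, hq⟩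
  choose q hq using hq
  set x₀ : X.Coord κ := fun a => q a
  have hd : dist (X.chart κ x) x₀ < ρ := (dist_pi_lt_iff hρ0).2 fun a => by
    rw [Real.dist_eq]; exact hq a
  have hsub : Metric.closedBall x₀ ρ ⊆ O := fun z hz => hball (by
    rw [Metric.mem_ball]
    have := dist_triangle_right z (X.chart κ x) x₀
    rw [Metric.mem_closedBall] at hz
    linarith)
  have hcpt : IsCompact (Metric.closedBall x₀ ρ ∩ (X.chart κ).target) := by
    have hcl : IsClosed (quadrant (X.n κ) (X.m κ)) := by
      simp only [quadrant, Set.ofPred_forall]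
      exact isClosed_iInter fun j => isClosed_le continuous_const (continuous_apply _)
    rw [hOt, ← inter_assoc, inter_eq_left.2 hsub]
    exact (isCompact_closedBall _ _).inter_right hcl
  refine ⟨(X.chart κ).symm '' (Metric.closedBall x₀ ρ ∩ (X.chart κ).target), ?_,
    hcpt.image_of_continuousOn ((X.continuousOn_symm κ).mono inter_subset_right), ?_,
    isDefinable_symm_image ?_⟩
  · refine Filter.mem_of_superset ((X.chart_isOpen_preimage Metric.isOpen_ball).mem_nhds
      ⟨hx, Metric.mem_ball.2 hd⟩) ?_
    rintro z ⟨hz, hzb⟩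
    exact ⟨_, ⟨Metric.ball_subset_closedBall hzb, (X.chart κ).map_source hz⟩,
      (X.chart κ).left_inv hz⟩
  · rintro _ ⟨z, hz, rfl⟩
    exact (X.chart κ).map_target hz.2
  · simp only [Metric.mem_closedBall]
    exact .le (.dist (by fun_prop) (.pi fun a => .const (ratCast_mem_subfield k _)))
      (.const (ratCast_mem_subfield k _))

/-- A decomposition of a compact definable set into definable pieces with compact closure in the
charts. -/
theorem exists_patches [Fact (ExpandsOrderedField L)] [T2Space M] {G : Set M} (hGc : IsCompact G)
    (hGd : X.IsDefinable G) :
    ∃ K R : Fin X.r → Set M, (∀ κ, IsCompact (K κ) ∧ K κ ⊆ G ∩ (X.chart κ).source) ∧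
      (∀ κ, R κ ⊆ K κ ∧ X.IsDefinable (R κ)) ∧
      ∀ x ∈ G, ∃ κ, x ∈ R κ ∧ ∀ κ', x ∈ R κ' → κ' = κ := by
  have h1 : ∀ x : G, ∃ κ, ∃ C ∈ 𝓝 (x : M), IsCompact C ∧ C ⊆ (X.chart κ).source ∧
      X.IsDefinable C := fun x => by
    obtain ⟨κ, hκ⟩ := X.cover x
    exact ⟨κ, exists_isCompact_isDefinable_nhds hκ⟩
  choose κ C hC hCc hCs hCd using h1
  obtain ⟨t, ht⟩ := hGc.elim_nhds_subcover' (fun x hx => C ⟨x, hx⟩) (fun x hx => hC ⟨x, hx⟩)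
  let K : Fin X.r → Set M := fun j => G ∩ ⋃ x : {x : t // κ x = j}, C x.1
  -- Removing the earlier compact pieces makes the `R j` disjoint while keeping them definable;
  -- compactness survives only for `K j`.
  let R : Fin X.r → Set M := fun j => K j \ ⋃ i : {i : Fin X.r // i < j}, K i
  have hKd : ∀ j, X.IsDefinable (K j) := fun j => hGd.inter (.iUnion fun x => hCd _)
  refine ⟨K, R, fun j => ⟨hGc.inter (isCompact_iUnion fun x => hCc _), ?_⟩,
    fun j => ⟨sdiff_subset, (hKd j).diff (.iUnion fun i => hKd i)⟩, fun x hx => ?_⟩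
  · refine inter_subset_inter_right _ (iUnion_subset fun x => ?_)
    have := hCs x.1
    rwa [x.2] at this
  · have hex : ∃ j, x ∈ K j := by
      obtain ⟨y, hy, hxy⟩ := mem_iUnion₂.1 (ht hx)
      exact ⟨κ y, hx, mem_iUnion.2 ⟨⟨⟨y, hy⟩, rfl⟩, hxy⟩⟩
    obtain ⟨j, hj, hmin⟩ := wellFounded_lt.has_min {j | x ∈ K j} hex
    have hR : ∀ j', x ∈ R j' ↔ x ∈ K j' ∧ ∀ i < j', x ∉ K i := fun j' => by
      simp only [R, mem_sdiff, mem_iUnion, not_exists, Subtype.forall]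
    refine ⟨j, (hR j).2 ⟨hj, fun i hi hiK => hmin i hiK hi⟩, fun j' hj' => ?_⟩
    rw [hR] at hj'
    exact le_antisymm (not_lt.1 fun h => hj'.2 j h hj) (not_lt.1 (hmin j' hj'.1))

/-- Countably many parametrizations suffice by second countability; each keeps what the previous
ones have not covered. The index `i₀` serves the case `U = ∅`, in which parametrizations are still
required. -/
theorem nonempty_paramPartition [SecondCountableTopology M] {d : ℕ} {U : Set M}
    (hU : X.IsSubmanifold d U) (i₀ : Fin X.r) : Nonempty (X.ParamPartition d U) := by
  rcases U.eq_empty_or_nonempty with rfl | hne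
  · exact ⟨⟨fun _ => .empty ∅ i₀, fun _ => ∅, fun _ => .empty, fun _ => empty_subset _,
      fun _ _ _ => by simp, by simp⟩⟩
  choose P hP using fun x : U => hU x x.2
  choose V hV hPV using fun x : U => (P x).isOpen_image_toM
  have hxV : ∀ x : U, (x : M) ∈ V x := fun x => (hPV x ▸ hP x : (x : M) ∈ U ∩ V x).2
  obtain ⟨T, hT, hTV⟩ := TopologicalSpace.isOpen_iUnion_countable V hV
  have hcov : ∀ x ∈ U, x ∈ ⋃ i, V i := fun x hx => mem_iUnion.2 ⟨⟨x, hx⟩, hxV ⟨x, hx⟩⟩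
  have hTne : T.Nonempty := by
    obtain ⟨x, hx⟩ := hne
    have := hcov x hx
    rw [← hTV] at this
    obtain ⟨y, hy, -⟩ := mem_iUnion₂.1 this
    exact ⟨y, hy⟩
  obtain ⟨f, rfl⟩ := hT.exists_eq_range hTne
  have himg : ∀ n, (P (f n)).toM '' ((P (f n)).W \ (P (f n)).toM ⁻¹' ⋃ m ∈ Iio n, V (f m)) =
      (U ∩ V (f n)) \ ⋃ m ∈ Iio n, V (f m) := fun n => by
    rw [← hPV, image_sdiff_preimage]
  refine ⟨⟨fun n => P (f n), fun n => (P (f n)).W \ (P (f n)).toM ⁻¹' ⋃ m ∈ Iio n, V (f m),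
    fun n => ?_, fun n => sdiff_subset, fun m n hmn => ?_, ?_⟩⟩
  · rw [← sdiff_self_inter]
    exact (P (f n)).isOpen_W.measurableSet.diff ((P (f n)).continuousOn_toM.isOpen_inter_preimage
      (P (f n)).isOpen_W (isOpen_biUnion fun m _ => hV _)).measurableSet
  · show Disjoint _ _
    rw [himg, himg, disjoint_left]
    rintro z ⟨⟨-, hz1⟩, hz2⟩ ⟨⟨-, hz3⟩, hz4⟩
    simp only [mem_iUnion, mem_Iio, not_exists] at hz2 hz4
    rcases hmn.lt_or_gt with h | h
    · exact hz4 m h hz1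
    · exact hz2 n h hz3
  · simp only [himg]
    refine subset_antisymm (iUnion_subset fun n z hz => hz.1.1) fun x hx => ?_
    have := hcov x hx
    rw [← hTV] at this
    obtain ⟨_, ⟨n, rfl⟩, hn⟩ := mem_iUnion₂.1 this
    classical
    have hex : ∃ n, x ∈ V (f n) := ⟨n, hn⟩
    refine mem_iUnion.2 ⟨Nat.find hex, ⟨hx, Nat.find_spec hex⟩, ?_⟩
    simp only [mem_iUnion, mem_Iio, not_exists]
    exact fun m hm => Nat.find_min hex hm

end DefinableManifold

end OMin

namespace OMin

namespace DefinableManifold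

variable {L : Language} [L.Structure ℝ] {k : Subfield ℝ} {p : ℕ∞}
  {M : Type*} [TopologicalSpace M] {X : DefinableManifold L k p M}

/-! ### Integration over a section of a coordinate projection -/

section Section

variable {d : ℕ} {κ : Fin X.r} (c : Fin d → Fin (X.n κ) ⊕ Fin (X.m κ)) {D : Set (Fin d → ℝ)}
  {g : (Fin d → ℝ) → X.Coord κ}

/-- The part of the domain that is mapped to the graph of the section `g` over `D`. -/
def LocalParam.overSection {N : Set M} (P : X.LocalParam d N) (D : Set (Fin d → ℝ))
    (g : (Fin d → ℝ) → X.Coord κ) : Set (Fin d → ℝ) :=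
  {w | w ∈ P.domIn κ ∧ P.coords κ c w ∈ D ∧ g (P.coords κ c w) = P.inChart κ w}

theorem LocalParam.measurableSet_overSection {N : Set M} (P : X.LocalParam d N)
    (hD : IsOpen D) (hg : ContinuousOn g D) : MeasurableSet (P.overSection c D g) := by
  have hc : ContinuousOn (P.coords κ c) (P.domIn κ) := fun w hw =>
    (P.contDiffAt_coords c hw).continuousAt.continuousWithinAt
  have hO := hc.isOpen_inter_preimage (P.isOpen_domIn κ) hD
  have h1 : ContinuousOn (fun w => g (P.coords κ c w) - P.inChart κ w)
      (P.domIn κ ∩ P.coords κ c ⁻¹' D) :=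
    (hg.comp (hc.mono inter_subset_left) fun w hw => hw.2).sub
      ((P.contDiffOn_inChart κ).continuousOn.mono inter_subset_left)
  obtain ⟨u, hu, h⟩ := continuousOn_iff_isClosed.1 h1 {0} isClosed_singleton
  have : P.overSection c D g = u ∩ (P.domIn κ ∩ P.coords κ c ⁻¹' D) := by
    rw [← h]
    ext w
    simp only [overSection, mem_ofPred_eq, mem_inter_iff, mem_preimage, mem_singleton_iff,
      sub_eq_zero]
    tauto
  rw [this]
  exact hu.measurableSet.inter hO.measurableSet

theorem LocalParam.toM_eq_of_overSection {N N' : Set M} {P : X.LocalParam d N}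
    {Q : X.LocalParam d N'} {w v : Fin d → ℝ} (hw : w ∈ P.overSection c D g)
    (hv : v ∈ Q.overSection c D g) (h : P.coords κ c w = Q.coords κ c v) : P.toM w = Q.toM v :=
  toM_eq_of_inChart_eq hw.1 hv.1 (by rw [← hw.2.2, ← hv.2.2, h])

/-- The coefficient of the form along the section `g`. -/
noncomputable def DiffForm.coeffOn {G : Set M} (ω : X.DiffForm d G) (g : (Fin d → ℝ) → X.Coord κ)
    (x : Fin d → ℝ) : ℝ := ω.coeff κ c ((X.chart κ).symm (g x))

theorem DiffForm.continuousOn_coeff {G : Set M} (ω : X.DiffForm d G) :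
    ContinuousOn (ω.coeff κ c) (G ∩ (X.chart κ).source) := by
  have h : Continuous fun f : X.Coord κ [⋀^Fin d]→L[ℝ] ℝ =>
      f (fun l => Pi.single (c l) (1 : ℝ)) :=
    continuous_eval_const (F := X.Coord κ [⋀^Fin d]→L[ℝ] ℝ) _
  exact (h.comp_continuousOn (ω.continuousOn κ)).div_const _

variable {c}

theorem DiffForm.exists_coeffOn_bound {G K : Set M} (ω : X.DiffForm d G) (hK : IsCompact K)
    (hKG : K ⊆ G ∩ (X.chart κ).source) (hgK : ∀ x ∈ D, (X.chart κ).symm (g x) ∈ K) :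
    ∃ C, 0 ≤ C ∧ ∀ x ∈ D, |ω.coeffOn c g x| ≤ C := by
  obtain ⟨C, hC⟩ := hK.exists_bound_of_continuousOn ((ω.continuousOn_coeff c).mono hKG)
  exact ⟨max C 0, le_max_right _ _, fun x hx => (hC _ (hgK x hx)).trans (le_max_left _ _)⟩

theorem exists_norm_le_of_section {G K : Set M} (hK : IsCompact K)
    (hKG : K ⊆ G ∩ (X.chart κ).source) (hgK : ∀ x ∈ D, (X.chart κ).symm (g x) ∈ K)
    (hgt : ∀ x ∈ D, g x ∈ (X.chart κ).target) (hπ : ∀ x ∈ D, ∀ l, g x (c l) = x l) :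
    ∃ C, 0 ≤ C ∧ ∀ x ∈ D, ‖x‖ ≤ C := by
  obtain ⟨C, hC⟩ := hK.exists_bound_of_continuousOn
    ((X.continuousOn_chart κ).mono (hKG.trans inter_subset_right))
  refine ⟨max C 0, le_max_right _ _, fun x hx => (pi_norm_le_iff_of_nonneg (le_max_right _ _)).2
    fun l => ?_⟩
  rw [← hπ x hx l]
  have := hC _ (hgK x hx)
  rw [(X.chart κ).right_inv (hgt x hx)] at this
  exact (norm_le_pi_norm _ _).trans (this.trans (le_max_left _ _))

theorem DiffForm.integrableOn_coeffOn {G K : Set M} (ω : X.DiffForm d G) (hD : IsOpen D)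
    (hg : ContinuousOn g D) (hK : IsCompact K)
    (hKG : K ⊆ G ∩ (X.chart κ).source) (hgK : ∀ x ∈ D, (X.chart κ).symm (g x) ∈ K)
    (hgt : ∀ x ∈ D, g x ∈ (X.chart κ).target) (hπ : ∀ x ∈ D, ∀ l, g x (c l) = x l) :
    IntegrableOn (ω.coeffOn c g) D := by
  obtain ⟨C, -, hC⟩ := ω.exists_coeffOn_bound (c := c) hK hKG hgK
  obtain ⟨B, -, hB⟩ := exists_norm_le_of_section hK hKG hgK hgt hπ
  refine .of_bound ((measure_mono fun x hx => mem_closedBall_zero_iff.2 (hB x hx)).trans_lt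
    (measure_closedBall_lt_top (r := B))) ?_ C ((ae_restrict_iff' hD.measurableSet).2 (.of_forall hC))
  refine ContinuousOn.aestronglyMeasurable ?_ hD.measurableSet
  exact (ω.continuousOn_coeff c).comp ((X.continuousOn_symm κ).comp hg hgt)
    fun x hx => hKG (hgK x hx)

theorem LocalParam.coeffOn_coords {G N : Set M} (P : X.LocalParam d N) (ω : X.DiffForm d G)
    {w : Fin d → ℝ} (hw : w ∈ P.overSection c D g) :
    ω.coeffOn c g (P.coords κ c w) = ω.coeff κ c (P.toM w) := by
  rw [DiffForm.coeffOn, hw.2.2, P.chart_symm_inChart hw.1]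

/-- On the part mapped to the graph of `g`, the coordinates `c` determine the point of `M`. Hence
they are injective on each piece with disjoint images, which fill `D` up to a null set, and the
change of variables applies to each piece. -/
theorem ParamPartition.integral_overSection {G U : Set M} (hp : 1 ≤ p) (Δ : X.ParamPartition d U)
    (hUG : U ⊆ G) (ω : X.DiffForm d G) (hD : IsOpen D) (hg : ContinuousOn g D)
    (hint : IntegrableOn (ω.coeffOn c g) D)
    (hcov : volume (D \ ⋃ l, (Δ.param l).coords κ c '' (Δ.B l ∩ (Δ.param l).overSection c D g)) = 0) :
    (∀ l, IntegrableOn (fun w => ω.coeff κ c ((Δ.param l).toM w) * (Δ.param l).jac κ c w)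
      (Δ.B l ∩ (Δ.param l).overSection c D g)) ∧
    (∀ l, IntegrableOn (fun w => ω.coeff κ c ((Δ.param l).toM w) * |(Δ.param l).jac κ c w|)
      (Δ.B l ∩ (Δ.param l).overSection c D g)) ∧
    (Summable fun l => ∫ w in Δ.B l ∩ (Δ.param l).overSection c D g,
      |ω.coeff κ c ((Δ.param l).toM w) * (Δ.param l).jac κ c w|) ∧
    HasSum (fun l => ∫ w in Δ.B l ∩ (Δ.param l).overSection c D g,
      ω.coeff κ c ((Δ.param l).toM w) * |(Δ.param l).jac κ c w|) (∫ x in D, ω.coeffOn c g x) := by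
  set T : ℕ → Set (Fin d → ℝ) := fun l => Δ.B l ∩ (Δ.param l).overSection c D g with hT
  have hTm : ∀ l, MeasurableSet (T l) := fun l =>
    (Δ.measurableSet l).inter ((Δ.param l).measurableSet_overSection c hD hg)
  have hder : ∀ l, ∀ w ∈ T l, HasFDerivWithinAt ((Δ.param l).coords κ c)
      (fderiv ℝ ((Δ.param l).coords κ c) w) (T l) w := fun l w hw =>
    ((Δ.param l).hasFDerivAt_coords hp c hw.2.1).differentiableAt.hasFDerivAt.hasFDerivWithinAt
  have hinj : ∀ l, InjOn ((Δ.param l).coords κ c) (T l) := fun l w hw v hv h =>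
    (Δ.param l).injOn_toM hw.2.1.1 hv.2.1.1 (LocalParam.toM_eq_of_overSection c hw.2 hv.2 h)
  set im : ℕ → Set (Fin d → ℝ) := fun l => (Δ.param l).coords κ c '' T l with him
  have himm : ∀ l, MeasurableSet (im l) := fun l =>
    measurable_image_of_fderivWithin (hTm l) (hder l) (hinj l)
  have himD : ∀ l, im l ⊆ D := fun l => by rintro _ ⟨w, hw, rfl⟩; exact hw.2.2.1
  have hdisj : Pairwise (Function.onFun Disjoint im) := fun l l' hne => by
    refine disjoint_left.2 ?_
    rintro _ ⟨w, hw, rfl⟩ ⟨v, hv, hvw⟩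
    have h := LocalParam.toM_eq_of_overSection c hv.2 hw.2 hvw
    exact disjoint_left.1 (Δ.disjoint hne) (mem_image_of_mem _ hw.1) (h ▸ mem_image_of_mem _ hv.1)
  have hae : (⋃ l, im l : Set _) =ᵐ[volume] D := by
    refine ae_eq_set.2 ⟨?_, hcov⟩
    rw [sdiff_eq_empty.2 (iUnion_subset himD), measure_empty]
  have hintU : IntegrableOn (ω.coeffOn c g) (⋃ l, im l) := hint.mono_set (iUnion_subset himD)
  have habs : ∀ l, IntegrableOn
      (fun w => |(Δ.param l).jac κ c w| • ω.coeffOn c g ((Δ.param l).coords κ c w)) (T l) :=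
    fun l => (integrableOn_image_iff_integrableOn_abs_det_fderiv_smul volume (hTm l) (hder l)
      (hinj l) _).1 (hint.mono_set (himD l))
  refine ⟨fun l => ?_, fun l => (integrableOn_congr_fun (fun w hw => ?_) (hTm l)).1 (habs l),
    ?_, ?_⟩
  · refine Integrable.mono' (habs l).norm ?_ ((ae_restrict_iff' (hTm l)).2 (.of_forall ?_))
    · refine ContinuousOn.aestronglyMeasurable (ContinuousOn.mul ?_ ?_) (hTm l)
      · exact (ω.continuousOn_coeff c).comp ((Δ.param l).continuousOn_toM.mono fun w hw => hw.2.1.1)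
          fun w hw => ⟨hUG ((Δ.param l).toM_mem hw.2.1.1), hw.2.1.2⟩
      · exact ((Δ.param l).continuousOn_jac hp κ c).mono fun w hw => hw.2.1
    · intro w hw
      rw [LocalParam.coeffOn_coords _ ω hw.2, norm_smul, norm_mul, mul_comm, Real.norm_eq_abs |_|,
        abs_abs]
      rfl
  · simp only [LocalParam.coeffOn_coords _ ω hw.2, smul_eq_mul]
    exact mul_comm _ _
  · have h := (hasSum_integral_iUnion himm hdisj hintU.norm).summable
    refine h.congr fun l => ?_
    rw [integral_image_eq_integral_abs_det_fderiv_smul volume (hTm l) (hder l) (hinj l)]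
    refine setIntegral_congr_fun (hTm l) fun w hw => ?_
    simp only [LocalParam.coeffOn_coords _ ω hw.2, smul_eq_mul, abs_mul, Real.norm_eq_abs]
    exact mul_comm _ _
  · have h := hasSum_integral_iUnion himm hdisj hintU
    rw [setIntegral_congr_set hae] at h
    refine h.congr_fun fun l => ?_
    rw [integral_image_eq_integral_abs_det_fderiv_smul volume (hTm l) (hder l) (hinj l)]
    refine setIntegral_congr_fun (hTm l) fun w hw => ?_
    simp only [LocalParam.coeffOn_coords _ ω hw.2, smul_eq_mul]
    exact mul_comm _ _

end Section

end DefinableManifold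

end OMin

namespace OMin

namespace DefinableManifold

variable {L : Language} [L.Structure ℝ] {k : Subfield ℝ} {p : ℕ∞}
  {M : Type*} [TopologicalSpace M] {X : DefinableManifold L k p M} {d : ℕ} {G : Set M}

/-! ### Systems of sections -/

/-- Definable pieces of `G` in the charts, with definable sections of all the coordinate projections
over them, and the signs of the orientation along the sections. -/
structure OrientedSections (o : X.PseudoOrientation d G) where
  K : Fin X.r → Set M
  R : Fin X.r → Set M
  isCompact_K : ∀ κ, IsCompact (K κ)
  K_subset : ∀ κ, K κ ⊆ G ∩ (X.chart κ).source
  R_subset : ∀ κ, R κ ⊆ K κ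
  exists_mem_R : ∀ x ∈ G, ∃ κ, x ∈ R κ ∧ ∀ κ', x ∈ R κ' → κ' = κ
  J : (κ : Fin X.r) → (Fin d → Fin (X.n κ) ⊕ Fin (X.m κ)) → Type
  D : (κ : Fin X.r) → (c : Fin d → Fin (X.n κ) ⊕ Fin (X.m κ)) → J κ c → Set (Fin d → ℝ)
  g : (κ : Fin X.r) → (c : Fin d → Fin (X.n κ) ⊕ Fin (X.m κ)) → J κ c → (Fin d → ℝ) → X.Coord κ
  isSectionFamily : ∀ κ c, IsSectionFamily L (k : Set ℝ)
    {q : (Fin d → ℝ) × X.Coord κ | q.2 ∈ X.lipSet κ c o.U ∧ q.2 ∈ X.chartImage κ (R κ) ∧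
      (fun l => q.2 (c l)) = q.1} (D κ c) (g κ c)
  volume_exhaust : ∀ κ c, volume {x | ∃ y, (y ∈ X.lipSet κ c o.U ∧ y ∈ X.chartImage κ (R κ) ∧
      (fun l => y (c l)) = x) ∧ ∀ j, x ∈ D κ c j → g κ c j x ≠ y} = 0
  s : (κ : Fin X.r) → (c : Fin d → Fin (X.n κ) ⊕ Fin (X.m κ)) → J κ c → ℤ
  signAt_eq : ∀ κ c j, ∀ x ∈ D κ c j, o.orientation.signAt κ c (g κ c j x) = s κ c j

theorem nonempty_orientedSections [Fact (IsOMinimal L)] [T2Space M] (hp : 1 ≤ p)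
    (hGc : IsCompact G) (hGd : X.IsDefinable G) (o : X.PseudoOrientation d G) :
    Nonempty (OrientedSections o) := by
  obtain ⟨K, R, hK, hR, hcov⟩ := exists_patches hGc hGd
  let E : (κ : Fin X.r) → (Fin d → Fin (X.n κ) ⊕ Fin (X.m κ)) → Set ((Fin d → ℝ) × X.Coord κ) :=
    fun κ c => {q | q.2 ∈ X.lipSet κ c o.U ∧ q.2 ∈ X.chartImage κ (R κ) ∧
      (fun l => q.2 (c l)) = q.1}
  have hE : ∀ κ c, DefP L (k : Set ℝ) (· ∈ E κ c) := fun κ c =>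
    ((defP_lipSet c (o.isDefinable.defP κ)).comp (by fun_prop)).and
      ((((hR κ).2.defP κ).comp (by fun_prop)).and
        ((DefP.finAll (P := fun l (q : (Fin d → ℝ) × X.Coord κ) => q.2 (c l) = q.1 l)
          fun l => .eq (by fun_prop) (by fun_prop)).congr fun q => funext_iff))
  have hcount : ∀ κ c x, {y | (x, y) ∈ E κ c}.Countable := fun κ c x => by
    refine (countable_lipSet_fiber (N := o.U) κ c x).mono ?_
    rintro y ⟨h1, -, h2⟩
    exact ⟨h1, h2⟩
  choose J D g h using fun κ c => (tame_fin d).exists_sections (hE κ c) (hcount κ c)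
  choose s hs using fun κ c j => o.orientation.exists_signAt_eq hp o.isSubmanifold
    ((h κ c).isPreconnected j) ((h κ c).continuousOn j) fun x hx => ((h κ c).mem j x hx).1
  exact ⟨⟨K, R, fun κ => (hK κ).1, fun κ => (hK κ).2, fun κ => (hR κ).1, hcov, J, D, g, h,
    fun κ c => volume_eq_zero_of_interior_eq_empty (L := L)
      ((h κ c).def_exhaust (hE κ c)).to_univ (h κ c).exhaust, s, hs⟩⟩

namespace OrientedSections

variable {o : X.PseudoOrientation d G} (S : OrientedSections o)

/-- The index set of all the sections. -/
abbrev Idx : Type :=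
  Σ (κ : Fin X.r) (c : Fin d → Fin (X.n κ) ⊕ Fin (X.m κ)), S.J κ c

noncomputable instance (κ : Fin X.r) (c : Fin d → Fin (X.n κ) ⊕ Fin (X.m κ)) :
    Fintype (S.J κ c) := @Fintype.ofFinite _ (S.isSectionFamily κ c).finite

/-- The domain of a section. -/
abbrev dom (i : S.Idx) : Set (Fin d → ℝ) := S.D i.1 i.2.1 i.2.2

/-- The section. -/
abbrev sec (i : S.Idx) : (Fin d → ℝ) → X.Coord i.1 := S.g i.1 i.2.1 i.2.2

/-- The sign of the orientation along a section. -/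
abbrev sign (i : S.Idx) : ℤ := S.s i.1 i.2.1 i.2.2

variable (i : S.Idx)

theorem isOpen_dom : IsOpen (S.dom i) := (S.isSectionFamily i.1 i.2.1).isOpen _

theorem continuousOn_sec : ContinuousOn (S.sec i) (S.dom i) :=
  (S.isSectionFamily i.1 i.2.1).continuousOn _

variable {x : Fin d → ℝ}

theorem sec_mem_lipSet (hx : x ∈ S.dom i) : S.sec i x ∈ X.lipSet i.1 i.2.1 o.U :=
  ((S.isSectionFamily i.1 i.2.1).mem _ x hx).1

theorem sec_mem_target (hx : x ∈ S.dom i) : S.sec i x ∈ (X.chart i.1).target :=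
  (mem_chartImage.1 ((S.isSectionFamily i.1 i.2.1).mem _ x hx).2.1).1

theorem symm_sec_mem_R (hx : x ∈ S.dom i) : (X.chart i.1).symm (S.sec i x) ∈ S.R i.1 :=
  (mem_chartImage.1 ((S.isSectionFamily i.1 i.2.1).mem _ x hx).2.1).2

theorem symm_sec_mem_K (hx : x ∈ S.dom i) : (X.chart i.1).symm (S.sec i x) ∈ S.K i.1 :=
  S.R_subset _ (S.symm_sec_mem_R i hx)

theorem sec_apply (hx : x ∈ S.dom i) (l : Fin d) : S.sec i x (i.2.1 l) = x l :=
  congrFun ((S.isSectionFamily i.1 i.2.1).mem _ x hx).2.2 l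

theorem integrableOn_coeffOn (ω : X.DiffForm d G) :
    IntegrableOn (ω.coeffOn i.2.1 (S.sec i)) (S.dom i) :=
  ω.integrableOn_coeffOn (S.isOpen_dom i) (S.continuousOn_sec i) (S.isCompact_K i.1)
    (S.K_subset i.1) (fun _ => S.symm_sec_mem_K i) (fun _ => S.sec_mem_target i)
    fun _ => S.sec_apply i

/-- The integral of the form, computed with the sections. -/
noncomputable def integral (ω : X.DiffForm d G) : ℝ :=
  ∑ i : S.Idx, (S.sign i : ℝ) * ∫ x in S.dom i, ω.coeffOn i.2.1 (S.sec i) x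

variable {o' : X.PseudoOrientation d G}

/-- The part of the domain of a parametrization that is mapped to a section. -/
abbrev preim {N : Set M} (Q : X.LocalParam d N) : Set (Fin d → ℝ) :=
  Q.overSection i.2.1 (S.dom i) (S.sec i)

theorem toM_mem_R {N : Set M} {Q : X.LocalParam d N} {w : Fin d → ℝ} (hw : w ∈ S.preim i Q) :
    Q.toM w ∈ S.R i.1 := by
  have := S.symm_sec_mem_R i hw.2.1
  rwa [show S.sec i _ = _ from hw.2.2, Q.chart_symm_inChart hw.1] at this

/-- A point of the section missed by the partition lies in `G` but not in `o'.U`, a set of dimension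
less than `d`. -/
theorem volume_not_covered [Fact (IsOMinimal L)] (hGd : X.IsDefinable G)
    (Δ : X.ParamPartition d o'.U) :
    volume (S.dom i \ ⋃ l, (Δ.param l).coords i.1 i.2.1 '' (Δ.B l ∩ S.preim i (Δ.param l))) = 0 := by
  refine measure_mono_null ?_
    (volume_coords_image_eq_zero (hGd.diff o'.isDefinable) o'.dim_lt i.2.1)
  rintro x ⟨hx, hx'⟩
  refine ⟨S.sec i x, mem_chartImage.2 ⟨S.sec_mem_target i hx, ?_, fun hU => hx' ?_⟩,
    funext (S.sec_apply i hx)⟩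
  · exact (S.K_subset _ (S.symm_sec_mem_K i hx)).1
  · rw [← Δ.cover] at hU
    obtain ⟨l, w, hw, hwx⟩ := mem_iUnion.1 hU
    have hdom : w ∈ (Δ.param l).domIn i.1 :=
      ⟨Δ.subset l hw, by rw [hwx]; exact (X.chart i.1).map_target (S.sec_mem_target i hx)⟩
    have h1 : (Δ.param l).inChart i.1 w = S.sec i x := by
      rw [LocalParam.inChart, hwx, (X.chart i.1).right_inv (S.sec_mem_target i hx)]
    have h2 : (Δ.param l).coords i.1 i.2.1 w = x := by
      funext j
      rw [LocalParam.coords, h1, S.sec_apply i hx]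
    exact mem_iUnion.2 ⟨l, w, ⟨hw, hdom, by rwa [h2], by rw [h2, h1]⟩, h2⟩

/-- There are two exceptions, both with null projection: points over which the sections do not
exhaust the nondegenerate part of `o.U`, and points of `G` outside `o.U`. Null sets pull back to
null sets where the Jacobian is nonzero. -/
theorem ae_exists_mem_preim [Fact (IsOMinimal L)] (hp : 1 ≤ p) (hGd : X.IsDefinable G)
    (Q : X.LocalParam d o'.U) (κ : Fin X.r) (c : Fin d → Fin (X.n κ) ⊕ Fin (X.m κ)) :
    ∀ᵐ w, w ∈ Q.domIn κ → Q.toM w ∈ S.R κ → Q.jac κ c w ≠ 0 →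
      ∃ j, w ∈ S.preim ⟨κ, c, j⟩ Q := by
  have h1 := Q.volume_coords_mem_eq_zero hp c (S.volume_exhaust κ c)
  have h2 := Q.volume_coords_mem_eq_zero hp c
    (volume_coords_image_eq_zero (hGd.diff o.isDefinable) o.dim_lt c)
  rw [measure_eq_zero_iff_ae_notMem] at h1 h2
  filter_upwards [h1, h2] with w hw1 hw2 hw hR hj
  by_contra! hne
  by_cases hU : Q.toM w ∈ o.U
  · refine hw1 ⟨hw, hj, Q.inChart κ w, ⟨Q.inChart_mem_lipSet_of_mem hp hw hj hU,
      (chart_mem_chartImage hw.2).2 hR, rfl⟩, fun j hD heq => hne j ⟨hw, hD, heq⟩⟩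
  · exact hw2 ⟨hw, hj, Q.inChart κ w, (chart_mem_chartImage hw.2).2
      ⟨o'.subset (Q.toM_mem hw.1), hU⟩, rfl⟩

theorem ae_pullbackCoeff_eq [Fact (IsOMinimal L)] (hp : 1 ≤ p) (hGd : X.IsDefinable G)
    (ω : X.DiffForm d G) (Q : X.LocalParam d o'.U) :
    ∀ᵐ w, w ∈ Q.W → ω.pullbackCoeff Q w = ∑ i : S.Idx, (S.preim i Q).indicator
      (fun w => ω.coeff i.1 i.2.1 (Q.toM w) * Q.jac i.1 i.2.1 w) w := by
  have h := ae_all_iff.2 fun κ => ae_all_iff.2 fun c => S.ae_exists_mem_preim hp hGd Q κ c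
  filter_upwards [h] with w hw hwW
  obtain ⟨κ, hκ, huniq⟩ := S.exists_mem_R _ (o'.subset (Q.toM_mem hwW))
  have hdom : w ∈ Q.domIn κ := ⟨hwW, (S.K_subset _ (S.R_subset _ hκ)).2⟩
  have hF : (∑ i : S.Idx, (S.preim i Q).indicator
      (fun w => ω.coeff i.1 i.2.1 (Q.toM w) * Q.jac i.1 i.2.1 w) w) =
      ∑ κ, ∑ c, ∑ j, (S.preim ⟨κ, c, j⟩ Q).indicator
      (fun w => ω.coeff κ c (Q.toM w) * Q.jac κ c w) w := by
    rw [Fintype.sum_sigma]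
    exact Finset.sum_congr rfl fun κ _ => Fintype.sum_sigma _
  rw [hF, ω.pullbackCoeff_eq_sum hp Q o'.subset hdom, Finset.sum_eq_single κ]
  · refine Finset.sum_congr rfl fun c _ => ?_
    -- A vanishing minor contributes nothing. Otherwise exactly one section passes through the
    -- point, by disjointness of the graphs.
    by_cases hj : Q.jac κ c w = 0
    · rw [hj, mul_zero]
      refine (Finset.sum_eq_zero fun j _ => indicator_apply_eq_zero.2 fun _ => ?_).symm
      rw [hj, mul_zero]
    · obtain ⟨j, hwj⟩ := hw κ c hdom hκ hj
      rw [Finset.sum_eq_single j, indicator_of_mem hwj]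
      · intro j' _ hne
        refine indicator_of_notMem (fun hwj' => ?_) _
        exact (S.isSectionFamily κ c).disjoint j' j _ hne hwj'.2.1 hwj.2.1
          (hwj'.2.2.trans hwj.2.2.symm)
      · exact fun h => absurd (Finset.mem_univ _) h
  · intro κ' _ hne
    refine Finset.sum_eq_zero fun c _ => Finset.sum_eq_zero fun j _ =>
      indicator_of_notMem (fun hw' => hne ?_) _
    exact huniq _ (S.toM_mem_R ⟨κ', c, j⟩ hw')
  · exact fun h => absurd (Finset.mem_univ _) h

/-- The sign of the orientation absorbs the sign of the Jacobian, leaving the constant sign of the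
section and the absolute value that the change of variables produces. -/
theorem sgn_mul_jac (hp : 1 ≤ p) (heq : o.Equivalent o') {Q : X.LocalParam d o'.U}
    {w : Fin d → ℝ} (hw : w ∈ S.preim i Q) :
    (((o'.orientation.sgn Q w : ℤˣ) : ℤ) : ℝ) * Q.jac i.1 i.2.1 w =
      S.sign i * |Q.jac i.1 i.2.1 w| := by
  by_cases hj : Q.jac i.1 i.2.1 w = 0
  · simp [hj]
  have hU : Q.toM w ∈ o.U := by
    have := mem_chartImage.1 (S.sec_mem_lipSet i hw.2.1).1
    rw [show S.sec i _ = _ from hw.2.2, Q.chart_symm_inChart hw.1] at this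
    exact this.2
  have h1 := heq.orientedSign_eq hp Q hw.1 hj hU
  have h2 := S.signAt_eq i.1 i.2.1 i.2.2 _ hw.2.1
  rw [show S.g i.1 i.2.1 i.2.2 _ = _ from hw.2.2] at h2
  rw [sign, ← h2, ← h1, LocalParam.orientedSign]
  push_cast
  rw [mul_assoc]
  congr 1
  rcases lt_or_gt_of_ne hj with h | h
  · simp [sign_neg h, abs_of_neg h]
  · simp [sign_pos h, abs_of_pos h]

/-- The sections are built once, from `o`. Every equivalent `o'` and every partition of `o'.U` is
compared with them, so all give the same value. -/
theorem hasIntegral [Fact (IsOMinimal L)] [SecondCountableTopology M] (hp : 1 ≤ p)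
    (hGd : X.IsDefinable G) (i₀ : Fin X.r) (ω : X.DiffForm d G) :
    o.HasIntegral ω (S.integral ω) := by
  intro o' heq
  refine ⟨nonempty_paramPartition o'.isSubmanifold i₀, fun Δ => ?_⟩
  let T : S.Idx → ℕ → Set (Fin d → ℝ) := fun i l => Δ.B l ∩ S.preim i (Δ.param l)
  let φ : S.Idx → ℕ → (Fin d → ℝ) → ℝ := fun i l w =>
    ω.coeff i.1 i.2.1 ((Δ.param l).toM w) * (Δ.param l).jac i.1 i.2.1 w
  have hover : ∀ i l, MeasurableSet (S.preim i (Δ.param l)) := fun i l =>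
    (Δ.param l).measurableSet_overSection _ (S.isOpen_dom i) (S.continuousOn_sec i)
  have hT : ∀ i l, MeasurableSet (T i l) := fun i l => (Δ.measurableSet l).inter (hover i l)
  have hsec := fun i => Δ.integral_overSection hp o'.subset ω (S.isOpen_dom i)
    (S.continuousOn_sec i) (S.integrableOn_coeffOn i ω) (S.volume_not_covered i hGd Δ)
  have hφ : ∀ i l, IntegrableOn (φ i l) (T i l) := fun i => (hsec i).1
  have hind : ∀ i l, IntegrableOn ((S.preim i (Δ.param l)).indicator (φ i l)) (Δ.B l) :=
    fun i l => by
      rw [IntegrableOn, integrable_indicator_iff (hover i l), IntegrableOn,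
        Measure.restrict_restrict (hover i l), inter_comm]
      exact hφ i l
  have hae : ∀ l, ω.pullbackCoeff (Δ.param l) =ᵐ[volume.restrict (Δ.B l)]
      fun w => ∑ i, (S.preim i (Δ.param l)).indicator (φ i l) w := fun l => by
    refine (ae_restrict_iff' (Δ.measurableSet l)).2 ?_
    filter_upwards [S.ae_pullbackCoeff_eq hp hGd ω (Δ.param l)] with w hw hwB
    exact hw (Δ.subset l hwB)
  have hint : ∀ l, IntegrableOn (ω.pullbackCoeff (Δ.param l)) (Δ.B l) := fun l =>
    (integrable_finsetSum _ fun i _ => hind i l).congr (hae l).symm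
  refine ⟨hint, ?_, ?_⟩
  · refine Summable.of_nonneg_of_le (fun l => integral_nonneg fun w => abs_nonneg _) (fun l => ?_)
      (summable_sum (s := Finset.univ) fun i _ => (hsec i).2.2.1)
    have h1 : ∀ i, ∫ w in T i l, |φ i l w| =
        ∫ w in Δ.B l, |(S.preim i (Δ.param l)).indicator (φ i l) w| := fun i => by
      rw [← setIntegral_indicator (hover i l)]
      refine integral_congr_ae (.of_forall fun w => ?_)
      by_cases hw : w ∈ S.preim i (Δ.param l) <;> simp [hw]
    refine le_trans ?_ (Finset.sum_congr rfl fun i _ => h1 i).ge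
    rw [← integral_finsetSum _ fun i _ => (hind i l).abs]
    refine integral_mono_ae (hint l).abs (integrable_finsetSum _ fun i _ => (hind i l).abs) ?_
    filter_upwards [hae l] with w hw
    simp only [hw]
    exact Finset.abs_sum_le_sum_abs _ _
  · have h2 : HasSum (fun l => ∑ i, (S.sign i : ℝ) * ∫ w in T i l,
        ω.coeff i.1 i.2.1 ((Δ.param l).toM w) * |(Δ.param l).jac i.1 i.2.1 w|) (S.integral ω) :=
      hasSum_sum fun i _ => (hsec i).2.2.2.mul_left _
    refine h2.congr_fun fun l => ?_
    have h3 : ∀ i, (S.sign i : ℝ) * ∫ w in T i l, ω.coeff i.1 i.2.1 ((Δ.param l).toM w) *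
        |(Δ.param l).jac i.1 i.2.1 w| = ∫ w in Δ.B l, (S.preim i (Δ.param l)).indicator
          (fun w => (S.sign i : ℝ) * (ω.coeff i.1 i.2.1 ((Δ.param l).toM w) *
            |(Δ.param l).jac i.1 i.2.1 w|)) w := fun i => by
      rw [setIntegral_indicator (hover i l), integral_const_mul]
    rw [Finset.sum_congr rfl fun i _ => h3 i, ← integral_finsetSum]
    · refine integral_congr_ae ?_
      filter_upwards [hae l] with w hw
      rw [hw, Finset.mul_sum]
      refine Finset.sum_congr rfl fun i _ => ?_
      by_cases hwi : w ∈ S.preim i (Δ.param l)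
      · simp only [indicator_of_mem hwi, φ]
        linear_combination ω.coeff i.1 i.2.1 ((Δ.param l).toM w) * S.sgn_mul_jac i hp heq hwi
      · simp only [indicator_of_notMem hwi, mul_zero]
    · intro i _
      rw [integrable_indicator_iff (hover i l), IntegrableOn,
        Measure.restrict_restrict (hover i l), inter_comm]
      exact ((hsec i).2.1 l).const_mul _

end OrientedSections

end DefinableManifold

end OMin

namespace OMin

namespace DefinableManifold

variable {L : Language} [L.Structure ℝ] {k : Subfield ℝ} {p : ℕ∞}
  {M : Type*} [TopologicalSpace M] {X : DefinableManifold L k p M} {d : ℕ} {G : Set M}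

/-! ### The integral of a definable form as a volume -/

/-- Extension by zero is needed because nothing is known about the form along `g` outside `D`. -/
theorem DiffForm.IsDefinable.defMap_coeffOn [Fact (ExpandsOrderedField L)] {ω : X.DiffForm d G}
    (hω : ω.IsDefinable) {κ : Fin X.r} {c : Fin d → Fin (X.n κ) ⊕ Fin (X.m κ)}
    {D : Set (Fin d → ℝ)} {g : (Fin d → ℝ) → X.Coord κ} (hD : DefP L (k : Set ℝ) (· ∈ D))
    (hg : DefMap L (k : Set ℝ) g) (hgG : ∀ x ∈ D, g x ∈ X.chartImage κ G) :
    DefMap L (k : Set ℝ) (D.indicator (ω.coeffOn c g)) := by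
  have h1 : DefP L (k : Set ℝ) (fun z : ((Fin (X.n κ) ⊕ Fin (X.m κ)) ⊕ Unit → ℝ) =>
      (fun a => z (Sum.inl a)) ∈ X.chartImage κ G ∧ (fun b => z (Sum.inr b)) = fun _ =>
        ω.toFun κ ((X.chart κ).symm fun a => z (Sum.inl a)) (fun l => Pi.single (c l) (1 : ℝ))) :=
    hω κ c
  have h2 : DefP L (k : Set ℝ) (fun q : (Fin d → ℝ) × ℝ =>
      g q.1 ∈ X.chartImage κ G ∧ (fun _ : Unit => q.2) = fun _ =>
        ω.toFun κ ((X.chart κ).symm (g q.1)) (fun l => Pi.single (c l) (1 : ℝ))) := by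
    refine h1.comp (f := fun q : (Fin d → ℝ) × ℝ => Sum.elim (g q.1) (fun _ => q.2)) (.pi ?_)
    rintro (a | a)
    · exact (by fun_prop : DefMap L (k : Set ℝ) (fun q : (Fin d → ℝ) × ℝ => g q.1 a))
    · exact (by fun_prop : DefMap L (k : Set ℝ) (fun q : (Fin d → ℝ) × ℝ => q.2))
  have hd : ((d.factorial : ℕ) : ℝ) ∈ (k : Set ℝ) := natCast_mem k _
  have hd0 : ((d.factorial : ℕ) : ℝ) ≠ 0 := by positivity
  have hD' : DefP L (k : Set ℝ) (fun q : (Fin d → ℝ) × ℝ => q.1 ∈ D) := hD.comp (by fun_prop)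
  -- The hypothesis concerns the values on basis vectors, which are `d!` times `coeff`.
  have h3 : DefP L (k : Set ℝ) (fun q : (Fin d → ℝ) × ℝ => _) :=
    (hD'.and (h2.comp (f := fun q : (Fin d → ℝ) × ℝ => (q.1, q.2 * (d.factorial : ℝ)))
      (.prodMk (by fun_prop) (.mul (by fun_prop) (.const hd))))).or
      (hD'.not.and (.eq (f := fun q => q.2) (g := fun _ => 0) (by fun_prop) (by fun_prop)))
  refine .of_graph (h3.congr fun q => ?_)
  by_cases hq : q.1 ∈ D
  · simp only [hq, indicator_of_mem, coeffOn, coeff, eq_div_iff hd0, hgG _ hq, true_and, not_true,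
      false_and, or_false, funext_iff, forall_const]
  · simp only [hq, indicator_of_notMem, not_false_eq_true, false_and, true_and, false_or]

/-- All sections live over the same `ℝ^d`, so the signed sum of their integrals is the integral of
one definable function, bounded and with bounded support by compactness. -/
theorem OrientedSections.exists_volume_eq_integral [Fact (IsOMinimal L)]
    {o : X.PseudoOrientation d G} (S : OrientedSections o) {ω : X.DiffForm d G}
    (hω : ω.IsDefinable) :
    ∃ V : Set (Fin (d + 1) → ℝ), (k : Set ℝ).Definable L V ∧ IsOpen V ∧ Bornology.IsBounded V ∧
      (S.integral ω = (volume V).toReal ∨ S.integral ω = -(volume V).toReal) := by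
  choose C hC0 hC using fun i : S.Idx => ω.exists_coeffOn_bound (c := i.2.1) (S.isCompact_K i.1)
    (S.K_subset i.1) (fun x => S.symm_sec_mem_K (x := x) i)
  choose N hN0 hN using fun i : S.Idx => exists_norm_le_of_section (c := i.2.1)
    (S.isCompact_K i.1) (S.K_subset i.1) (fun x => S.symm_sec_mem_K (x := x) i)
    (fun x => S.sec_mem_target i) (fun x => S.sec_apply i)
  let h : (Fin d → ℝ) → ℝ := fun x => ∑ i : S.Idx,
    (S.sign i : ℝ) * (S.dom i).indicator (ω.coeffOn i.2.1 (S.sec i)) x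
  have hh : DefMap L (k : Set ℝ) h := .finsum fun i => .mul (.const (intCast_mem k _))
    (hω.defMap_coeffOn ((S.isSectionFamily i.1 i.2.1).def_dom _)
      ((S.isSectionFamily i.1 i.2.1).def_map _) fun x hx => mem_chartImage.2
      ⟨S.sec_mem_target i hx, (S.K_subset _ (S.symm_sec_mem_K i hx)).1⟩)
  have hbd : ∀ x, |h x| ≤ ∑ i : S.Idx, |(S.sign i : ℝ)| * C i := fun x => by
    refine (Finset.abs_sum_le_sum_abs _ _).trans (Finset.sum_le_sum fun i _ => ?_)
    rw [abs_mul]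
    refine mul_le_mul_of_nonneg_left ?_ (abs_nonneg _)
    by_cases hx : x ∈ S.dom i
    · rw [indicator_of_mem hx]; exact hC i x hx
    · rw [indicator_of_notMem hx, abs_zero]; exact hC0 i
  have hsupp : ∀ x, h x ≠ 0 → ‖x‖ ≤ ∑ i : S.Idx, N i := fun x hx => by
    obtain ⟨i, -, hi⟩ := Finset.exists_ne_zero_of_sum_ne_zero hx
    have : x ∈ S.dom i := by
      by_contra hxi
      exact hi (by rw [indicator_of_notMem hxi, mul_zero])
    exact (hN i x this).trans (Finset.single_le_sum (fun i _ => hN0 i) (Finset.mem_univ i))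
  have hI : S.integral ω = ∫ x, h x := by
    rw [integral, integral_finsetSum]
    · refine Finset.sum_congr rfl fun i _ => ?_
      rw [integral_const_mul, integral_indicator (S.isOpen_dom i).measurableSet]
    · exact fun i _ => ((integrable_indicator_iff (S.isOpen_dom i).measurableSet).2
        (S.integrableOn_coeffOn i ω)).const_mul _
  rw [hI]
  exact OMin.exists_volume_eq_integral k hh hbd hsupp

theorem exists_chart_of_dim_eq (h : X.dim G = ((d : ℕ∞) : WithBot ℕ∞)) : Nonempty (Fin X.r) := by
  by_contra hne
  rw [not_nonempty_iff] at hne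
  rw [dim, iSup_of_empty] at h
  exact absurd h.symm (WithBot.coe_ne_bot)

end DefinableManifold

end OMin

theorem mainTheorem6
    (L : FirstOrder.Language) [L.Structure ℝ] (hL : OMin.IsOMinimal L) (k : Subfield ℝ)
    (p : ℕ∞) (hp : 1 ≤ p)
    (M : Type*) [TopologicalSpace M] [T2Space M] [SecondCountableTopology M]
    (X : OMin.DefinableManifold L k p M)
    (d : ℕ) (G : Set M) (hGc : IsCompact G) (hGd : X.IsDefinable G)
    (hdim : X.dim G = ((d : ℕ∞) : WithBot ℕ∞))
    (o : X.PseudoOrientation d G) (ω : X.DiffForm d G) :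
    ∃ I : ℝ, o.HasIntegral ω I ∧
      (ω.IsDefinable →
        ∃ S : Set (Fin (d + 1) → ℝ), (k : Set ℝ).Definable L S ∧ IsOpen S ∧
          Bornology.IsBounded S ∧
          (I = (MeasureTheory.volume S).toReal ∨ I = -(MeasureTheory.volume S).toReal)) := by
  have : Fact (OMin.IsOMinimal L) := ⟨hL⟩
  -- Without charts the dimension would be `⊥`, so `hdim` provides one.
  obtain ⟨i₀⟩ := OMin.DefinableManifold.exists_chart_of_dim_eq hdim
  obtain ⟨S⟩ := OMin.DefinableManifold.nonempty_orientedSections hp hGc hGd o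
  exact ⟨S.integral ω, S.hasIntegral hp hGd i₀ ω, S.exists_volume_eq_integral⟩
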